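/- **Quantum sets.** A quantum set $\mathcal X$ is a family of nonzero finite-dimensional complex Hilbert spaces, its atoms; $\mathrm{At}(\mathcal X)$ is the collection of atoms. The atoms of the dual $\mathcal X^*$ are the duals $X^*=L(X,\mathbb C)$, $X\in\mathrm{At}(\mathcal X)$; the atoms of $\mathcal X\times\mathcal Y$ are the $X\otimes Y$; $\mathbf 1$ has the single atom $\mathbb C$. An ordinary set $A$ gives the quantum set ${}^{\backprime}A$ with one one-dimensional atom $\mathbb C_a$ for each $a\in A$. A binary relation $R$ from $\mathcal X$ to $\mathcal Y$ assigns to all atoms $X,Y$ a subspace $R(X,Y)\subseteq L(X,Y)$; relations are ordered by atomwise inclusion. Put $(S\circ R)(X,Z)=\mathrm{span}\bigcup_Y S(Y,Z)R(X,Y)$, $R^\dagger(Y,X)=\{r^\dagger: r\in R(X,Y)\}$, $R_*(X^*,Y^*)=\{(r^\dagger)^* : r\in R(X,Y)\}$, where $s^*$ denotes the transpose (precomposition with $s$), and $(R\times S)(X\otimes Z,Y\otimes W)=\mathrm{span}\{r\otimes s: r\in R(X,Y),\, s\in S(Z,W)\}$; $I_{\mathcal X}$ has $I_{\mathcal X}(X,X)=\mathbb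 C1$ and zero off-diagonal components. A function $F:\mathcal X\to\mathcal Y$ is a binary relation with $F\circ F^\dagger\le I_{\mathcal Y}$ and $F^\dagger\circ F\ge I_{\mathcal X}$. A binary relation, operation or element for an ordinary set $A$ gives a binary relation ${}^{\backprime}r$ on ${}^{\backprime}A$, a function ${}^{\backprime}A\times{}^{\backprime}A\to{}^{\backprime}A$ or a function $\mathbf 1\to{}^{\backprime}A$, respectively, whose components are everything where the classical relation holds and zero elsewhere. The conjugation function $C_A:{}^{\backprime}A\to({}^{\backprime}A)^*$ has $C_A(\mathbb C_a,\mathbb C_a^*)=L(\mathbb C_a,\mathbb C_a^*)$ and other components zero. Canonical isomorphisms of products, and $(\mathcal X\times\mathcal Y)^*\cong\mathcal X^*\times\mathcal Y^*$, $\mathcal X^{**}\cong\mathcal X$, $\mathbf 1^*\cong\mathbf 1$, are used tacitly. **Logic.** A relation of arity $(\mathcal X_1,\dots,\mathcal X_n)$ is a binary relation from $\mathcal X_1\times\cdots\times\mathcal X_n$ to $\mathbf 1$; the maximum one is $\top$. The equality relation $E_{\mathcal X}$, of arity $(\mathcal X,\mathcal X^*)$, has $E_{\mathcal X}(X\otimes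 X^*)=\mathbb C\epsilon_X$, with $\epsilon_X$ the evaluation functional, and other components zero. The bend of a binary relation $R$ from $\mathcal X$ to $\mathcal Y$ is $\breve R=E_{\mathcal Y}\circ(R\times I_{\mathcal Y^*})$, of arity $(\mathcal X,\mathcal Y^*)$. A formula $\phi(x_1,\dots,x_n)$ with variables of sorts $\mathcal X_i$ is interpreted as a relation $[\![\phi]\!]$ of arity $(\mathcal X_1,\dots,\mathcal X_n)$: an atomic formula whose arguments are distinct variables is interpreted as the given relation times $\top$ on the other variables, with factors permuted suitably; $\neg$ is the atomwise orthocomplement; $\wedge$ is the intersection; $\phi\vee\psi$ is $\neg(\neg\phi\wedge\neg\psi)$; $\phi\to\psi$ is $\neg\phi\vee(\phi\wedge\psi)$; $[\![(\forall x\in\mathcal X)\phi]\!]$ is the supremum of all $R$ with $\top_{\mathcal X}\times R\le[\![\phi]\!]$; and $\exists$ is $\neg\forall\neg$. Further, $(\forall(x=x_*)\in\mathcal X\times\mathcal X^*)\,\phi$ abbreviates $(\forall x_*\in\mathcal X^*)(\forall x\in\mathcal X)(E_{\mathcal X}(x,x_*)\to\phi)$, where $x$ and $x_*$ are distinct variables,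 and $(\exists(x=x_*))\phi$ abbreviates $\neg(\forall(x=x_*))\neg\phi$. Terms are built from variables by function symbols, which are functions $\mathcal X_1\times\cdots\times\mathcal X_m\to\mathcal Y$. No variable occurs twice in an atomic formula. An atomic formula $R(t_1,\dots,t_n)$ in which not all $t_i$ are variables abbreviates $$(\exists(y_n=y_{n*}))\cdots(\exists(y_1=y_{1*}))\,\bigl(R(y_1,\dots,y_n)\wedge t_1\curvearrowright y_{1*}\wedge\cdots\wedge t_n\curvearrowright y_{n*}\bigr)$$ with new variables, where $t\curvearrowright y_*$ is $E_{\mathcal Y}(t,y_*)$ if $t$ is a variable and is $\breve G(s_1,\dots,s_m,y_*)$ if $t=G(s_1,\dots,s_m)$. **Quantum pseudometrics (Kuperberg–Weaver).** Let $M$ be a von Neumann algebra on a Hilbert space $H$. A quantum pseudometric on $M$ is a family $(V_\beta\mid\beta\in[0,\infty))$ of ultraweakly closed, self-adjoint, unital subspaces of $L(H)$ with $V_\alpha V_\beta\subseteq V_{\alpha+\beta}$ and $V_\alpha=\bigcap_{\beta>\alpha}V_\beta$ for all $\alpha,\beta$, and $M'\subseteq V_0$. It is a quantum metric if $V_0=M'$.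 For a quantum set $\mathcal X$, let $\ell^\infty(\mathcal X)$ be the $\ell^\infty$-direct sum of the algebras $L(X)$, $X\in\mathrm{At}(\mathcal X)$, acting on the $\ell^2$-direct sum of the atoms, and let $\mathrm{inc}_X$ be the inclusion isometry of the atom $X$ into this $\ell^2$-direct sum. **Theorem.** Let $\mathcal X$ be a quantum set and let $T={}^{\backprime}(\le)$, a binary relation on ${}^{\backprime}[0,\infty]$. There is a one-to-one correspondence between the quantum pseudometrics $(V_\beta\mid\beta\in[0,\infty))$ on $\ell^\infty(\mathcal X)$ and the functions $F:\mathcal X\times\mathcal X^*\to{}^{\backprime}[0,\infty]$ such that 1. $[\![(\forall(x_1=x_{1*})\in\mathcal X\times\mathcal X^*)\;E_{{}^{\backprime}[0,\infty]}(F(x_1,x_{1*}),{}^{\backprime}0_*)]\!]=\top$; 2. $[\![(\forall(x_1=x_{1*})\in\mathcal X\times\mathcal X^*)(\forall(x_2=x_{2*})\in\mathcal X\times\mathcal X^*)\;E_{{}^{\backprime}[0,\infty]}(F(x_1,x_{2*}),C_{[0,\infty]}(F(x_2,x_{1*})))]\!]=\top$; 3. $[\![(\forall(x_1=x_{1*})\in\mathcal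 X\times\mathcal X^*)(\forall(x_2=x_{2*})\in\mathcal X\times\mathcal X^*)(\forall(x_3=x_{3*})\in\mathcal X\times\mathcal X^*)\;\breve T(F(x_1,x_{2*}),{}^{\backprime}(+)_*(F_*(x_{1*},x_3),F_*(x_{3*},x_2)))]\!]=\top$. A function $F$ and a quantum pseudometric $(V_\beta)$ correspond to each other if and only if $$\sum_{\alpha\in[0,\beta]}R_\alpha(X_1,X_2)=\mathrm{inc}_{X_2}^\dagger\cdot V_\beta\cdot\mathrm{inc}_{X_1}\qquad\text{for all }\beta\in[0,\infty),\ X_1,X_2\in\mathrm{At}(\mathcal X),$$ where $R_\alpha$ is the binary relation on $\mathcal X$ with $\breve R_\alpha={}^{\backprime}\alpha^\dagger\circ F$ for each $\alpha\in[0,\infty]$. Moreover, this correspondence restricts to a one-to-one correspondence between the quantum metrics on $\ell^\infty(\mathcal X)$ and the functions $F$ that satisfy (1), (2), (3) and 4. $[\![(\forall x_1\in\mathcal X)(\forall x_{2*}\in\mathcal X^*)\,(E_{{}^{\backprime}[0,\infty]}(F(x_1,x_{2*}),{}^{\backprime}0_*)\to E_{\mathcal X}(x_1,x_{2*}))]\!]=\top$.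 -/

import Mathlib

open scoped TensorProduct NNReal ENNReal Topology

universe u

noncomputable section

/-! ## The dual of a Hilbert space -/

/-- The inner product on the dual `H* = L(H, ℂ)` of a Hilbert space, for which the (antilinear)
Riesz map `x ↦ ⟨x|` is antiunitary; its norm is the operator norm. -/
instance strongDualInnerProductSpace (H : Type) [NormedAddCommGroup H] [InnerProductSpace ℂ H]
    [CompleteSpace H] : InnerProductSpace ℂ (StrongDual ℂ H) where
  inner f g := inner ℂ ((InnerProductSpace.toDual ℂ H).symm g)
    ((InnerProductSpace.toDual ℂ H).symm f)
  norm_sq_eq_re_inner f := by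
    rw [← (InnerProductSpace.toDual ℂ H).symm.norm_map f]
    exact norm_sq_eq_re_inner (𝕜 := ℂ) _
  conj_inner_symm f g := inner_conj_symm _ _
  add_left f g h := by rw [map_add, inner_add_right]
  smul_left f g r := by rw [map_smulₛₗ, inner_smul_right]

/-- The dual `H* = L(H, ℂ)` of a finite-dimensional Hilbert space, itself a finite-dimensional
Hilbert space. -/
def DualSpace (H : Type) [NormedAddCommGroup H] [InnerProductSpace ℂ H] : Type := StrongDual ℂ H

namespace DualSpace

variable {H : Type} [NormedAddCommGroup H] [InnerProductSpace ℂ H] [FiniteDimensional ℂ H]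

instance : NormedAddCommGroup (DualSpace H) := inferInstanceAs (NormedAddCommGroup (StrongDual ℂ H))

instance : InnerProductSpace ℂ (DualSpace H) :=
  inferInstanceAs (InnerProductSpace ℂ (StrongDual ℂ H))

instance : FiniteDimensional ℂ (DualSpace H) :=
  inferInstanceAs (FiniteDimensional ℂ (StrongDual ℂ H))

instance [Nontrivial H] : Nontrivial (DualSpace H) :=
  (InnerProductSpace.toDual ℂ H).symm.toEquiv.nontrivial

/-- The Riesz map `x ↦ ⟨x|` from a Hilbert space to its dual. -/
def bra (x : H) : DualSpace H := innerSL ℂ x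

/-- The value `ξ(x)` of a functional. -/
def pairing (ξ : DualSpace H) (x : H) : ℂ := DFunLike.coe (F := StrongDual ℂ H) ξ x

end DualSpace

/-! ## Quantum sets -/

/-- A quantum set: a family of nonzero finite-dimensional complex Hilbert spaces, its atoms.  The
underlying type of an atom is in the lowest universe, which is no restriction because each
finite-dimensional Hilbert space is isometric to some `ℂⁿ`. -/
structure QSet : Type (u + 1) where
  At : Type u
  H : At → Type
  [normed : ∀ a, NormedAddCommGroup (H a)]
  [innerProd : ∀ a, InnerProductSpace ℂ (H a)]
  [finDim : ∀ a, FiniteDimensional ℂ (H a)]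
  [nontriv : ∀ a, Nontrivial (H a)]

attribute [instance] QSet.normed QSet.innerProd QSet.finDim QSet.nontriv

theorem nontrivial_tensor (H K : Type) [NormedAddCommGroup H] [InnerProductSpace ℂ H]
    [NormedAddCommGroup K] [InnerProductSpace ℂ K]
    [Nontrivial H] [Nontrivial K] : Nontrivial (H ⊗[ℂ] K) := by
  obtain ⟨x, hx⟩ := exists_ne (0 : H)
  obtain ⟨y, hy⟩ := exists_ne (0 : K)
  refine ⟨x ⊗ₜ[ℂ] y, 0, fun h => ?_⟩
  have h1 : inner ℂ (x ⊗ₜ[ℂ] y) (x ⊗ₜ[ℂ] y) = (0 : ℂ) := by rw [h]; simp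
  rw [TensorProduct.inner_tmul] at h1
  simp [hx, hy] at h1

namespace QSet

/-- The dual quantum set: its atoms are the duals of the atoms of `X`. -/
@[reducible] def dual (X : QSet.{u}) : QSet.{u} where
  At := X.At
  H a := DualSpace (X.H a)

/-- The Cartesian product: its atoms are the tensor products of an atom of `X` with one of `Y`. -/
@[reducible] def prod (X Y : QSet.{u}) : QSet.{u} where
  At := X.At × Y.At
  H a := X.H a.1 ⊗[ℂ] Y.H a.2
  nontriv a := nontrivial_tensor (X.H a.1) (Y.H a.2)

/-- The monoidal unit, whose only atom is `ℂ`. -/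
@[reducible] def one : QSet.{u} where
  At := PUnit
  H _ := ℂ

/-- The quantum set of an ordinary set `A`: one one-dimensional atom for each element of `A`. -/
@[reducible] def ofSet (A : Type) : QSet.{u} where
  At := ULift.{u} A
  H _ := ℂ

/-- The Cartesian product of a finite list of quantum sets. -/
@[reducible] def prodList : List QSet.{u} → QSet.{u}
  | [] => one
  | X :: Γ => X.prod (prodList Γ)

end QSet

/-! ## Binary relations and predicates -/

/-- A binary relation from `X` to `Y`: a subspace of `L(H, K)` for all atoms `H` of `X` and
`K` of `Y`.  The order is the atomwise inclusion. -/
abbrev BRel (X Y : QSet.{u}) : Type u :=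
  ∀ (a : X.At) (b : Y.At), Submodule ℂ (X.H a →L[ℂ] Y.H b)

/-- A predicate on `X`: a subspace of `L(H, ℂ)` for each atom `H` of `X`. -/
abbrev Pred (X : QSet.{u}) : Type u :=
  ∀ a : X.At, Submodule ℂ (StrongDual ℂ (X.H a))

namespace BRel

variable {X Y Z W : QSet.{u}}

/-- The identity binary relation. -/
def id (X : QSet.{u}) : BRel X X := fun a b =>
  Submodule.span ℂ {f | ∃ h : a = b, ∀ x, f x = h ▸ x}

/-- The composition `S ∘ R`. -/
def comp (S : BRel Y Z) (R : BRel X Y) : BRel X Z := fun a c =>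
  Submodule.span ℂ {f | ∃ b, ∃ s ∈ S b c, ∃ r ∈ R a b, f = s ∘L r}

/-- The adjoint `R†`. -/
def dagger (R : BRel X Y) : BRel Y X := fun b a =>
  Submodule.span ℂ {f | ∃ r ∈ R a b, f = ContinuousLinearMap.adjoint r}

/-- The product `R × S` of binary relations. -/
def prod (R : BRel X Y) (S : BRel Z W) : BRel (X.prod Z) (Y.prod W) := fun a b =>
  Submodule.span ℂ {f | ∃ r ∈ R a.1 b.1, ∃ s ∈ S a.2 b.2,
    ∀ x z, f (x ⊗ₜ[ℂ] z) = r x ⊗ₜ[ℂ] s z}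

/-- The equality relation `E_X`, the span of the evaluation functionals, as a binary relation
from `X × X*` to `1`. -/
def eval (X : QSet.{u}) : BRel (X.prod X.dual) QSet.one := fun a _ =>
  Submodule.span ℂ {f | ∃ h : a.1 = a.2, ∀ (x : X.H a.1) (ξ : X.dual.H a.2),
    f (x ⊗ₜ[ℂ] ξ) = DualSpace.pairing ξ (h ▸ x)}

/-- The bend `E_Y ∘ (R × I_{Y*})` of a binary relation `R` from `X` to `Y`. -/
def bend (R : BRel X Y) : BRel (X.prod Y.dual) QSet.one :=
  (eval Y).comp (R.prod (id Y.dual))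

/-- A function from `X` to `Y` is a binary relation `F` with `F ∘ F† ≤ I_Y` and
`F† ∘ F ≥ I_X`. -/
def IsFunction (F : BRel X Y) : Prop :=
  F.comp F.dagger ≤ id Y ∧ id X ≤ F.dagger.comp F

/-- The conjugate `R_*`, a binary relation from `X*` to `Y*`, spanned by the operators
`r_* = (r†)*`, that is, `⟨x| ↦ ⟨r x|`. -/
def conj (R : BRel X Y) : BRel X.dual Y.dual := fun a b =>
  Submodule.span ℂ {f | ∃ r ∈ R a b, ∀ x : X.H a, f (DualSpace.bra x) = DualSpace.bra (r x)}

/-- The conjugate of a binary relation from `X × Y` to `Z`, where `(X × Y)*` is identified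
with `X* × Y*`. -/
def conj₂ (R : BRel (X.prod Y) Z) : BRel (X.dual.prod Y.dual) Z.dual := fun a b =>
  Submodule.span ℂ {f | ∃ r ∈ R a b, ∀ (x : X.H a.1) (y : Y.H a.2),
    f (DualSpace.bra x ⊗ₜ[ℂ] DualSpace.bra y) = DualSpace.bra (r (x ⊗ₜ[ℂ] y))}

/-- The conjugate of a binary relation from `X × Y*` to `Z`, where `(X × Y*)*` is identified
with `X* × Y`. -/
def conjDual (R : BRel (X.prod Y.dual) Z) : BRel (X.dual.prod Y) Z.dual := fun a b =>
  Submodule.span ℂ {f | ∃ r ∈ R a b, ∀ (x : X.H a.1) (y : Y.H a.2),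
    f (DualSpace.bra x ⊗ₜ[ℂ] y) = DualSpace.bra (r (x ⊗ₜ[ℂ] DualSpace.bra y))}

/-- The binary relation between the quantum sets of `A` and `B` given by an ordinary binary
relation `r`. -/
def ofRel {A B : Type} (r : A → B → Prop) : BRel (QSet.ofSet.{u} A) (QSet.ofSet.{u} B) :=
  fun a b => ⨆ _ : r a.down b.down, ⊤

/-- The function from `1` to the quantum set of `A` given by an element of `A`. -/
def ofElem {A : Type} (a : A) : BRel QSet.one (QSet.ofSet.{u} A) :=
  fun _ b => ⨆ _ : a = b.down, ⊤

/-- The function given by an ordinary binary operation on `A`. -/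
def ofOp {A : Type} (op : A → A → A) :
    BRel ((QSet.ofSet.{u} A).prod (QSet.ofSet A)) (QSet.ofSet A) :=
  fun a b => ⨆ _ : op a.1.down a.2.down = b.down, ⊤

/-- The function from `1` to the dual of the quantum set of `A` that is the conjugate of an element
of `A`; here `1` is identified with `1*`. -/
def ofElemConj {A : Type} (a : A) : BRel QSet.one (QSet.ofSet.{u} A).dual :=
  (conj (ofElem a)).comp (fun _ _ => ⊤ : BRel QSet.one QSet.one.dual)

/-- The conjugation function `C_A` from the quantum set of `A` to its dual. -/
def conjugation (A : Type) : BRel (QSet.ofSet.{u} A) (QSet.ofSet A).dual :=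
  fun a b => ⨆ _ : a = b, ⊤

end BRel

/-! ## Relations and their logical operations -/

/-- A relation of arity `Γ`: a predicate on the Cartesian product of the list `Γ`. -/
abbrev QRel (Γ : List QSet.{u}) : Type u := Pred (QSet.prodList Γ)

/-- `Var Γ X` is the type of variables of sort `X` in the context `Γ`. -/
inductive Var : List QSet.{u} → QSet.{u} → Type (u + 1)
  | head {Γ : List QSet.{u}} {X : QSet.{u}} : Var (X :: Γ) X
  | tail {Γ : List QSet.{u}} {X Y : QSet.{u}} : Var Γ X → Var (Y :: Γ) X

namespace Var

/-- The position of a variable in its context. -/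
def index : {Γ : List QSet.{u}} → {X : QSet.{u}} → Var Γ X → ℕ
  | _, _, head => 0
  | _, _, tail v => v.index + 1

/-- The component of a tuple of atoms. -/
def atom : {Γ : List QSet.{u}} → {X : QSet.{u}} → Var Γ X → (QSet.prodList Γ).At → X.At
  | _, _, head, a => a.1
  | _, _, tail v, a => v.atom a.2

end Var

/-- Tuples of vectors, one from each factor of a product atom. -/
def Vecs : (Γ : List QSet.{u}) → (QSet.prodList Γ).At → Type
  | [], _ => Unit
  | X :: Γ, a => X.H a.1 × Vecs Γ a.2

/-- Tuples of functionals, one on each factor of a product atom. -/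
def Covecs : (Γ : List QSet.{u}) → (QSet.prodList Γ).At → Type
  | [], _ => Unit
  | X :: Γ, a => StrongDual ℂ (X.H a.1) × Covecs Γ a.2

/-- The elementary tensor of a tuple of vectors. -/
def Vecs.tensor : (Γ : List QSet.{u}) → (a : (QSet.prodList Γ).At) → Vecs Γ a →
    (QSet.prodList Γ).H a
  | [], _, _ => (1 : ℂ)
  | X :: Γ, a, x => Prod.fst (α := X.H a.1) x ⊗ₜ[ℂ] Vecs.tensor Γ a.2 x.2

/-- The component of a tuple of vectors. -/
def Var.vec : {Γ : List QSet.{u}} → {X : QSet.{u}} → (v : Var Γ X) →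
    (a : (QSet.prodList Γ).At) → Vecs Γ a → X.H (v.atom a)
  | _, _, .head, _, x => x.1
  | _, _, .tail v, a, x => v.vec a.2 x.2

/-- The product of the numbers `ξᵢ(xᵢ)` over all positions `i` that are not in the list `U`;
`k` is the position of the first entry. -/
def Covecs.prodOff (U : List ℕ) : (Γ : List QSet.{u}) → (a : (QSet.prodList Γ).At) → ℕ →
    Covecs Γ a → Vecs Γ a → ℂ
  | [], _, _, _, _ => 1
  | X :: Γ, a, k, ξ, x =>
    (if k ∈ U then 1 else Prod.fst (α := StrongDual ℂ (X.H a.1)) ξ x.1) *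
      Covecs.prodOff U Γ a.2 (k + 1) ξ.2 x.2

/-- A tuple of variables in the context `Γ` whose sorts are the entries of `Δ`. -/
def Ren (Δ Γ : List QSet.{u}) : Type (u + 1) := ∀ Z : QSet.{u}, Var Δ Z → Var Γ Z

namespace Ren

def nil {Γ : List QSet.{u}} : Ren [] Γ := fun _ v => nomatch v

def cons {Δ Γ : List QSet.{u}} {X : QSet.{u}} (w : Var Γ X) (ρ : Ren Δ Γ) : Ren (X :: Δ) Γ
  | _, .head => w
  | _, .tail v => ρ _ v

def tail {Δ Γ : List QSet.{u}} {X : QSet.{u}} (ρ : Ren (X :: Δ) Γ) : Ren Δ Γ :=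
  fun Z v => ρ Z v.tail

def snoc {Γ : List QSet.{u}} {W : QSet.{u}} : (Δ : List QSet.{u}) → Ren Δ Γ → Var Γ W →
    Ren (Δ ++ [W]) Γ
  | [], _, w => cons w nil
  | _ :: Δ, ρ, w => cons (ρ _ .head) (snoc Δ ρ.tail w)

/-- The list of the positions of the variables of a tuple. -/
def indices {Γ : List QSet.{u}} : (Δ : List QSet.{u}) → Ren Δ Γ → List ℕ
  | [], _ => []
  | _ :: Δ, ρ => (ρ _ .head).index :: indices Δ ρ.tail

/-- The atoms selected by a tuple of variables. -/
def atoms {Γ : List QSet.{u}} : (Δ : List QSet.{u}) → Ren Δ Γ → (QSet.prodList Γ).At →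
    (QSet.prodList Δ).At
  | [], _, _ => PUnit.unit
  | _ :: Δ, ρ, a => ((ρ _ .head).atom a, atoms Δ ρ.tail a)

/-- The vectors selected by a tuple of variables. -/
def vecs {Γ : List QSet.{u}} : (Δ : List QSet.{u}) → (ρ : Ren Δ Γ) → (a : (QSet.prodList Γ).At) →
    Vecs Γ a → Vecs Δ (ρ.atoms Δ a)
  | [], _, _, _ => ()
  | _ :: Δ, ρ, a, x => ((ρ _ .head).vec a x, vecs Δ ρ.tail a x)

end Ren

namespace QRel

variable {Γ Δ : List QSet.{u}}

/-- The interpretation, in the context `Γ`, of the primitive atomic formula `R(x₁, …, xₘ)` with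
distinct variables `x₁, …, xₘ`: the product of `R` with the maximum predicates on the sorts of the
remaining variables, with the factors permuted into the order of the context. -/
def atomic (R : QRel Δ) (ρ : Ren Δ Γ) : QRel Γ := fun a =>
  Submodule.span ℂ {f | ∃ r ∈ R (ρ.atoms Δ a), ∃ ξ : Covecs Γ a, ∀ x : Vecs Γ a,
    f (Vecs.tensor Γ a x) =
      r (Vecs.tensor Δ (ρ.atoms Δ a) (ρ.vecs Δ a x)) *
        Covecs.prodOff (ρ.indices Δ) Γ a 0 ξ x}

/-- The orthocomplement `¬ R`, taken atomwise. -/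
def neg (R : QRel Γ) : QRel Γ := fun a => (R a)ᗮ

/-- `R ∨ S` abbreviates `¬ (¬ R ∧ ¬ S)`. -/
def or (R S : QRel Γ) : QRel Γ := neg (neg R ⊓ neg S)

/-- The Sasaki arrow: `R → S` abbreviates `¬ R ∨ (R ∧ S)`. -/
def imp (R S : QRel Γ) : QRel Γ := or (neg R) (R ⊓ S)

/-- The product `⊤_X × R`. -/
def topProd (X : QSet.{u}) (R : QRel Γ) : QRel (X :: Γ) := fun a =>
  Submodule.span ℂ {f | ∃ ξ : StrongDual ℂ (X.H a.1), ∃ r ∈ R a.2,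
    ∀ (x : X.H a.1) (y : (QSet.prodList Γ).H a.2), f (x ⊗ₜ[ℂ] y) = ξ x * r y}

/-- Universal quantification over the first variable. -/
def all {X : QSet.{u}} (φ : QRel (X :: Γ)) : QRel Γ := sSup {R : QRel Γ | topProd X R ≤ φ}

/-- `∃ x, φ` abbreviates `¬ ∀ x, ¬ φ`. -/
def ex {X : QSet.{u}} (φ : QRel (X :: Γ)) : QRel Γ := neg (all (neg φ))

/-- A binary relation from `X × Y` to `1`, as a relation of arity `(X, Y)`; likewise below. -/
def of₂ {X Y : QSet.{u}} (P : BRel (X.prod Y) QSet.one) : QRel [X, Y] := fun a =>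
  Submodule.span ℂ {f | ∃ g ∈ P (a.1, a.2.1) PUnit.unit, ∀ (x : X.H a.1) (y : Y.H a.2.1),
    f (x ⊗ₜ[ℂ] (y ⊗ₜ[ℂ] (1 : ℂ))) = g (x ⊗ₜ[ℂ] y)}

def of₃ {X Y Z : QSet.{u}} (P : BRel ((X.prod Y).prod Z) QSet.one) : QRel [X, Y, Z] := fun a =>
  Submodule.span ℂ {f | ∃ g ∈ P ((a.1, a.2.1), a.2.2.1) PUnit.unit,
    ∀ (x : X.H a.1) (y : Y.H a.2.1) (z : Z.H a.2.2.1),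
      f (x ⊗ₜ[ℂ] (y ⊗ₜ[ℂ] (z ⊗ₜ[ℂ] (1 : ℂ)))) = g ((x ⊗ₜ[ℂ] y) ⊗ₜ[ℂ] z)}

/-- The equality relation `E_X` of arity `(X, X*)`. -/
def equality (X : QSet.{u}) : QRel [X, X.dual] := of₂ (BRel.eval X)

/-- The primitive atomic formula `E_X(x, y)`. -/
def eqAtom {X : QSet.{u}} (x : Var Γ X) (y : Var Γ X.dual) : QRel Γ :=
  atomic (equality X) (.cons x (.cons y .nil))

/-- `(∀ (x = x_*) ∈ X × X*) φ` abbreviates `(∀ x_* ∈ X*) (∀ x ∈ X) (E_X(x, x_*) → φ)`. -/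
def allDiag (X : QSet.{u}) (φ : QRel (X :: X.dual :: Γ)) : QRel Γ :=
  all (all (imp (eqAtom .head (.tail .head)) φ))

/-- `(∃ (x = x_*) ∈ X × X*) φ` abbreviates `¬ (∀ (x = x_*) ∈ X × X*) ¬ φ`. -/
def exDiag (X : QSet.{u}) (φ : QRel (X :: X.dual :: Γ)) : QRel Γ := neg (allDiag X (neg φ))

end QRel

/-! ## Function graphs -/

namespace BRel

variable {X Y Z : QSet.{u}}

/-- The function graph of a function with no arguments; here `1 × Z*` is identified with `Z*`. -/
def graph₀ (F : BRel QSet.one Z) : QRel ([] ++ [Z.dual]) := fun a =>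
  Submodule.span ℂ {f | ∃ g ∈ F.bend (PUnit.unit, a.1) PUnit.unit,
    ∀ ζ : Z.dual.H a.1, f (ζ ⊗ₜ[ℂ] (1 : ℂ)) = g ((1 : ℂ) ⊗ₜ[ℂ] ζ)}

/-- The function graph of a function with one argument. -/
def graph₁ (F : BRel X Z) : QRel ([X] ++ [Z.dual]) := QRel.of₂ F.bend

/-- The function graph of a function with two arguments. -/
def graph₂ (F : BRel (X.prod Y) Z) : QRel ([X, Y] ++ [Z.dual]) := QRel.of₃ F.bend

end BRel

/-! ## Terms and formulas -/

mutual

/-- Terms in the context `Γ`: variables, and applications of function symbols.  A function symbol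
is given by its graph, a relation of arity `(X₁, …, Xₘ, Y*)`.  (The interpretation makes sense for
each such relation, so the definition does not insist that it be the graph of a function; all
function symbols below are graphs of functions.) -/
inductive Term : List QSet.{u} → QSet.{u} → Type (u + 1)
  | var {Γ : List QSet.{u}} {X : QSet.{u}} (x : Var Γ X) : Term Γ X
  | app {Γ : List QSet.{u}} (Δ : List QSet.{u}) (Y : QSet.{u}) (G : QRel (Δ ++ [Y.dual]))
      (ts : Terms Γ Δ) : Term Γ Y

/-- Tuples of terms. -/
inductive Terms : List QSet.{u} → List QSet.{u} → Type (u + 1)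
  | nil {Γ : List QSet.{u}} : Terms Γ []
  | cons {Γ Δ : List QSet.{u}} {X : QSet.{u}} (t : Term Γ X) (ts : Terms Γ Δ) : Terms Γ (X :: Δ)

end

mutual

/-- The list of the positions of all occurrences of variables. -/
def Term.indices : {Γ : List QSet.{u}} → {X : QSet.{u}} → Term Γ X → List ℕ
  | _, _, .var x => [x.index]
  | _, _, .app _ _ _ ts => ts.indices

def Terms.indices : {Γ Δ : List QSet.{u}} → Terms Γ Δ → List ℕ
  | _, _, .nil => []
  | _, _, .cons t ts => t.indices ++ ts.indices

end

/-- The variables of a tuple of terms that are all variables. -/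
def Terms.vars? : {Γ Δ : List QSet.{u}} → Terms Γ Δ → Option (Ren Δ Γ)
  | _, _, .nil => some .nil
  | _, _, .cons (.var x) ts => ts.vars?.map (Ren.cons x)
  | _, _, .cons (.app ..) _ => none

/-- The context `y₁, y₁_*, …, yₖ, yₖ_*, Γ`, where `y₁, …, yₖ` are new variables whose sorts are
the entries of `Δ`. -/
def diagCtx : List QSet.{u} → List QSet.{u} → List QSet.{u}
  | [], Γ => Γ
  | Y :: Δ, Γ => Y :: Y.dual :: diagCtx Δ Γ

/-- The variables of `Γ` in the extended context. -/
def diagOld {Γ : List QSet.{u}} : (Δ : List QSet.{u}) → Ren Γ (diagCtx Δ Γ)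
  | [], _, v => v
  | _ :: Δ, _, v => .tail (.tail (diagOld Δ _ v))

/-- The variables `y₁, …, yₖ`. -/
def diagNew {Γ : List QSet.{u}} : (Δ : List QSet.{u}) → Ren Δ (diagCtx Δ Γ)
  | _ :: _, _, .head => .head
  | _ :: Δ, _, .tail v => .tail (.tail (diagNew Δ _ v))

/-- The variables `y₁_*, …, yₖ_*`. -/
def diagNewDual {Γ : List QSet.{u}} : (Δ : List QSet.{u}) → (Z : QSet.{u}) → Var Δ Z →
    Var (diagCtx Δ Γ) Z.dual
  | _ :: _, _, .head => .tail .head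
  | _ :: Δ, _, .tail v => .tail (.tail (diagNewDual Δ _ v))

/-- `(∃ (yₖ = yₖ_*)) ⋯ (∃ (y₁ = y₁_*)) φ`. -/
def QRel.exDiags {Γ : List QSet.{u}} : (Δ : List QSet.{u}) → QRel (diagCtx Δ Γ) → QRel Γ
  | [], φ => φ
  | Y :: Δ, φ => QRel.exDiags Δ (QRel.exDiag Y φ)

mutual

/-- The interpretation, in the context `Θ`, of the formula `t ↷ y_*`, where the variables of `t`
are renamed along `ρ`.  It is `E_Y(t, y_*)` if `t` is a variable and `G(s₁, …, sₘ, y_*)` if `t` is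
the application of `G` to `s₁, …, sₘ`.  If `s₁, …, sₘ` are not all variables, then the latter
formula abbreviates
`(∃ (w = w_*)) (∃ (zₘ = zₘ_*)) ⋯ (∃ (z₁ = z₁_*))
  (G(z₁, …, zₘ, w) ∧ s₁ ↷ z₁_* ∧ ⋯ ∧ sₘ ↷ zₘ_* ∧ y_* ↷ w_*)`. -/
def Term.graph : {Γ : List QSet.{u}} → {Y : QSet.{u}} → Term Γ Y → (Θ : List QSet.{u}) →
    Ren Γ Θ → Var Θ Y.dual → QRel Θ
  | _, _, .var x, _, ρ, y => QRel.eqAtom (ρ _ x) y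
  | _, _, .app Δ Y G ts, Θ, ρ, y =>
    match ts.vars? with
    | some τ => QRel.atomic G (Ren.snoc Δ (fun Z v => ρ Z (τ Z v)) y)
    | none =>
      QRel.exDiag Y.dual (QRel.exDiags Δ
        (QRel.atomic G (Ren.snoc Δ (diagNew Δ) (diagOld Δ _ .head))
          ⊓ ts.graphs (diagCtx Δ (Y.dual :: Y.dual.dual :: Θ))
              (fun Z v => diagOld Δ Z (.tail (.tail (ρ Z v)))) (diagNewDual Δ)
          ⊓ QRel.eqAtom (diagOld Δ _ (.tail (.tail y))) (diagOld Δ _ (.tail .head))))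

/-- The conjunction of the formulas `tᵢ ↷ yᵢ_*`. -/
def Terms.graphs : {Γ Δ : List QSet.{u}} → Terms Γ Δ → (Θ : List QSet.{u}) → Ren Γ Θ →
    (∀ Z : QSet.{u}, Var Δ Z → Var Θ Z.dual) → QRel Θ
  | _, _, .nil, _, _, _ => ⊤
  | _, _, .cons t ts, Θ, ρ, ys =>
    t.graph Θ ρ (ys _ .head) ⊓ ts.graphs Θ ρ (fun Z v => ys Z v.tail)

end

/-- Nonduplicating formulas in the context `Γ`; the quantifiers bind the first variable. -/
inductive Formula : List QSet.{u} → Type (u + 1)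
  | rel {Γ Δ : List QSet.{u}} (R : QRel Δ) (ts : Terms Γ Δ) (h : ts.indices.Nodup) : Formula Γ
  | neg {Γ : List QSet.{u}} (φ : Formula Γ) : Formula Γ
  | and {Γ : List QSet.{u}} (φ ψ : Formula Γ) : Formula Γ
  | or {Γ : List QSet.{u}} (φ ψ : Formula Γ) : Formula Γ
  | imp {Γ : List QSet.{u}} (φ ψ : Formula Γ) : Formula Γ
  | all {Γ : List QSet.{u}} (X : QSet.{u}) (φ : Formula (X :: Γ)) : Formula Γ
  | ex {Γ : List QSet.{u}} (X : QSet.{u}) (φ : Formula (X :: Γ)) : Formula Γ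

namespace Formula

/-- The interpretation of a nonduplicating formula.  The atomic formula `R(t₁, …, tₙ)` is primitive
if all of its terms are variables, and otherwise it abbreviates
`(∃ (yₙ = yₙ_*)) ⋯ (∃ (y₁ = y₁_*)) (R(y₁, …, yₙ) ∧ t₁ ↷ y₁_* ∧ ⋯ ∧ tₙ ↷ yₙ_*)`. -/
def interp : {Γ : List QSet.{u}} → Formula Γ → QRel Γ
  | Γ, .rel (Δ := Δ) R ts _ =>
    match ts.vars? with
    | some τ => QRel.atomic R τ
    | none => QRel.exDiags Δ (QRel.atomic R (diagNew Δ)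
        ⊓ ts.graphs (diagCtx Δ Γ) (diagOld Δ) (diagNewDual Δ))
  | _, .neg φ => QRel.neg φ.interp
  | _, .and φ ψ => φ.interp ⊓ ψ.interp
  | _, .or φ ψ => QRel.or φ.interp ψ.interp
  | _, .imp φ ψ => QRel.imp φ.interp ψ.interp
  | _, .all _ φ => QRel.all φ.interp
  | _, .ex _ φ => QRel.ex φ.interp

/-- The atomic formula `R(s, t)`. -/
def rel₂ {Γ : List QSet.{u}} {X Y : QSet.{u}} (R : QRel [X, Y]) (s : Term Γ X) (t : Term Γ Y)
    (h : (s.indices ++ t.indices).Nodup) : Formula Γ :=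
  .rel R (.cons s (.cons t .nil)) (by simpa [Terms.indices] using h)

/-- `(∀ (x = x_*) ∈ X × X*) φ`. -/
def allDiag {Γ : List QSet.{u}} (X : QSet.{u}) (φ : Formula (X :: X.dual :: Γ)) : Formula Γ :=
  .all X.dual (.all X (.imp
    (rel₂ (QRel.equality X) (.var .head) (.var (.tail .head))
      (by simp [Term.indices, Var.index])) φ))

/-- A sentence is true if its interpretation, a relation of arity `()`, is `⊤`. -/
def IsTrue (φ : Formula.{u} []) : Prop := φ.interp = ⊤

end Formula

/-! ## The sentences for distance functions -/

/-- The quantum set of the ordinary set `[0, ∞]`. -/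
@[reducible] def QSet.dist : QSet.{u} := QSet.ofSet ℝ≥0∞

namespace DistanceFunction

variable {X : QSet.{u}} (F : BRel (X.prod X.dual) QSet.dist)

/-- The term `F(x, y_*)`. -/
def term {Γ : List QSet.{u}} (x : Var Γ X) (y : Var Γ X.dual) : Term Γ QSet.dist :=
  .app [X, X.dual] QSet.dist F.graph₂ (.cons (.var x) (.cons (.var y) .nil))

/-- The term `F_*(x_*, y)`. -/
def termConj {Γ : List QSet.{u}} (x : Var Γ X.dual) (y : Var Γ X) : Term Γ QSet.dist.dual :=
  .app [X.dual, X] QSet.dist.dual F.conjDual.graph₂ (.cons (.var x) (.cons (.var y) .nil))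

/-- The constant term `0_*`. -/
def termZeroConj {Γ : List QSet.{u}} : Term Γ QSet.dist.dual :=
  .app [] QSet.dist.dual (BRel.ofElemConj (0 : ℝ≥0∞)).graph₀ .nil

/-- The term `C(t)`, for `C` the conjugation function of `[0, ∞]`. -/
def termConjugation {Γ : List QSet.{u}} (t : Term Γ QSet.dist) : Term Γ QSet.dist.dual :=
  .app [QSet.dist] QSet.dist.dual (BRel.conjugation ℝ≥0∞).graph₁ (.cons t .nil)

/-- The term `(+)_*(s, t)`. -/
def termAddConj {Γ : List QSet.{u}} (s t : Term Γ QSet.dist.dual) : Term Γ QSet.dist.dual :=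
  .app [QSet.dist.dual, QSet.dist.dual] QSet.dist.dual
    (BRel.ofOp (fun α β : ℝ≥0∞ => α + β)).conj₂.graph₂ (.cons s (.cons t .nil))

/-- `(∀ (x₁ = x₁_*)) E(F(x₁, x₁_*), 0_*)`. -/
def zeroSelfDistance : Formula.{u} [] :=
  .allDiag X
    (.rel₂ (QRel.equality QSet.dist) (term F .head (.tail .head)) termZeroConj
      (by simp [term, termZeroConj, Term.indices, Terms.indices, Var.index]))

/-- `(∀ (x₁ = x₁_*)) (∀ (x₂ = x₂_*)) E(F(x₁, x₂_*), C(F(x₂, x₁_*)))`. -/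
def symmetry : Formula.{u} [] :=
  .allDiag X (.allDiag X
    (let x₂ : Var [X, X.dual, X, X.dual] X := .head
     let x₂' : Var [X, X.dual, X, X.dual] X.dual := .tail .head
     let x₁ : Var [X, X.dual, X, X.dual] X := .tail (.tail .head)
     let x₁' : Var [X, X.dual, X, X.dual] X.dual := .tail (.tail (.tail .head))
     .rel₂ (QRel.equality QSet.dist) (term F x₁ x₂') (termConjugation (term F x₂ x₁'))
      (by simp [x₁, x₁', x₂, x₂', term, termConjugation, Term.indices, Terms.indices, Var.index])))

/-- `(∀ (x₁ = x₁_*)) (∀ (x₂ = x₂_*)) (∀ (x₃ = x₃_*))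
T(F(x₁, x₂_*), (+)_*(F_*(x₁_*, x₃), F_*(x₃_*, x₂)))`, for `T` the bend of the order relation of
`[0, ∞]`. -/
def triangle : Formula.{u} [] :=
  .allDiag X (.allDiag X (.allDiag X
    (let Γ : List QSet.{u} := [X, X.dual, X, X.dual, X, X.dual]
     let x₃ : Var Γ X := .head
     let x₃' : Var Γ X.dual := .tail .head
     let x₂ : Var Γ X := .tail (.tail .head)
     let x₂' : Var Γ X.dual := .tail (.tail (.tail .head))
     let x₁ : Var Γ X := .tail (.tail (.tail (.tail .head)))
     let x₁' : Var Γ X.dual := .tail (.tail (.tail (.tail (.tail .head))))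
     .rel₂ (QRel.of₂ (BRel.ofRel (fun α β : ℝ≥0∞ => α ≤ β)).bend) (term F x₁ x₂')
      (termAddConj (termConj F x₁' x₃) (termConj F x₃' x₂))
      (by simp [x₁, x₁', x₂, x₂', x₃, x₃', term, termConj, termAddConj, Term.indices,
            Terms.indices, Var.index]))))

/-- `(∀ x₁ ∈ X) (∀ x₂_* ∈ X*) (E(F(x₁, x₂_*), 0_*) → E_X(x₁, x₂_*))`. -/
def separation : Formula.{u} [] :=
  .all X (.all X.dual
    (let x₂' : Var [X.dual, X] X.dual := .head
     let x₁ : Var [X.dual, X] X := .tail .head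
     .imp
      (.rel₂ (QRel.equality QSet.dist) (term F x₁ x₂') termZeroConj
        (by simp [x₁, x₂', term, termZeroConj, Term.indices, Terms.indices, Var.index]))
      (.rel₂ (QRel.equality X) (.var x₁) (.var x₂')
        (by simp [x₁, x₂', Term.indices, Var.index]))))

end DistanceFunction

/-- `F` is a function from `X × X*` to `[0, ∞]` that satisfies the sentences expressing zero
self-distance, symmetry and the triangle inequality. -/
structure IsDistanceFunction {X : QSet.{u}} (F : BRel (X.prod X.dual) QSet.dist) : Prop where
  isFunction : F.IsFunction
  zeroSelfDistance : (DistanceFunction.zeroSelfDistance F).IsTrue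
  symmetry : (DistanceFunction.symmetry F).IsTrue
  triangle : (DistanceFunction.triangle F).IsTrue

/-! ## Quantum pseudometrics -/

section Operators

variable {H : Type u} [NormedAddCommGroup H] [InnerProductSpace ℂ H] [CompleteSpace H]

/-- The ultraweak topology on `L(H)`, generated by the functionals `T ↦ ∑ₙ ⟨xₙ, T yₙ⟩` for square
summable sequences `x` and `y` in `H`. -/
@[reducible] def ultraweak (H : Type u) [NormedAddCommGroup H] [InnerProductSpace ℂ H] :
    TopologicalSpace (H →L[ℂ] H) :=
  ⨅ (x : lp (fun _ : ℕ => H) 2) (y : lp (fun _ : ℕ => H) 2),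
    TopologicalSpace.induced (fun T : H →L[ℂ] H => ∑' n, inner ℂ (x n) (T (y n))) inferInstance

/-- A quantum pseudometric on a von Neumann algebra `M` of operators on `H` is a family of dual
operator systems `V β`, `β ∈ [0, ∞)`, that is a W*-filtration with `M' ⊆ V 0`. -/
structure IsQuantumPseudometric (M : Set (H →L[ℂ] H)) (V : ℝ≥0 → Submodule ℂ (H →L[ℂ] H)) :
    Prop where
  isClosed : ∀ β, IsClosed[ultraweak H] (V β : Set (H →L[ℂ] H))
  one_mem : ∀ β, 1 ∈ V β
  adjoint_mem : ∀ β, ∀ T ∈ V β, ContinuousLinearMap.adjoint T ∈ V β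
  mul_mem : ∀ α β, ∀ S ∈ V α, ∀ T ∈ V β, S * T ∈ V (α + β)
  eq_iInf : ∀ α, V α = ⨅ (β : ℝ≥0) (_ : α < β), V β
  commutant_le : M.centralizer ⊆ V 0

/-- A quantum metric on `M` is a quantum pseudometric with `V 0 = M'`. -/
structure IsQuantumMetric (M : Set (H →L[ℂ] H)) (V : ℝ≥0 → Submodule ℂ (H →L[ℂ] H)) :
    Prop extends IsQuantumPseudometric M V where
  eq_commutant : (V 0 : Set (H →L[ℂ] H)) = M.centralizer

end Operators

namespace QSet

variable (X : QSet.{u})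

/-- The `ℓ²`-direct sum of the atoms of `X`. -/
abbrev hilbertSum : Type u := lp X.H 2

/-- The von Neumann algebra `ℓ^∞(X)`, the `ℓ^∞`-direct sum of the algebras `L(H)` for the atoms `H`
of `X`, canonically represented on the `ℓ²`-direct sum of the atoms. -/
def linfty : Set (X.hilbertSum →L[ℂ] X.hilbertSum) :=
  {T | ∃ t : ∀ a, X.H a →L[ℂ] X.H a, (∃ C : ℝ, ∀ a, ‖t a‖ ≤ C) ∧
    ∀ (ψ : X.hilbertSum) (a : X.At), T ψ a = t a (ψ a)}

open Classical in
/-- The inclusion isometry of an atom into the `ℓ²`-direct sum of the atoms. -/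
def inc (a : X.At) : X.H a →L[ℂ] X.hilbertSum := lp.singleContinuousLinearMap ℂ X.H 2 a

/-- The linear map `v ↦ inc_b† · v · inc_a`. -/
def compress (a b : X.At) :
    (X.hilbertSum →L[ℂ] X.hilbertSum) →ₗ[ℂ] (X.H a →L[ℂ] X.H b) where
  toFun v := ContinuousLinearMap.adjoint (X.inc b) ∘L v ∘L X.inc a
  map_add' v w := by ext; simp
  map_smul' c v := by ext; simp

end QSet

/-- The functions `F` and the quantum pseudometrics `V` correspond to each other if
`∑_{α ≤ β} R_α(a, b) = inc_b† · V_β · inc_a` for all `β ∈ [0, ∞)` and all atoms `a` and `b`, where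
`R_α` is the binary relation on `X` with bend `α† ∘ F`, for `α ∈ [0, ∞]`. -/
def DistanceCorresponds {X : QSet.{u}} (F : BRel (X.prod X.dual) QSet.dist)
    (V : ℝ≥0 → Submodule ℂ (X.hilbertSum →L[ℂ] X.hilbertSum)) : Prop :=
  ∃ R : ℝ≥0∞ → BRel X X, (∀ α, (R α).bend = (BRel.ofElem α).dagger.comp F) ∧
    ∀ (β : ℝ≥0) (a b : X.At),
      ⨆ (α : ℝ≥0∞) (_ : α ≤ β), R α a b = (V β).map (X.compress a b)

end

-- For atoms X and Y, the map sending r to the functional x ⊗ ξ ↦ ξ(r x) (`BRel.bendMap`) identifies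
-- L(X, Y), with the Hilbert–Schmidt inner product, with the dual of X ⊗ Y*. The atoms of the
-- quantum set of [0, ∞] are one-dimensional, so a function F is the same as an orthogonal
-- decomposition of every L(X, Y) into subspaces indexed by [0, ∞] (`BRel.isFunction_iff`). The
-- subspace at α is `component F α`, which is the relation R_α of the theorem (`bend_eq_iff`). The
-- correspondence passes through the partial sums U_β = ∑_{α ≤ β} R_α, `levels F β`.
--
-- Logic. A functional f satisfies (∀ (x = x_*)) φ exactly if ev ⊗ f satisfies φ at every diagonal
-- pair of atoms (`mem_allDiag`), and ∃ is the Hilbert space adjoint operation, a contraction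
-- (`exDiag_apply`). Over a classical sort, tensoring with ev is bijective, so the auxiliary
-- variables of sort [0, ∞] that come from unfolding terms can be pulled out as suprema over
-- distances. Each sentence thus says that a product of evaluations lies in a supremum of subspaces
-- given by their slices in pairs of variables (`loc`). Contracting such a membership with elements
-- of the components kills all summands with the wrong distances, by orthogonality. Conversely,
-- Parseval's identity in bases adapted to the decomposition (`sum_bendMap_mul`) expands the product
-- of evaluations into terms that visibly belong to the right summands. The sentences become: 1 ∈
-- R_0 (`isTrue_zeroSelfDistance`); each R_α is closed under adjoints (`isTrue_symmetry`); R_β R_α ⊆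
-- ∑_{γ ≤ α + β} R_γ (`isTrue_triangle`); R_0 consists of scalars (`isTrue_separation`). In terms of
-- U, the first three say that U is an `IsOperatorFiltration`.
--
-- From filtrations to decompositions. A right-continuous filtration of a finite-dimensional space
-- changes only finitely often, and the part new at α, orthogonal to all earlier levels, recovers
-- the decomposition (`jumps_levels`, `iSup_jumps`). The component at ∞ is the complement of all
-- finite levels.
--
-- From filtrations to quantum pseudometrics. The commutant of ℓ^∞(X) contains the projections onto
-- the atoms, and it lies in V_0; hence each V_β is stable under cutting down to a pair of atoms.
-- Ultraweak closedness and the convergence of finite cut-downs show that V_β consists of all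
-- operators whose compressions lie in U_β (`ofCompressions_compressions`). Finally V_0 is the
-- commutant exactly if U_0 = R_0 consists of scalars on the diagonal and zero off it.

set_option maxSynthPendingDepth 8
set_option linter.unusedSectionVars false

/-! ## Functionals on tensor products -/

section TensorFunctional

variable {H K : Type} [NormedAddCommGroup H] [InnerProductSpace ℂ H]
  [NormedAddCommGroup K] [InnerProductSpace ℂ K]

theorem StrongDual.tensor_ext {E : Type} [NormedAddCommGroup E] [NormedSpace ℂ E]
    {f g : H ⊗[ℂ] K →L[ℂ] E}
    (h : ∀ x y, f (x ⊗ₜ[ℂ] y) = g (x ⊗ₜ[ℂ] y)) : f = g := by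
  have : (f : H ⊗[ℂ] K →ₗ[ℂ] E) = g := TensorProduct.ext' h
  exact ContinuousLinearMap.coe_injective this

theorem StrongDual.tensor_ext₃ {L : Type} [NormedAddCommGroup L] [InnerProductSpace ℂ L]
    {f g : StrongDual ℂ (H ⊗[ℂ] (K ⊗[ℂ] L))}
    (h : ∀ x y z, f (x ⊗ₜ (y ⊗ₜ z)) = g (x ⊗ₜ (y ⊗ₜ z))) : f = g := by
  refine StrongDual.tensor_ext fun x t => ?_
  induction t with
  | zero => simp
  | add t s ht hs => rw [TensorProduct.tmul_add, map_add, map_add, ht, hs]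
  | tmul ξ y => exact h x ξ y

variable [FiniteDimensional ℂ H] [FiniteDimensional ℂ K]

/-- The functional `x ⊗ y ↦ f x * g y`. -/
noncomputable def StrongDual.tmul (f : StrongDual ℂ H) (g : StrongDual ℂ K) :
    StrongDual ℂ (H ⊗[ℂ] K) :=
  LinearMap.toContinuousLinearMap
    (LinearMap.mul' ℂ ℂ ∘ₗ TensorProduct.map (f : H →ₗ[ℂ] ℂ) (g : K →ₗ[ℂ] ℂ))

@[simp] theorem StrongDual.tmul_apply (f : StrongDual ℂ H) (g : StrongDual ℂ K) (x : H) (y : K) :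
    StrongDual.tmul f g (x ⊗ₜ[ℂ] y) = f x * g y := by
  simp [StrongDual.tmul]

/-- A bilinear map into `ℂ`, as a functional on the tensor product. -/
noncomputable def StrongDual.ofBilin (B : H →ₗ[ℂ] K →ₗ[ℂ] ℂ) : StrongDual ℂ (H ⊗[ℂ] K) :=
  LinearMap.toContinuousLinearMap (TensorProduct.lift B)

@[simp] theorem StrongDual.ofBilin_apply (B : H →ₗ[ℂ] K →ₗ[ℂ] ℂ) (x : H) (y : K) :
    StrongDual.ofBilin B (x ⊗ₜ[ℂ] y) = B x y := by
  simp [StrongDual.ofBilin]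

end TensorFunctional

/-! ## Tuples of vectors and elementary tensors -/

namespace Vecs

theorem linearMap_ext {M : Type*} [AddCommGroup M] [Module ℂ M] : (Γ : List QSet.{u}) →
    (a : (QSet.prodList Γ).At) → {f g : (QSet.prodList Γ).H a →ₗ[ℂ] M} →
    (∀ z : Vecs Γ a, f (tensor Γ a z) = g (tensor Γ a z)) → f = g
  | [], _, f, g, h => LinearMap.ext_ring (h ())
  | X :: Γ, a, f, g, h => by
    refine TensorProduct.ext' fun x y => ?_
    have := linearMap_ext Γ a.2 (f := f ∘ₗ TensorProduct.mk ℂ (X.H a.1) _ x)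
      (g := g ∘ₗ TensorProduct.mk ℂ (X.H a.1) _ x) fun z => h (x, z)
    exact LinearMap.congr_fun this y

theorem functional_ext {Γ : List QSet.{u}} {a : (QSet.prodList Γ).At}
    {f g : StrongDual ℂ ((QSet.prodList Γ).H a)}
    (h : ∀ z : Vecs Γ a, f (tensor Γ a z) = g (tensor Γ a z)) : f = g :=
  ContinuousLinearMap.coe_injective (linearMap_ext Γ a h)

@[ext] theorem ext_vec : {Γ : List QSet.{u}} → {a : (QSet.prodList Γ).At} → {x z : Vecs Γ a} →
    (∀ (Z : QSet.{u}) (v : Var Γ Z), v.vec a x = v.vec a z) → x = z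
  | [], _, _, _, _ => rfl
  | _ :: _, _, _, _, h => Prod.ext (h _ .head) (ext_vec fun Z v => h Z v.tail)

/-- Two tuples agree at all positions outside `U`. -/
def AgreeOff (U : List ℕ) {Γ : List QSet.{u}} {a : (QSet.prodList Γ).At} (x z : Vecs Γ a) : Prop :=
  ∀ (Z : QSet.{u}) (v : Var Γ Z), v.index ∉ U → v.vec a x = v.vec a z

theorem prodOff_congr (U : List ℕ) : (Γ : List QSet.{u}) → (a : (QSet.prodList Γ).At) → (k : ℕ) →
    (ξ : Covecs Γ a) → {x z : Vecs Γ a} →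
    (∀ (Z : QSet.{u}) (v : Var Γ Z), v.index + k ∉ U → v.vec a x = v.vec a z) →
    Covecs.prodOff U Γ a k ξ x = Covecs.prodOff U Γ a k ξ z
  | [], _, _, _, _, _, _ => rfl
  | X :: Γ, a, k, ξ, x, z, h => by
    have h2 := prodOff_congr U Γ a.2 (k + 1) ξ.2 (x := x.2) (z := z.2) fun Z v hv =>
      h Z v.tail (by simpa [Var.index, add_assoc, add_comm] using hv)
    simp only [Covecs.prodOff, h2]
    by_cases hk : k ∈ U
    · simp [hk]
    · have h1 : x.1 = z.1 := h X .head (by simpa [Var.index] using hk)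
      simp [hk, h1]

end Vecs

/-- Inserting a resolution of the identity at every position outside `U`, and nothing at the
positions in `U`, writes the identity as a sum of operators that freeze the outside entries at basis
vectors. This is what reconstructs a functional from its slices. -/
theorem id_mem_span_prodOff (U : List ℕ) : (Γ : List QSet.{u}) → (a : (QSet.prodList Γ).At) →
    (k : ℕ) → (LinearMap.id : (QSet.prodList Γ).H a →ₗ[ℂ] (QSet.prodList Γ).H a) ∈
      Submodule.span ℂ {P | ∃ (ξ : Covecs Γ a) (w : Vecs Γ a → Vecs Γ a) (x : Vecs Γ a), ∀ z,
        P (Vecs.tensor Γ a z) = Covecs.prodOff U Γ a k ξ z • Vecs.tensor Γ a (w z) ∧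
        (∀ (Z : QSet.{u}) (v : Var Γ Z), v.index + k ∉ U → v.vec a x = v.vec a (w z)) ∧
        (∀ (Z : QSet.{u}) (v : Var Γ Z), v.index + k ∈ U → v.vec a (w z) = v.vec a z)}
  | [], a, k => by
    refine Submodule.subset_span ⟨(), fun z => z, (), fun z => ⟨?_, ?_, ?_⟩⟩
    · simp [Covecs.prodOff]
    · rintro _ ⟨⟩
    · rintro _ ⟨⟩
  | X :: Γ, a, k => by
    have ih := id_mem_span_prodOff U Γ a.2 (k + 1)
    -- One admissible operator on the head factor is tensored with the expansion of the identity of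
    -- the tail. At a position in `U` the operator is the identity; elsewhere it has rank one with a
    -- fixed range vector.
    have key : ∀ L : X.H a.1 →ₗ[ℂ] X.H a.1,
        (∃ (ξ : StrongDual ℂ (X.H a.1)) (w : X.H a.1 → X.H a.1) (x : X.H a.1), ∀ z,
          L z = (if k ∈ U then 1 else ξ z) • w z ∧ (k ∉ U → x = w z) ∧ (k ∈ U → w z = z)) →
        TensorProduct.map L (LinearMap.id : (QSet.prodList Γ).H a.2 →ₗ[ℂ] _) ∈
          Submodule.span ℂ {P | ∃ (ξ : Covecs (X :: Γ) a) (w : Vecs (X :: Γ) a → Vecs (X :: Γ) a)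
            (x : Vecs (X :: Γ) a), ∀ z,
            P (Vecs.tensor (X :: Γ) a z) =
              Covecs.prodOff U (X :: Γ) a k ξ z • Vecs.tensor (X :: Γ) a (w z) ∧
            (∀ (Z : QSet.{u}) (v : Var (X :: Γ) Z),
              v.index + k ∉ U → v.vec a x = v.vec a (w z)) ∧
            (∀ (Z : QSet.{u}) (v : Var (X :: Γ) Z),
              v.index + k ∈ U → v.vec a (w z) = v.vec a z)} := by
      rintro L ⟨ξ, w, x, hL⟩
      change TensorProduct.mapBilinear (.id ℂ) (X.H a.1) _ (X.H a.1) _ L _ ∈ _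
      refine Submodule.span_induction
        (p := fun P _ => TensorProduct.mapBilinear (.id ℂ) (X.H a.1) _ (X.H a.1) _ L P ∈ _)
        ?_ ?_ ?_ ?_ ih
      · rintro P ⟨ξ', w', x', hP⟩
        refine Submodule.subset_span ⟨(ξ, ξ'), fun z => (w z.1, w' z.2), (x, x'), fun z => ?_⟩
        obtain ⟨h1, h2, h3⟩ := hL z.1
        obtain ⟨h1', h2', h3'⟩ := hP z.2
        refine ⟨?_, ?_, ?_⟩
        · change L z.1 ⊗ₜ[ℂ] P (Vecs.tensor Γ a.2 z.2) = _
          rw [h1, h1', TensorProduct.smul_tmul_smul]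
          rfl
        · intro Z v hv
          cases v with
          | head => exact h2 (by simpa [Var.index] using hv)
          | tail v => exact h2' Z v (by simpa [Var.index, add_assoc, add_comm] using hv)
        · intro Z v hv
          cases v with
          | head => exact h3 (by simpa [Var.index] using hv)
          | tail v => exact h3' Z v (by simpa [Var.index, add_assoc, add_comm] using hv)
      · rw [map_zero]; exact Submodule.zero_mem _
      · intro P Q _ _ hP hQ; rw [map_add]; exact Submodule.add_mem _ hP hQ
      · intro c P _ hP; rw [map_smul]; exact Submodule.smul_mem _ c hP
    by_cases hk : k ∈ U
    · have := key LinearMap.id ⟨0, fun z => z, 0, fun z => by simp [hk]⟩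
      rwa [TensorProduct.map_id] at this
    · have b := stdOrthonormalBasis ℂ (X.H a.1)
      have hid : (LinearMap.id : X.H a.1 →ₗ[ℂ] X.H a.1) =
          ∑ i, (LinearMap.toSpanSingleton ℂ _ (b i)) ∘ₗ (innerSL ℂ (b i) : X.H a.1 →ₗ[ℂ] ℂ) := by
        ext x
        simp [b.sum_repr' x]
      rw [← TensorProduct.map_id, hid]
      change TensorProduct.mapBilinear (.id ℂ) (X.H a.1) _ (X.H a.1) _ _ _ ∈ _
      rw [map_sum, LinearMap.sum_apply]
      refine Submodule.sum_mem _ fun i _ => ?_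
      exact key _ ⟨innerSL ℂ (b i), fun _ => b i, b i, fun z => by simp [hk]⟩

namespace Ren

theorem vecs_congr : {Γ : List QSet.{u}} → (Δ : List QSet.{u}) → (ρ : Ren Δ Γ) →
    {a : (QSet.prodList Γ).At} → {x z : Vecs Γ a} →
    (∀ (Z : QSet.{u}) (v : Var Γ Z), v.index ∈ ρ.indices Δ → v.vec a x = v.vec a z) →
    ρ.vecs Δ a x = ρ.vecs Δ a z
  | _, [], _, _, _, _, _ => rfl
  | _, _ :: Δ, ρ, _, _, _, h => Prod.ext (h _ _ List.mem_cons_self)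
      (vecs_congr Δ ρ.tail fun Z v hv => h Z v (List.mem_cons_of_mem _ hv))

end Ren

-- Slices of primitive formulas

namespace QRel

variable {Γ Δ : List QSet.{u}}

/-- A functional belongs to a primitive atomic formula if and only if its slices in the variables
of that formula belong to the relation. -/
theorem mem_atomic {R : QRel Δ} {ρ : Ren Δ Γ} {a : (QSet.prodList Γ).At}
    {f : StrongDual ℂ ((QSet.prodList Γ).H a)} :
    f ∈ atomic R ρ a ↔ ∀ x : Vecs Γ a, ∃ r ∈ R (ρ.atoms Δ a), ∀ z : Vecs Γ a,
      Vecs.AgreeOff (ρ.indices Δ) x z →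
      f (Vecs.tensor Γ a z) = r (Vecs.tensor Δ (ρ.atoms Δ a) (ρ.vecs Δ a z)) := by
  constructor
  · intro hf x
    refine Submodule.span_induction (p := fun f _ => ∃ r ∈ R (ρ.atoms Δ a), ∀ z : Vecs Γ a,
      Vecs.AgreeOff (ρ.indices Δ) x z →
      f (Vecs.tensor Γ a z) = r (Vecs.tensor Δ (ρ.atoms Δ a) (ρ.vecs Δ a z))) ?_ ?_ ?_ ?_ hf
    · rintro f ⟨r, hr, ξ, h⟩
      refine ⟨Covecs.prodOff (ρ.indices Δ) Γ a 0 ξ x • r, Submodule.smul_mem _ _ hr, fun z hz => ?_⟩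
      rw [h, Vecs.prodOff_congr _ _ _ _ ξ (x := x) (z := z) fun Z v hv => hz Z v hv, mul_comm]
      rfl
    · exact ⟨0, Submodule.zero_mem _, fun z _ => rfl⟩
    · rintro f g _ _ ⟨r, hr, h⟩ ⟨s, hs, k⟩
      exact ⟨r + s, Submodule.add_mem _ hr hs, fun z hz => by
        rw [add_apply, add_apply, h z hz, k z hz]⟩
    · rintro c f _ ⟨r, hr, h⟩
      exact ⟨c • r, Submodule.smul_mem _ _ hr, fun z hz => by
        rw [smul_apply, smul_apply, h z hz]⟩
  · intro h
    -- Composing f with the expansion of the identity gives a sum of terms (slice of f) · (product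
    -- of functionals in the other variables), and these are the generators of `atomic`.
    have hid := id_mem_span_prodOff (ρ.indices Δ) Γ a 0
    have : LinearMap.toContinuousLinearMap ((f : (QSet.prodList Γ).H a →ₗ[ℂ] ℂ) ∘ₗ .id) ∈
        atomic R ρ a := by
      refine Submodule.span_induction (p := fun P _ => LinearMap.toContinuousLinearMap
        ((f : (QSet.prodList Γ).H a →ₗ[ℂ] ℂ) ∘ₗ P) ∈ atomic R ρ a) ?_ ?_ ?_ ?_ hid
      · rintro P ⟨ξ, w, x, hP⟩
        obtain ⟨r, hr, hx⟩ := h x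
        refine Submodule.subset_span ⟨r, hr, ξ, fun z => ?_⟩
        obtain ⟨h1, h2, h3⟩ := hP z
        have h4 := hx (w z) fun Z v hv => h2 Z v hv
        have h5 : ρ.vecs Δ a (w z) = ρ.vecs Δ a z := Ren.vecs_congr Δ ρ fun Z v hv => h3 Z v hv
        rw [h5] at h4
        simp [h1, h4, mul_comm]
      · simp
      · intro P Q _ _ hP hQ
        rw [LinearMap.comp_add, map_add]; exact Submodule.add_mem _ hP hQ
      · intro c P _ hP
        rw [LinearMap.comp_smul, map_smul]; exact Submodule.smul_mem _ c hP
    convert this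
    ext; rfl

end QRel

namespace Var

/-- Replacement of one component of a tuple of vectors. -/
def set : {Γ : List QSet.{u}} → {X : QSet.{u}} → (v : Var Γ X) → (a : (QSet.prodList Γ).At) →
    X.H (v.atom a) → Vecs Γ a → Vecs Γ a
  | _, _, .head, _, h, x => (h, x.2)
  | _, _, .tail v, a, h, x => (x.1, v.set a.2 h x.2)

theorem vec_set_self : {Γ : List QSet.{u}} → {X : QSet.{u}} → (v : Var Γ X) →
    (a : (QSet.prodList Γ).At) → (h : X.H (v.atom a)) → (x : Vecs Γ a) →
    v.vec a (v.set a h x) = h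
  | _, _, .head, _, _, _ => rfl
  | _, _, .tail v, a, h, x => vec_set_self v a.2 h x.2

theorem set_vec_self : {Γ : List QSet.{u}} → {X : QSet.{u}} → (v : Var Γ X) →
    (a : (QSet.prodList Γ).At) → (x : Vecs Γ a) → v.set a (v.vec a x) x = x
  | _, _, .head, _, _ => rfl
  | _, _, .tail v, a, x => Prod.ext rfl (set_vec_self v a.2 x.2)

theorem vec_set_of_ne : {Γ : List QSet.{u}} → {X Y : QSet.{u}} → (v : Var Γ X) → (w : Var Γ Y) →
    (a : (QSet.prodList Γ).At) → (h : X.H (v.atom a)) → (x : Vecs Γ a) → w.index ≠ v.index →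
    w.vec a (v.set a h x) = w.vec a x
  | _, _, _, .head, .head, _, _, _, hne => absurd rfl hne
  | _, _, _, .head, .tail _, _, _, _, _ => rfl
  | _, _, _, .tail _, .head, _, _, _, _ => rfl
  | _, _, _, .tail v, .tail w, a, h, x, hne =>
    vec_set_of_ne v w a.2 h x.2 fun e => hne (congrArg (· + 1) e)

theorem vec_set_congr : {Γ : List QSet.{u}} → {X Y : QSet.{u}} → (v : Var Γ X) → (w : Var Γ Y) →
    (a : (QSet.prodList Γ).At) → (h : X.H (v.atom a)) → (x z : Vecs Γ a) → w.index = v.index →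
    w.vec a (v.set a h x) = w.vec a (v.set a h z)
  | _, _, _, .head, .head, _, _, _, _, _ => rfl
  | _, _, _, .head, .tail _, _, _, _, _, e => absurd e (Nat.succ_ne_zero _)
  | _, _, _, .tail _, .head, _, _, _, _, e => absurd e.symm (Nat.succ_ne_zero _)
  | _, _, _, .tail v, .tail w, a, h, x, z, e =>
    vec_set_congr v w a.2 h x.2 z.2 (Nat.succ_injective e)

theorem exists_tensor_set : {Γ : List QSet.{u}} → {X : QSet.{u}} → (v : Var Γ X) →
    (a : (QSet.prodList Γ).At) → (x : Vecs Γ a) →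
    ∃ L : X.H (v.atom a) →ₗ[ℂ] (QSet.prodList Γ).H a,
      ∀ h, Vecs.tensor Γ a (v.set a h x) = L h
  | _ :: Γ, X, .head, a, x =>
    ⟨(TensorProduct.mk ℂ (X.H a.1) _).flip (Vecs.tensor Γ a.2 x.2), fun _ => rfl⟩
  | Y :: Γ, X, .tail v, a, x => by
    obtain ⟨L, hL⟩ := exists_tensor_set v a.2 x.2
    exact ⟨TensorProduct.mk ℂ (Y.H a.1) _ x.1 ∘ₗ L, fun h =>
      congrArg (fun t => x.1 ⊗ₜ[ℂ] t) (hL h)⟩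

end Var

theorem Vecs.AgreeOff.set {Γ : List QSet.{u}} {X : QSet.{u}} {a : (QSet.prodList Γ).At}
    {x z : Vecs Γ a} (v : Var Γ X) {U : List ℕ} (h : AgreeOff (v.index :: U) x z)
    (t : X.H (v.atom a)) : AgreeOff U (v.set a t x) (v.set a t z) := by
  intro Z w hw
  by_cases e : w.index = v.index
  · exact Var.vec_set_congr v w a t x z e
  · rw [Var.vec_set_of_ne v w a t x e, Var.vec_set_of_ne v w a t z e]
    exact h Z w (by simp [e, hw])

namespace QRel

/-- With the other entries frozen, f is multilinear in the selected ones, so it factors through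
their tensor product. Distinctness of the variables is essential: a repeated variable would have to
enter r more than linearly. -/
theorem exists_slice {Γ : List QSet.{u}} {a : (QSet.prodList Γ).At} : (Δ : List QSet.{u}) →
    (ρ : Ren Δ Γ) → (ρ.indices Δ).Nodup → (f : StrongDual ℂ ((QSet.prodList Γ).H a)) →
    (x : Vecs Γ a) → ∃ r : StrongDual ℂ ((QSet.prodList Δ).H (ρ.atoms Δ a)), ∀ z,
      Vecs.AgreeOff (ρ.indices Δ) x z →
      f (Vecs.tensor Γ a z) = r (Vecs.tensor Δ (ρ.atoms Δ a) (ρ.vecs Δ a z))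
  | [], ρ, _, f, x => by
    refine ⟨f (Vecs.tensor Γ a x) • ContinuousLinearMap.id ℂ ℂ, fun z hz => ?_⟩
    have : x = z := Vecs.ext_vec fun Z v => hz Z v (by simp [Ren.indices])
    subst this
    change _ = f (Vecs.tensor Γ a x) * 1
    rw [mul_one]
  | Y :: Δ, ρ, hρ, f, x => by
    set v := ρ _ .head with hv
    have b := stdOrthonormalBasis ℂ (Y.H (v.atom a))
    have hρ' : v.index ∉ ρ.tail.indices Δ ∧ (ρ.tail.indices Δ).Nodup := List.nodup_cons.1 hρ
    choose r hr using fun i => exists_slice Δ ρ.tail hρ'.2 f (v.set a (b i) x)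
    refine ⟨∑ i, StrongDual.tmul (innerSL ℂ (b i)) (r i), fun z hz => ?_⟩
    obtain ⟨L, hL⟩ := v.exists_tensor_set a z
    have h1 : Vecs.tensor Γ a z = ∑ i, inner ℂ (b i) (v.vec a z) • Vecs.tensor Γ a (v.set a (b i) z) := by
      simp only [hL, ← map_smul, ← map_sum, b.sum_repr']
      rw [← hL, Var.set_vec_self]
    rw [h1, map_sum]
    have h2 : Vecs.tensor (Y :: Δ) (ρ.atoms (Y :: Δ) a) (ρ.vecs (Y :: Δ) a z) =
      v.vec a z ⊗ₜ[ℂ] Vecs.tensor Δ (ρ.tail.atoms Δ a) (ρ.tail.vecs Δ a z) := rfl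
    have h3 : ∀ i, f (Vecs.tensor Γ a (v.set a (b i) z)) =
        r i (Vecs.tensor Δ (ρ.tail.atoms Δ a) (ρ.tail.vecs Δ a z)) := fun i => by
      rw [hr i _ (Vecs.AgreeOff.set v hz (b i))]
      congr 2
      refine Ren.vecs_congr Δ ρ.tail fun Z w hw => Var.vec_set_of_ne v w a _ _ ?_
      rintro e
      exact hρ'.1 (e ▸ hw)
    rw [h2]
    simp only [map_smul, h3]
    refine Eq.trans ?_ (sum_apply Finset.univ (fun i => StrongDual.tmul (innerSL ℂ (b i)) (r i))
      (v.vec a z ⊗ₜ[ℂ] _)).symm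
    exact Finset.sum_congr rfl fun i _ =>
      (StrongDual.tmul_apply (innerSL ℂ (b i)) (r i) (v.vec a z) _).symm

variable {Γ Δ : List QSet.{u}}

theorem atomic_eq_top {R : QRel Δ} {ρ : Ren Δ Γ} {a : (QSet.prodList Γ).At}
    (hρ : (ρ.indices Δ).Nodup) (h : R (ρ.atoms Δ a) = ⊤) : atomic R ρ a = ⊤ := by
  refine eq_top_iff.2 fun f _ => mem_atomic.2 fun x => ?_
  obtain ⟨r, hr⟩ := exists_slice Δ ρ hρ f x
  exact ⟨r, h ▸ Submodule.mem_top, hr⟩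

theorem atomic_eq_bot {R : QRel Δ} {ρ : Ren Δ Γ} {a : (QSet.prodList Γ).At}
    (h : R (ρ.atoms Δ a) = ⊥) : atomic R ρ a = ⊥ := by
  refine (Submodule.eq_bot_iff _).2 fun f hf => Vecs.functional_ext fun z => ?_
  obtain ⟨r, hr, hz⟩ := mem_atomic.1 hf z
  rw [h, Submodule.mem_bot] at hr
  rw [hz z fun _ _ _ => rfl, hr]; rfl

/-- The functionals `f` with `ξ ⊗ f ∈ φ` for all `ξ`. -/
theorem mem_all {X : QSet.{u}} {φ : QRel (X :: Γ)} {c : (QSet.prodList Γ).At}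
    {f : StrongDual ℂ ((QSet.prodList Γ).H c)} :
    f ∈ all φ c ↔ ∀ (a : X.At) (ξ : StrongDual ℂ (X.H a)), StrongDual.tmul ξ f ∈ φ (a, c) := by
  -- The condition is linear in f, so it defines a relation; by the description of ⊤_X × R through
  -- product functionals it is the largest R with ⊤_X × R ≤ φ.
  let S : QRel Γ := fun c =>
    { carrier := {f | ∀ (a : X.At) (ξ : StrongDual ℂ (X.H a)), StrongDual.tmul ξ f ∈ φ (a, c)}
      add_mem' := fun {f g} hf hg a ξ => by
        have : StrongDual.tmul ξ (f + g) = StrongDual.tmul ξ f + StrongDual.tmul ξ g :=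
          StrongDual.tensor_ext fun x y => by simp [mul_add]
        rw [this]; exact Submodule.add_mem _ (hf a ξ) (hg a ξ)
      zero_mem' := fun a ξ => by
        have : StrongDual.tmul ξ (0 : StrongDual ℂ ((QSet.prodList Γ).H c)) = 0 :=
          StrongDual.tensor_ext fun x y => by simp
        rw [this]; exact Submodule.zero_mem _
      smul_mem' := fun t f hf a ξ => by
        have : StrongDual.tmul ξ (t • f) = t • StrongDual.tmul ξ f :=
          StrongDual.tensor_ext fun x y => by simp [mul_left_comm]
        rw [this]; exact Submodule.smul_mem _ t (hf a ξ) }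
  have hS : all φ = S := by
    refine le_antisymm (sSup_le fun R hR c f hf a ξ => ?_) (le_sSup fun ac => ?_)
    · exact hR (a, c) (Submodule.subset_span ⟨ξ, f, hf, fun x y => StrongDual.tmul_apply ξ f x y⟩)
    · refine Submodule.span_le.2 ?_
      rintro g ⟨ξ, r, hr, h⟩
      have : g = StrongDual.tmul ξ r :=
        StrongDual.tensor_ext fun x y => (h x y).trans (StrongDual.tmul_apply ξ r x y).symm
      rw [this]
      exact hr ac.1 ξ
  rw [hS]; rfl

end QRel

/-! ## The inner product on functionals -/

section Inner

variable {H K : Type} [NormedAddCommGroup H] [InnerProductSpace ℂ H] [FiniteDimensional ℂ H]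
  [NormedAddCommGroup K] [InnerProductSpace ℂ K] [FiniteDimensional ℂ K]

/-- The dual inner product interchanges the two Riesz vectors, so pairing with f is evaluation at
the Riesz vector of f. Inner products of functionals are computed below by exhibiting that vector.
-/
theorem StrongDual.inner_eq_apply_symm (f g : StrongDual ℂ H) :
    inner ℂ f g = g ((InnerProductSpace.toDual ℂ H).symm f) :=
  InnerProductSpace.toDual_symm_apply

theorem StrongDual.inner_eq_apply {f : StrongDual ℂ H} {u : H} (h : ∀ x, f x = inner ℂ u x)
    (g : StrongDual ℂ H) : inner ℂ f g = g u := by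
  rw [StrongDual.inner_eq_apply_symm]
  congr 1
  rw [LinearIsometryEquiv.symm_apply_eq]
  ext x
  exact h x

theorem DualSpace.pairing_bra (x y : H) : pairing (bra x) y = inner ℂ x y := rfl

theorem DualSpace.inner_bra (x : H) (ξ : DualSpace H) : inner ℂ (bra x) ξ = pairing ξ x :=
  StrongDual.inner_eq_apply (f := innerSL ℂ x) (fun _ => rfl) ξ

theorem DualSpace.exists_bra (ξ : DualSpace H) : ∃ x, ξ = bra x :=
  ⟨(InnerProductSpace.toDual ℂ H).symm ξ, ((InnerProductSpace.toDual ℂ H).apply_symm_apply ξ).symm⟩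

/-- The pairing of a space with its dual, as a bilinear map. -/
noncomputable def DualSpace.pairingBilin (H : Type) [NormedAddCommGroup H] [InnerProductSpace ℂ H]
    [FiniteDimensional ℂ H] : H →ₗ[ℂ] DualSpace H →ₗ[ℂ] ℂ :=
  LinearMap.mk₂ ℂ (fun x ξ => DualSpace.pairing ξ x) (fun x y ξ => map_add (M := H) (N := ℂ) (F := StrongDual ℂ H) ξ x y)
    (fun c x ξ => map_smul (F := StrongDual ℂ H) ξ c x) (fun _ _ _ => rfl) (fun _ _ _ => rfl)

@[simp] theorem DualSpace.pairingBilin_apply (x : H) (ξ : DualSpace H) :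
    DualSpace.pairingBilin H x ξ = DualSpace.pairing ξ x := rfl

/-- The functional `x ⊗ (ξ ⊗ y) ↦ ξ(x) f(y)`. -/
noncomputable def evalTensor (H : Type) [NormedAddCommGroup H] [InnerProductSpace ℂ H]
    [FiniteDimensional ℂ H] :
    StrongDual ℂ K →ₗ[ℂ] StrongDual ℂ (H ⊗[ℂ] (DualSpace H ⊗[ℂ] K)) where
  toFun f := LinearMap.toContinuousLinearMap
    ((StrongDual.tmul (StrongDual.ofBilin (DualSpace.pairingBilin H)) f :
      (H ⊗[ℂ] DualSpace H) ⊗[ℂ] K →ₗ[ℂ] ℂ) ∘ₗ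
        (TensorProduct.assoc ℂ H (DualSpace H) K).symm.toLinearMap)
  map_add' f g := by
    refine StrongDual.tensor_ext fun x t => ?_
    induction t with
    | zero => simp
    | add t s ht hs => rw [TensorProduct.tmul_add, map_add, map_add, ht, hs]
    | tmul ξ y => simp [mul_add]
  map_smul' c f := by
    refine StrongDual.tensor_ext fun x t => ?_
    induction t with
    | zero => simp
    | add t s ht hs => rw [TensorProduct.tmul_add, map_add, map_add, ht, hs]
    | tmul ξ y => simp [mul_left_comm]

@[simp] theorem evalTensor_apply (f : StrongDual ℂ K) (x : H) (ξ : DualSpace H) (y : K) :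
    evalTensor H f (x ⊗ₜ[ℂ] (ξ ⊗ₜ[ℂ] y)) = DualSpace.pairing ξ x * f y := by
  simp [evalTensor]

/-- The map `g ↦ (y ↦ ∑ᵢ g(eᵢ ⊗ (⟨eᵢ| ⊗ y)))`, for an orthonormal basis `(eᵢ)`. -/
noncomputable def contract (H : Type) [NormedAddCommGroup H] [InnerProductSpace ℂ H]
    [FiniteDimensional ℂ H] :
    StrongDual ℂ (H ⊗[ℂ] (DualSpace H ⊗[ℂ] K)) →ₗ[ℂ] StrongDual ℂ K where
  toFun g := ∑ i, LinearMap.toContinuousLinearMap ((g : H ⊗[ℂ] (DualSpace H ⊗[ℂ] K) →ₗ[ℂ] ℂ) ∘ₗ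
    TensorProduct.mk ℂ H _ (stdOrthonormalBasis ℂ H i) ∘ₗ
      TensorProduct.mk ℂ (DualSpace H) K (DualSpace.bra (stdOrthonormalBasis ℂ H i)))
  map_add' f g := by ext y; simp [Finset.sum_add_distrib]
  map_smul' c g := by ext y; simp [Finset.mul_sum]

theorem contract_apply (g : StrongDual ℂ (H ⊗[ℂ] (DualSpace H ⊗[ℂ] K))) (y : K) :
    contract H g y = ∑ i, g (stdOrthonormalBasis ℂ H i ⊗ₜ[ℂ]
      (DualSpace.bra (stdOrthonormalBasis ℂ H i) ⊗ₜ[ℂ] y)) := by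
  simp [contract]

theorem DualSpace.pairing_eq_sum {ι : Type*} [Fintype ι] (b : OrthonormalBasis ι ℂ H)
    (ξ : DualSpace H) (x : H) :
    pairing ξ x = ∑ i, inner ℂ (b i) x * pairing ξ (b i) := by
  conv_lhs => rw [← b.sum_repr' x, ← pairingBilin_apply, map_sum, LinearMap.sum_apply]
  simp

/-- The Riesz vector of ev ⊗ f is ∑ᵢ eᵢ ⊗ ⟨eᵢ| ⊗ y, where y is that of f. Hence `contract` is the
adjoint of `evalTensor`, which turns the orthocomplements in ∃ = ¬∀¬ into images. -/
theorem inner_evalTensor (f : StrongDual ℂ K) (g : StrongDual ℂ (H ⊗[ℂ] (DualSpace H ⊗[ℂ] K))) :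
    inner ℂ (evalTensor H f) g = inner ℂ f (contract H g) := by
  rw [StrongDual.inner_eq_apply_symm f, contract_apply, ← map_sum]
  refine StrongDual.inner_eq_apply (fun t => ?_) g
  have : evalTensor H f = innerSL ℂ (∑ i, stdOrthonormalBasis ℂ H i ⊗ₜ[ℂ]
      (DualSpace.bra (stdOrthonormalBasis ℂ H i) ⊗ₜ[ℂ] (InnerProductSpace.toDual ℂ K).symm f)) := by
    refine StrongDual.tensor_ext₃ fun x ξ y => ?_
    simp only [evalTensor_apply, innerSL_apply_apply, sum_inner, TensorProduct.inner_tmul,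
      DualSpace.inner_bra, InnerProductSpace.toDual_symm_apply]
    rw [DualSpace.pairing_eq_sum (stdOrthonormalBasis ℂ H), Finset.sum_mul]
    simp only [mul_assoc]
  rw [this]; rfl

/-- The factor is ∑ᵢ ⟨eᵢ, eᵢ⟩. Thus `evalTensor` is a nonzero multiple of an isometry if H ≠ 0, and
an isometry if H is one-dimensional. -/
theorem contract_evalTensor (f : StrongDual ℂ K) :
    contract H (evalTensor H f) = (Module.finrank ℂ H : ℂ) • f := by
  ext y
  simp [contract_apply, DualSpace.pairing_bra]

theorem contract_tmul (ξ : StrongDual ℂ H) (η : StrongDual ℂ (DualSpace H)) (f : StrongDual ℂ K) :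
    ∃ c : ℂ, contract H (StrongDual.tmul ξ (StrongDual.tmul η f)) = c • f := by
  refine ⟨∑ i, ξ (stdOrthonormalBasis ℂ H i) * η (DualSpace.bra (stdOrthonormalBasis ℂ H i)), ?_⟩
  ext y
  simp [contract_apply, Finset.sum_mul, mul_assoc]

theorem evalTensor_eq_sum (f : StrongDual ℂ K) :
    evalTensor H f = ∑ i, StrongDual.tmul (innerSL ℂ (stdOrthonormalBasis ℂ H i))
      (StrongDual.tmul (LinearMap.toContinuousLinearMap
        (DualSpace.pairingBilin H (stdOrthonormalBasis ℂ H i))) f) := by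
  refine StrongDual.tensor_ext₃ fun x ξ y => ?_
  rw [evalTensor_apply, DualSpace.pairing_eq_sum (stdOrthonormalBasis ℂ H)]
  simp [Finset.sum_mul, mul_assoc]

end Inner

/-- Several definitions take the span of a set that is already a subspace; this removes the span.
The scalar `c'` may differ from `c` because conjugation and adjoints are antilinear. -/
theorem Submodule.mem_span_of_rel {A B : Type*} [AddCommGroup A] [Module ℂ A] [AddCommGroup B]
    [Module ℂ B] {P : Submodule ℂ A} {Q : A → B → Prop} (h0 : Q 0 0)
    (hadd : ∀ g g' f f', Q g f → Q g' f' → Q (g + g') (f + f'))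
    (hsmul : ∀ (c : ℂ) g f, Q g f → ∃ c' : ℂ, Q (c' • g) (c • f)) {f : B} :
    f ∈ Submodule.span ℂ {f | ∃ g ∈ P, Q g f} ↔ ∃ g ∈ P, Q g f := by
  refine ⟨fun hf => ?_, fun hf => Submodule.subset_span hf⟩
  refine Submodule.span_induction (p := fun f _ => ∃ g ∈ P, Q g f) (fun f hf => hf)
    ⟨0, P.zero_mem, h0⟩ ?_ ?_ hf
  · rintro f f' _ _ ⟨g, hg, h⟩ ⟨g', hg', h'⟩
    exact ⟨g + g', P.add_mem hg hg', hadd _ _ _ _ h h'⟩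
  · rintro c f _ ⟨g, hg, h⟩
    obtain ⟨c', h'⟩ := hsmul c g f h
    exact ⟨c' • g, P.smul_mem _ hg, h'⟩

namespace BRel

variable {X Y Z W : QSet.{u}}

theorem mem_id_self {a : X.At} {f : X.H a →L[ℂ] X.H a} :
    f ∈ id X a a ↔ ∃ t : ℂ, ∀ x, f x = t • x := by
  constructor
  · intro hf
    refine Submodule.span_induction (p := fun f _ => ∃ t : ℂ, ∀ x, f x = t • x) ?_ ?_ ?_ ?_ hf
    · rintro f ⟨_, h⟩; exact ⟨1, fun x => by rw [h, one_smul]⟩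
    · exact ⟨0, fun x => by simp⟩
    · rintro f g _ _ ⟨t, h⟩ ⟨s, k⟩; exact ⟨t + s, fun x => by simp [h, k, add_smul]⟩
    · rintro c f _ ⟨t, h⟩; exact ⟨c * t, fun x => by simp [h, mul_smul]⟩
  · rintro ⟨t, h⟩
    have : f = t • ContinuousLinearMap.id ℂ (X.H a) := by ext x; simp [h]
    rw [this]
    exact Submodule.smul_mem _ _ (Submodule.subset_span ⟨rfl, fun x => rfl⟩)

theorem id_of_ne {a b : X.At} (h : a ≠ b) : id X a b = ⊥ := by
  refine Submodule.span_eq_bot.2 ?_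
  rintro f ⟨e, _⟩; exact absurd e h

theorem mem_eval_self {a : X.At} {u} {f : (X.prod X.dual).H (a, a) →L[ℂ] QSet.one.H u} :
    f ∈ eval X (a, a) u ↔ ∃ t : ℂ, ∀ (x : X.H a) (ξ : X.dual.H a),
      f (x ⊗ₜ[ℂ] ξ) = (t * DualSpace.pairing ξ x : ℂ) := by
  constructor
  · intro hf
    refine Submodule.span_induction (p := fun f _ => ∃ t : ℂ, ∀ (x : X.H a) (ξ : X.dual.H a),
      f (x ⊗ₜ[ℂ] ξ) = (t * DualSpace.pairing ξ x : ℂ)) ?_ ?_ ?_ ?_ hf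
    · rintro f ⟨_, h⟩; exact ⟨1, fun x ξ => by rw [one_mul]; exact h x ξ⟩
    · exact ⟨0, fun x ξ => by rw [zero_mul]; rfl⟩
    · rintro f g _ _ ⟨t, h⟩ ⟨s, k⟩
      exact ⟨t + s, fun x ξ => by rw [add_apply, h, k, add_mul]⟩
    · rintro c f _ ⟨t, h⟩
      exact ⟨c * t, fun x ξ => by rw [smul_apply, h, mul_assoc]; rfl⟩
  · rintro ⟨t, h⟩
    have : f = t • StrongDual.ofBilin (DualSpace.pairingBilin (X.H a)) := by
      refine StrongDual.tensor_ext fun x ξ => ?_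
      rw [h, smul_apply, StrongDual.ofBilin_apply]; rfl
    rw [this]
    exact Submodule.smul_mem _ _ (Submodule.subset_span ⟨rfl, fun x ξ =>
      StrongDual.ofBilin_apply _ _ _⟩)

theorem eval_of_ne {a b : X.At} {u} (h : a ≠ b) : eval X (a, b) u = ⊥ := by
  refine Submodule.span_eq_bot.2 ?_
  rintro f ⟨e, _⟩; exact absurd e h

end BRel

-- Quantification along the diagonal

namespace QRel

variable {Γ Δ : List QSet.{u}} {X Y Z : QSet.{u}}

theorem mem_of₂ {P : BRel (X.prod Y) QSet.one} {a : (QSet.prodList [X, Y]).At}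
    {f : StrongDual ℂ ((QSet.prodList [X, Y]).H a)} :
    f ∈ of₂ P a ↔ ∃ g ∈ P (a.1, a.2.1) PUnit.unit, ∀ (x : X.H a.1) (y : Y.H a.2.1),
      f (x ⊗ₜ[ℂ] (y ⊗ₜ[ℂ] (1 : ℂ))) = g (x ⊗ₜ[ℂ] y) := by
  refine Submodule.mem_span_of_rel (fun _ _ => rfl) ?_ ?_
  · intro g g' f f' h h' x y
    rw [add_apply, add_apply, h, h']
  · intro c g f h
    exact ⟨c, fun x y => by rw [smul_apply, smul_apply, h]⟩

theorem mem_of₃ {P : BRel ((X.prod Y).prod Z) QSet.one} {a : (QSet.prodList [X, Y, Z]).At}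
    {f : StrongDual ℂ ((QSet.prodList [X, Y, Z]).H a)} :
    f ∈ of₃ P a ↔ ∃ g ∈ P ((a.1, a.2.1), a.2.2.1) PUnit.unit,
      ∀ (x : X.H a.1) (y : Y.H a.2.1) (z : Z.H a.2.2.1),
      f (x ⊗ₜ[ℂ] (y ⊗ₜ[ℂ] (z ⊗ₜ[ℂ] (1 : ℂ)))) = g ((x ⊗ₜ[ℂ] y) ⊗ₜ[ℂ] z) := by
  refine Submodule.mem_span_of_rel (fun _ _ _ => rfl) ?_ ?_
  · intro g g' f f' h h' x y z
    rw [add_apply, add_apply, h, h']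
  · intro c g f h
    exact ⟨c, fun x y z => by rw [smul_apply, smul_apply, h]⟩

theorem mem_equality_self {a : X.At} {u : (QSet.prodList []).At}
    {f : StrongDual ℂ ((QSet.prodList [X, X.dual]).H (a, (a, u)))} :
    f ∈ equality X (a, (a, u)) ↔ ∃ t : ℂ, ∀ (x : X.H a) (ξ : X.dual.H a),
      f (x ⊗ₜ[ℂ] (ξ ⊗ₜ[ℂ] (1 : ℂ))) = t * DualSpace.pairing ξ x := by
  refine mem_of₂.trans ⟨?_, ?_⟩
  · rintro ⟨g, hg, h⟩
    obtain ⟨t, ht⟩ := BRel.mem_eval_self.1 hg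
    exact ⟨t, fun x ξ => (h x ξ).trans (ht x ξ)⟩
  · rintro ⟨t, ht⟩
    refine ⟨t • StrongDual.ofBilin (DualSpace.pairingBilin (X.H a)), BRel.mem_eval_self.2
      ⟨t, fun x ξ => ?_⟩, fun x ξ => (ht x ξ).trans ?_⟩
    · rw [smul_apply, StrongDual.ofBilin_apply]; rfl
    · rw [smul_apply, StrongDual.ofBilin_apply]; rfl

theorem equality_of_ne {a b : X.At} {u : (QSet.prodList []).At} (h : a ≠ b) :
    equality X (a, (b, u)) = ⊥ := by
  refine (Submodule.eq_bot_iff _).2 fun f hf => ?_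
  obtain ⟨g, hg, hfg⟩ := mem_of₂.1 hf
  rw [BRel.eval_of_ne h, Submodule.mem_bot] at hg
  refine Vecs.functional_ext (Γ := [X, X.dual]) fun z => ?_
  refine (hfg z.1 z.2.1).trans ?_
  rw [hg]; rfl

/-- The formula `E_X(x, x_*)` on the first two variables. -/
theorem mem_eqAtom_self {a : X.At} {c : (QSet.prodList Γ).At}
    {f : StrongDual ℂ ((QSet.prodList (X :: X.dual :: Γ)).H (a, (a, c)))} :
    f ∈ (eqAtom .head (.tail .head) : QRel (X :: X.dual :: Γ)) (a, (a, c)) ↔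
      ∃ g : StrongDual ℂ ((QSet.prodList Γ).H c), f = evalTensor (X.H a) g := by
  rw [eqAtom, mem_atomic]
  constructor
  · intro h
    -- Each slice of f in (x, x_*) is a multiple t · ev. As ev(e ⊗ ⟨e|) = 1 for a unit vector e, the
    -- value of f at e ⊗ ⟨e| is the coefficient t, and it defines g.
    obtain ⟨e, he⟩ := exists_norm_eq (X.H a) zero_le_one
    let g : StrongDual ℂ ((QSet.prodList Γ).H c) := LinearMap.toContinuousLinearMap
      ((f : X.H a ⊗[ℂ] (DualSpace (X.H a) ⊗[ℂ] (QSet.prodList Γ).H c) →ₗ[ℂ] ℂ) ∘ₗ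
      TensorProduct.mk ℂ (X.H a) _ e ∘ₗ
      TensorProduct.mk ℂ (DualSpace (X.H a)) _ (DualSpace.bra e))
    refine ⟨g, Vecs.functional_ext (Γ := X :: X.dual :: Γ) fun z => ?_⟩
    obtain ⟨r, hr, hz⟩ := h z
    obtain ⟨t, ht⟩ := mem_equality_self.1 hr
    have h1 := (hz z fun _ _ _ => rfl).trans (ht z.1 z.2.1)
    have h2 := (hz (e, (DualSpace.bra e, z.2.2)) fun Z v hv => by
      cases v with
      | head => simp [Ren.indices, Ren.cons, Var.index] at hv
      | tail v => cases v with
        | head => simp [Ren.indices, Ren.cons, Ren.tail, Var.index] at hv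
        | tail v => rfl).trans (ht e (DualSpace.bra e))
    have h3 : DualSpace.pairing (DualSpace.bra e) e = 1 := by
      rw [DualSpace.pairing_bra, inner_self_eq_norm_sq_to_K, he]; simp
    have h4 : t * DualSpace.pairing (DualSpace.bra e) e = t := by rw [h3, mul_one]
    replace h2 := h2.trans h4
    refine h1.trans ((evalTensor_apply g z.1 z.2.1 (Vecs.tensor Γ c z.2.2)).trans ?_).symm
    rw [← h2, mul_comm]
    rfl
  · rintro ⟨g, rfl⟩ x
    let r : StrongDual ℂ (X.H a ⊗[ℂ] (DualSpace (X.H a) ⊗[ℂ] ℂ)) :=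
      evalTensor (X.H a) (g (Vecs.tensor Γ c x.2.2) • ContinuousLinearMap.id ℂ ℂ)
    have hr : ∀ (y : X.H a) (ξ : DualSpace (X.H a)), r (y ⊗ₜ[ℂ] (ξ ⊗ₜ[ℂ] (1 : ℂ))) =
        g (Vecs.tensor Γ c x.2.2) * DualSpace.pairing ξ y := fun y ξ => by
      simp [r, mul_comm]
    refine ⟨r, mem_equality_self.2 ⟨g (Vecs.tensor Γ c x.2.2), hr⟩, fun z hz => ?_⟩
    have hz2 : x.2.2 = z.2.2 := Vecs.ext_vec fun Z v =>
      hz Z v.tail.tail (by simp [Ren.indices, Ren.cons, Ren.tail, Var.index])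
    refine (evalTensor_apply g z.1 z.2.1 (Vecs.tensor Γ c z.2.2)).trans ?_
    rw [← hz2, mul_comm]
    exact (hr z.1 z.2.1).symm

theorem eqAtom_of_ne {a b : X.At} {c : (QSet.prodList Γ).At} (h : a ≠ b) :
    (eqAtom .head (.tail .head) : QRel (X :: X.dual :: Γ)) (a, (b, c)) = ⊥ :=
  atomic_eq_bot (equality_of_ne h)

/-- Modus ponens for the Sasaki arrow. Split v = p + q along E ⊓ P; then q lies in E and is
orthogonal to E ⊓ P, so it is orthogonal to v and to p, hence to itself. -/
theorem mem_of_mem_imp {V : Type*} [NormedAddCommGroup V] [InnerProductSpace ℂ V]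
    [FiniteDimensional ℂ V] {E P : Submodule ℂ V} {v : V} (hE : v ∈ E)
    (h : v ∈ (E ⊓ (E ⊓ P)ᗮ)ᗮ) : v ∈ P := by
  obtain ⟨p, hp, q, hq, rfl⟩ := (E ⊓ P).exists_add_mem_mem_orthogonal v
  have hqE : q ∈ E := by simpa using E.sub_mem hE hp.1
  have h0 : inner ℂ q (p + q) = 0 := (Submodule.mem_orthogonal _ _).1 h q ⟨hqE, hq⟩
  rw [inner_add_right, Submodule.inner_left_of_mem_orthogonal hp hq, zero_add,
    inner_self_eq_zero] at h0
  rw [h0, add_zero]; exact hp.2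

theorem imp_apply (E P : QRel Γ) (c : (QSet.prodList Γ).At) :
    imp E P c = (E c ⊓ (E c ⊓ P c)ᗮ)ᗮ := by
  change (((E c)ᗮ)ᗮ ⊓ (E c ⊓ P c)ᗮ)ᗮ = _
  rw [Submodule.orthogonal_orthogonal]

/-- In one direction, ev ⊗ f is a sum of product functionals, all of which satisfy the Sasaki arrow,
and it satisfies the equality predicate, so modus ponens applies. In the other, a functional in E
orthogonal to E ⊓ φ has the form ev ⊗ g and is orthogonal to ev ⊗ f. Then g is orthogonal to f,
because the inner product of ev ⊗ f and ev ⊗ g is dim H times that of f and g; and every product ξ ⊗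
η ⊗ f contracts to a multiple of f, so it is orthogonal to ev ⊗ g. At distinct atoms E vanishes and
the arrow is total. -/
theorem mem_allDiag {φ : QRel (X :: X.dual :: Γ)} {c : (QSet.prodList Γ).At}
    {f : StrongDual ℂ ((QSet.prodList Γ).H c)} :
    f ∈ allDiag X φ c ↔ ∀ a : X.At, evalTensor (X.H a) f ∈ φ (a, (a, c)) := by
  rw [allDiag, mem_all]
  constructor
  · intro h a
    have hE : evalTensor (X.H a) f ∈
        (eqAtom .head (.tail .head) : QRel (X :: X.dual :: Γ)) (a, (a, c)) :=
      mem_eqAtom_self.2 ⟨f, rfl⟩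
    refine mem_of_mem_imp hE ((imp_apply (eqAtom .head (.tail .head)) φ (a, (a, c))).le ?_)
    rw [evalTensor_eq_sum]
    exact Submodule.sum_mem _ fun i _ => mem_all.1 (h a _) a _
  · intro h b η
    rw [mem_all]
    intro a ξ
    rw [imp_apply]
    by_cases hab : a = b
    · subst hab
      refine (Submodule.mem_orthogonal _ _).2 fun w hw => ?_
      obtain ⟨g, rfl⟩ := mem_eqAtom_self.1 hw.1
      have h0 := (Submodule.mem_orthogonal _ _).1 hw.2 _ ⟨mem_eqAtom_self.2 ⟨f, rfl⟩, h a⟩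
      rw [inner_evalTensor, contract_evalTensor, inner_smul_right] at h0
      have hd : (Module.finrank ℂ (X.H a) : ℂ) ≠ 0 :=
        Nat.cast_ne_zero.2 Module.finrank_pos.ne'
      have h1 : inner ℂ f g = 0 := (mul_eq_zero.1 h0).resolve_left hd
      obtain ⟨t, ht⟩ := contract_tmul ξ η f
      refine (inner_evalTensor g _).trans ?_
      rw [ht, inner_smul_right, inner_eq_zero_symm.1 h1, mul_zero]
    · rw [eqAtom_of_ne hab]; simp

/-- By `mem_allDiag`, (∀ (x = x_*)) ¬φ consists of the f for which every ev ⊗ f is orthogonal to φ.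
Since `contract` is the adjoint of `evalTensor`, this is the orthocomplement of the images; the
second negation removes the complement. -/
theorem exDiag_apply (φ : QRel (X :: X.dual :: Γ)) (c : (QSet.prodList Γ).At) :
    exDiag X φ c = ⨆ a : X.At, (φ (a, (a, c))).map (contract (X.H a)) := by
  have : allDiag X (neg φ) c = (⨆ a : X.At, (φ (a, (a, c))).map (contract (X.H a)))ᗮ := by
    ext f
    rw [mem_allDiag, Submodule.mem_orthogonal']
    constructor
    · intro h g hg
      refine Submodule.iSup_induction _ (motive := fun g => inner ℂ f g = 0) hg ?_ ?_ ?_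
      · rintro a _ ⟨g, hg, rfl⟩
        rw [← inner_evalTensor]
        exact (Submodule.mem_orthogonal' _ _).1 (h a) g hg
      · simp
      · intro g g' hg hg'; rw [inner_add_right, hg, hg', add_zero]
    · intro h a
      refine (Submodule.mem_orthogonal' _ _).2 fun g hg => ?_
      rw [inner_evalTensor]
      exact h _ (Submodule.mem_iSup_of_mem a ⟨g, hg, rfl⟩)
  change (allDiag X (neg φ) c)ᗮ = _
  rw [this, Submodule.orthogonal_orthogonal]

end QRel

/-! ## Classical sorts -/

/-- A quantum set all of whose atoms are one-dimensional. -/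
def QSet.IsClassical (Y : QSet.{u}) : Prop := ∀ a, Module.finrank ℂ (Y.H a) = 1

section OneDim

variable {H K : Type} [NormedAddCommGroup H] [InnerProductSpace ℂ H] [FiniteDimensional ℂ H]
  [NormedAddCommGroup K] [InnerProductSpace ℂ K] [FiniteDimensional ℂ K]

theorem finrank_strongDual : Module.finrank ℂ (StrongDual ℂ H) = Module.finrank ℂ H := by
  rw [← Subspace.dual_finrank_eq (K := ℂ) (V := H)]
  exact (LinearMap.toContinuousLinearMap (𝕜 := ℂ) (E := H) (F' := ℂ)).finrank_eq.symm

theorem exists_unit_smul (hH : Module.finrank ℂ H = 1) :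
    ∃ e : H, ‖e‖ = 1 ∧ ∀ x : H, x = inner ℂ e x • e := by
  have : Nontrivial H := Module.nontrivial_of_finrank_pos (R := ℂ) (by omega)
  obtain ⟨e, he⟩ := exists_norm_eq H zero_le_one
  have he0 : e ≠ 0 := by rintro rfl; simp at he
  refine ⟨e, he, fun x => ?_⟩
  obtain ⟨c, rfl⟩ := (finrank_eq_one_iff_of_nonzero' e he0).1 hH x
  rw [inner_smul_right, inner_self_eq_norm_sq_to_K, he]; simp

theorem evalTensor_surjective (hH : Module.finrank ℂ H = 1)
    (g : StrongDual ℂ (H ⊗[ℂ] (DualSpace H ⊗[ℂ] K))) :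
    ∃ f : StrongDual ℂ K, g = evalTensor H f := by
  obtain ⟨e, he, hx⟩ := exists_unit_smul hH
  refine ⟨LinearMap.toContinuousLinearMap ((g : H ⊗[ℂ] (DualSpace H ⊗[ℂ] K) →ₗ[ℂ] ℂ) ∘ₗ
    TensorProduct.mk ℂ H _ e ∘ₗ TensorProduct.mk ℂ (DualSpace H) K (DualSpace.bra e)), ?_⟩
  refine StrongDual.tensor_ext₃ fun x ξ y => ?_
  have hξ : ξ = DualSpace.pairing ξ e • DualSpace.bra e := by
    refine ContinuousLinearMap.ext (f := ξ) fun x => ?_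
    conv_lhs => rw [hx x]
    exact (map_smul (F := StrongDual ℂ H) ξ _ e).trans (mul_comm _ _)
  have hp : DualSpace.pairing ξ x = inner ℂ e x * DualSpace.pairing ξ e := by
    conv_lhs => rw [hx x]
    exact map_smul (F := StrongDual ℂ H) ξ _ e
  rw [evalTensor_apply, hp]
  conv_lhs => rw [hx x, hξ]
  simp [← TensorProduct.smul_tmul', mul_assoc, mul_left_comm]

/-- For one-dimensional H the two maps are mutually inverse. A preimage commutes with intersections
and an image with suprema, so ∃ over a classical sort commutes with both at a fixed atom. -/
theorem comap_evalTensor (hH : Module.finrank ℂ H = 1)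
    (S : Submodule ℂ (StrongDual ℂ (H ⊗[ℂ] (DualSpace H ⊗[ℂ] K)))) :
    S.comap (evalTensor H) = S.map (contract H) := by
  have h : ∀ f : StrongDual ℂ K, contract H (evalTensor H f) = f := fun f => by
    rw [contract_evalTensor, hH, Nat.cast_one, one_smul]
  ext f
  constructor
  · intro hf; exact ⟨_, hf, h f⟩
  · rintro ⟨g, hg, rfl⟩
    obtain ⟨f, rfl⟩ := evalTensor_surjective hH g
    rw [h]; exact hg

theorem comap_evalTensor_iSup (hH : Module.finrank ℂ H = 1) {ι : Sort*}
    (S : ι → Submodule ℂ (StrongDual ℂ (H ⊗[ℂ] (DualSpace H ⊗[ℂ] K)))) :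
    (⨆ i, S i).comap (evalTensor H) = ⨆ i, (S i).comap (evalTensor H) := by
  simp only [comap_evalTensor hH, Submodule.map_iSup]

end OneDim

namespace QSet

theorem isClassical_ofSet (A : Type) : (ofSet.{u} A).IsClassical := fun _ => Module.finrank_self ℂ

theorem IsClassical.dual {Y : QSet.{u}} (h : Y.IsClassical) : Y.dual.IsClassical := fun a =>
  finrank_strongDual.trans (h a)

theorem isClassical_prodList : (Δ : List QSet.{u}) → (∀ Y ∈ Δ, Y.IsClassical) →
    (prodList Δ).IsClassical
  | [], _ => fun _ => Module.finrank_self ℂ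
  | Y :: Δ, h => fun a => by
    have h1 := h Y List.mem_cons_self a.1
    have h2 := isClassical_prodList Δ (fun Z hZ => h Z (List.mem_cons_of_mem _ hZ)) a.2
    exact (Module.finrank_tensorProduct (R := ℂ) (S := ℂ)).trans (by rw [h1, h2])

end QSet

/-- A subspace of a line is a truth value. In the form of a supremum over a proposition it passes
through the suprema of the other quantifiers. -/
theorem Submodule.eq_iSup_prop {V : Type*} [AddCommGroup V] [Module ℂ V]
    (hV : Module.finrank ℂ V = 1) {S : Submodule ℂ V} {p : Prop} (h : (∃ f ∈ S, f ≠ 0) ↔ p) :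
    S = ⨆ _ : p, ⊤ := by
  by_cases hp : p
  · obtain ⟨f, hf, h0⟩ := h.2 hp
    rw [iSup_pos hp]
    refine eq_top_iff.2 fun g _ => ?_
    obtain ⟨c, rfl⟩ := (finrank_eq_one_iff_of_nonzero' f h0).1 hV g
    exact S.smul_mem c hf
  · refine Eq.trans ((Submodule.eq_bot_iff _).2 fun f hf => ?_) (iSup_neg hp).symm
    by_contra h0
    exact hp (h.1 ⟨f, hf, h0⟩)

theorem Submodule.iSup_prop_top_inf {V : Type*} [AddCommGroup V] [Module ℂ V] (p : Prop)
    (S : Submodule ℂ V) : (⨆ _ : p, (⊤ : Submodule ℂ V)) ⊓ S = ⨆ _ : p, S := by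
  by_cases hp : p <;> simp [hp]

theorem Submodule.inf_iSup_prop_top {V : Type*} [AddCommGroup V] [Module ℂ V] (p : Prop)
    (S : Submodule ℂ V) : S ⊓ (⨆ _ : p, (⊤ : Submodule ℂ V)) = ⨆ _ : p, S := by
  by_cases hp : p <;> simp [hp]

namespace BRel

variable {X Y Z W : QSet.{u}}

/-- The functional `x ⊗ ξ ↦ ξ(r x)`. -/
noncomputable def bendMap (H K : Type) [NormedAddCommGroup H] [InnerProductSpace ℂ H]
    [FiniteDimensional ℂ H] [NormedAddCommGroup K] [InnerProductSpace ℂ K]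
    [FiniteDimensional ℂ K] : (H →L[ℂ] K) →ₗ[ℂ] StrongDual ℂ (H ⊗[ℂ] DualSpace K) where
  toFun r := StrongDual.ofBilin ((DualSpace.pairingBilin K) ∘ₗ (r : H →ₗ[ℂ] K))
  map_add' r s := StrongDual.tensor_ext fun x ξ => by
    simp
  map_smul' c r := StrongDual.tensor_ext fun x ξ => by
    simp

@[simp] theorem bendMap_apply {H K : Type} [NormedAddCommGroup H] [InnerProductSpace ℂ H]
    [FiniteDimensional ℂ H] [NormedAddCommGroup K] [InnerProductSpace ℂ K]
    [FiniteDimensional ℂ K] (r : H →L[ℂ] K) (x : H) (ξ : DualSpace K) :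
    bendMap H K r (x ⊗ₜ[ℂ] ξ) = DualSpace.pairing ξ (r x) :=
  StrongDual.ofBilin_apply _ _ _

/-- The relations I_{Y*} and E_Y vanish at distinct atoms and are spanned by one element at equal
ones. So the only intermediate atom that matters is (b, b), and each generator is a multiple of the
bend of an element of R. -/
theorem mem_bend {R : BRel X Y} {a : X.At} {b : Y.At} {u : QSet.one.{u}.At}
    {f : StrongDual ℂ (X.H a ⊗[ℂ] DualSpace (Y.H b))} :
    f ∈ R.bend (a, b) u ↔ ∃ r ∈ R a b, f = bendMap _ _ r := by
  constructor
  · intro hf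
    refine Submodule.span_induction (p := fun f _ => ∃ r ∈ R a b, f = bendMap _ _ r) ?_ ?_ ?_ ?_ hf
    · rintro f ⟨⟨b1, b2⟩, s, hs, q, hq, rfl⟩
      have key : b1 = b2 → b = b2 → ∃ r ∈ R a b, s ∘L q = bendMap _ _ r := by
        rintro rfl rfl
        obtain ⟨t, ht⟩ := mem_eval_self.1 hs
        refine Submodule.span_induction
          (p := fun q _ => ∃ r ∈ R a b, s ∘L q = bendMap _ _ r) ?_ ?_ ?_ ?_ hq
        · rintro q ⟨r, hr, i, hi, h⟩
          obtain ⟨c, hc⟩ := mem_id_self.1 hi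
          refine ⟨(t * c) • r, Submodule.smul_mem _ _ hr, StrongDual.tensor_ext fun x ξ => ?_⟩
          rw [bendMap_apply]
          refine (congrArg s (h x ξ)).trans ((ht _ _).trans ?_)
          rw [hc]
          simp only [← DualSpace.pairingBilin_apply, smul_apply, map_smul, LinearMap.smul_apply,
            smul_eq_mul, mul_assoc]
        · exact ⟨0, Submodule.zero_mem _, by simp⟩
        · rintro q q' _ _ ⟨r, hr, h⟩ ⟨r', hr', h'⟩
          exact ⟨r + r', Submodule.add_mem _ hr hr', by
            rw [ContinuousLinearMap.comp_add, h, h', map_add]⟩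
        · rintro c q _ ⟨r, hr, h⟩
          exact ⟨c • r, Submodule.smul_mem _ _ hr, by
            rw [ContinuousLinearMap.comp_smul, h, map_smul]⟩
      by_cases h1 : b1 = b2
      · by_cases h2 : b = b2
        · exact key h1 h2
        · have : q = 0 := by
            refine (Submodule.mem_bot ℂ).1 (Submodule.span_le.2 ?_ hq)
            rintro q ⟨r, hr, i, hi, h⟩
            rw [id_of_ne (X := Y.dual) h2, Submodule.mem_bot] at hi
            refine (Submodule.mem_bot ℂ).2 (StrongDual.tensor_ext fun x ξ => ?_)
            rw [h, hi]; simp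
          exact ⟨0, Submodule.zero_mem _, by rw [this]; simp⟩
      · rw [eval_of_ne h1, Submodule.mem_bot] at hs
        exact ⟨0, Submodule.zero_mem _, by rw [hs]; simp⟩
    · exact ⟨0, Submodule.zero_mem _, by simp⟩
    · rintro f g _ _ ⟨r, hr, rfl⟩ ⟨s, hs, rfl⟩
      exact ⟨r + s, Submodule.add_mem _ hr hs, by rw [map_add]⟩
    · rintro c f _ ⟨r, hr, rfl⟩
      exact ⟨c • r, Submodule.smul_mem _ _ hr, by rw [map_smul]⟩
  · rintro ⟨r, hr, rfl⟩
    refine Submodule.subset_span ⟨(b, b), StrongDual.ofBilin (DualSpace.pairingBilin (Y.H b)),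
      mem_eval_self.2 ⟨1, fun x ξ => ?_⟩,
      LinearMap.toContinuousLinearMap (TensorProduct.map (r : X.H a →ₗ[ℂ] Y.H b) LinearMap.id),
      Submodule.subset_span ⟨r, hr, ContinuousLinearMap.id ℂ _, mem_id_self.2 ⟨1, fun x => ?_⟩,
        fun x ξ => rfl⟩, StrongDual.tensor_ext fun x ξ => ?_⟩
    · rw [one_mul]; exact StrongDual.ofBilin_apply _ _ _
    · rw [one_smul]; rfl
    · rw [bendMap_apply]
      exact (StrongDual.ofBilin_apply (DualSpace.pairingBilin (Y.H b)) (r x) ξ).symm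

end BRel

namespace Vecs

theorem AgreeOff.mono {Γ : List QSet.{u}} {a : (QSet.prodList Γ).At} {x z : Vecs Γ a}
    {U U' : List ℕ} (h : AgreeOff U x z) (hU : U ⊆ U') : AgreeOff U' x z :=
  fun Z v hv => h Z v fun h' => hv (hU h')

end Vecs

-- Slices in two variables and graphs of functions

namespace QRel

variable {Γ Δ : List QSet.{u}} {X Y Z : QSet.{u}}

/-- The functionals whose slices in the two given variables belong to `W`. -/
def loc (vx : Var Γ X) (vy : Var Γ Y) (c : (QSet.prodList Γ).At)
    (W : Submodule ℂ (StrongDual ℂ (X.H (vx.atom c) ⊗[ℂ] Y.H (vy.atom c)))) :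
    Submodule ℂ (StrongDual ℂ ((QSet.prodList Γ).H c)) where
  carrier := {f | ∀ x : Vecs Γ c, ∃ r ∈ W, ∀ z : Vecs Γ c, Vecs.AgreeOff [vx.index, vy.index] x z →
    f (Vecs.tensor Γ c z) = r (vx.vec c z ⊗ₜ[ℂ] vy.vec c z)}
  add_mem' {f g} hf hg x := by
    obtain ⟨r, hr, h⟩ := hf x
    obtain ⟨s, hs, k⟩ := hg x
    exact ⟨r + s, W.add_mem hr hs, fun z hz => by rw [add_apply, add_apply, h z hz, k z hz]⟩
  zero_mem' x := ⟨0, W.zero_mem, fun z _ => rfl⟩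
  smul_mem' t f hf x := by
    obtain ⟨r, hr, h⟩ := hf x
    exact ⟨t • r, W.smul_mem t hr, fun z hz => by rw [smul_apply, smul_apply, h z hz]⟩

/-- Quantification over a pair of variables that are absent from the formula has no effect: slices
of ev ⊗ f are multiples of slices of f, and freezing the new pair at e ⊗ ⟨e|, for a unit vector e,
gives back the slices of f. -/
theorem comap_evalTensor_loc {a : X.At} {c : (QSet.prodList Γ).At} (vy : Var Γ Y) (vz : Var Γ Z)
    (W : Submodule ℂ (StrongDual ℂ (Y.H (vy.atom c) ⊗[ℂ] Z.H (vz.atom c)))) :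
    (loc (Γ := X :: X.dual :: Γ) vy.tail.tail vz.tail.tail (a, (a, c)) W).comap
      (evalTensor (X.H a)) = loc vy vz c W := by
  ext f
  constructor
  · intro hf x
    obtain ⟨e, he⟩ := exists_norm_eq (X.H a) zero_le_one
    have h3 : DualSpace.pairing (DualSpace.bra e) e = 1 := by
      rw [DualSpace.pairing_bra, inner_self_eq_norm_sq_to_K, he]; simp
    obtain ⟨r, hr, h⟩ := hf (e, (DualSpace.bra e, x))
    refine ⟨r, hr, fun z hz => ?_⟩
    refine Eq.trans ?_ (h (e, (DualSpace.bra e, z)) fun U v hv => ?_)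
    · refine Eq.trans ?_ (evalTensor_apply f e (DualSpace.bra e) (Vecs.tensor Γ c z)).symm
      rw [h3, one_mul]
    · cases v with
      | head => rfl
      | tail v => cases v with
        | head => rfl
        | tail v => exact hz U v (by simpa [Var.index] using hv)
  · intro hf x
    obtain ⟨r, hr, h⟩ := hf x.2.2
    refine ⟨DualSpace.pairing (H := X.H a) x.2.1 x.1 • r, W.smul_mem _ hr, fun z hz => ?_⟩
    have h1 : x.1 = z.1 := hz X .head (by simp [Var.index])
    have h2 : x.2.1 = z.2.1 := hz X.dual (.tail .head) (by simp [Var.index])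
    have h3 := h z.2.2 fun U v hv => hz U v.tail.tail (by simpa [Var.index] using hv)
    refine (evalTensor_apply f z.1 z.2.1 (Vecs.tensor Γ c z.2.2)).trans ?_
    rw [h3, h1, h2]
    rfl

theorem exists_of₂ {H K : Type} [NormedAddCommGroup H] [InnerProductSpace ℂ H]
    [FiniteDimensional ℂ H] [NormedAddCommGroup K] [InnerProductSpace ℂ K] [FiniteDimensional ℂ K]
    (g : StrongDual ℂ (H ⊗[ℂ] K)) :
    ∃ f : StrongDual ℂ (H ⊗[ℂ] (K ⊗[ℂ] ℂ)), ∀ x y, f (x ⊗ₜ[ℂ] (y ⊗ₜ[ℂ] (1 : ℂ))) = g (x ⊗ₜ[ℂ] y) :=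
  ⟨LinearMap.toContinuousLinearMap ((g : H ⊗[ℂ] K →ₗ[ℂ] ℂ) ∘ₗ
    TensorProduct.map LinearMap.id (TensorProduct.rid ℂ K).toLinearMap), fun x y => by simp⟩

theorem exists_of₃ {H K L : Type} [NormedAddCommGroup H] [InnerProductSpace ℂ H]
    [FiniteDimensional ℂ H] [NormedAddCommGroup K] [InnerProductSpace ℂ K] [FiniteDimensional ℂ K]
    [NormedAddCommGroup L] [InnerProductSpace ℂ L] [FiniteDimensional ℂ L]
    (g : StrongDual ℂ ((H ⊗[ℂ] K) ⊗[ℂ] L)) :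
    ∃ f : StrongDual ℂ (H ⊗[ℂ] (K ⊗[ℂ] (L ⊗[ℂ] ℂ))), ∀ x y z,
      f (x ⊗ₜ[ℂ] (y ⊗ₜ[ℂ] (z ⊗ₜ[ℂ] (1 : ℂ)))) = g ((x ⊗ₜ[ℂ] y) ⊗ₜ[ℂ] z) :=
  ⟨LinearMap.toContinuousLinearMap ((g : (H ⊗[ℂ] K) ⊗[ℂ] L →ₗ[ℂ] ℂ) ∘ₗ
    (TensorProduct.assoc ℂ H K L).symm.toLinearMap ∘ₗ
    TensorProduct.map LinearMap.id (TensorProduct.map LinearMap.id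
      (TensorProduct.rid ℂ L).toLinearMap)), fun x y z => by simp⟩

theorem mem_atomic₃ {R : QRel [X, Y, Z]} {vx : Var Γ X} {vy : Var Γ Y} {vz : Var Γ Z}
    {c : (QSet.prodList Γ).At} {f : StrongDual ℂ ((QSet.prodList Γ).H c)} :
    f ∈ atomic R (.cons vx (.cons vy (.cons vz .nil))) c ↔ ∀ x : Vecs Γ c,
      ∃ r : StrongDual ℂ (X.H (vx.atom c) ⊗[ℂ] (Y.H (vy.atom c) ⊗[ℂ] (Z.H (vz.atom c) ⊗[ℂ] ℂ))),
      r ∈ R (vx.atom c, (vy.atom c, (vz.atom c, PUnit.unit))) ∧ ∀ z : Vecs Γ c,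
      Vecs.AgreeOff [vx.index, vy.index, vz.index] x z → f (Vecs.tensor Γ c z) =
        r (vx.vec c z ⊗ₜ[ℂ] (vy.vec c z ⊗ₜ[ℂ] (vz.vec c z ⊗ₜ[ℂ] (1 : ℂ)))) :=
  mem_atomic

/-- The graph of a function with values in a classical sort. -/
theorem atomic_graph₂ {F : BRel (X.prod Y) Z} (τ : Ren [X, Y] Γ) (w : Var Γ Z.dual)
    {c : (QSet.prodList Γ).At} (hZ : Module.finrank ℂ (Z.H (w.atom c)) = 1)
    {ζ : StrongDual ℂ (Z.H (w.atom c))} (hζ : ζ ≠ 0)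
    (hx : (τ _ .head).index ≠ w.index) (hy : (τ _ (.tail .head)).index ≠ w.index)
    {W : Submodule ℂ (StrongDual ℂ (X.H ((τ _ .head).atom c) ⊗[ℂ] Y.H ((τ _ (.tail .head)).atom c)))}
    (hW : ∀ r, r ∈ W ↔
      ∃ f ∈ F ((τ _ .head).atom c, (τ _ (.tail .head)).atom c) (w.atom c), ∀ t, r t = ζ (f t)) :
    atomic F.graph₂ (Ren.snoc [X, Y] τ w) c = loc (τ _ .head) (τ _ (.tail .head)) c W := by
  have hζ' : ∀ z : StrongDual ℂ (Z.H (w.atom c)), ∃ s : ℂ, s • ζ = z := fun z =>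
    (finrank_eq_one_iff_of_nonzero' ζ hζ).1 (finrank_strongDual.trans hZ) z
  ext f
  refine (mem_atomic₃ (R := F.graph₂) (vx := τ _ .head) (vy := τ _ (.tail .head))
    (vz := w)).trans ?_
  constructor
  · intro h x
    obtain ⟨r, hr, hz⟩ := h x
    obtain ⟨g, hg, hrg⟩ := mem_of₃.1 hr
    obtain ⟨f0, hf0, hgf⟩ := BRel.mem_bend.1 hg
    obtain ⟨s, hs⟩ := hζ' (w.vec c x)
    refine ⟨s • (ζ ∘L f0), W.smul_mem s ((hW _).2 ⟨f0, hf0, fun t => rfl⟩), fun z hxz => ?_⟩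
    refine (hz z (hxz.mono (by simp))).trans ?_
    refine (hrg ((τ _ .head).vec c z) ((τ _ (.tail .head)).vec c z) (w.vec c z)).trans ?_
    rw [hgf]
    refine (BRel.bendMap_apply f0 _ _).trans ?_
    have : w.vec c z = s • ζ :=
      (hxz _ w (by simp [hx.symm, hy.symm])).symm.trans hs.symm
    rw [this]
    rfl
  · intro h x
    -- In `loc` the variable w is frozen, whereas in the graph it is free. It is frozen here at the
    -- generator ζ; any other value is a multiple of ζ, and f is linear in that entry.
    obtain ⟨r, hr, hz⟩ := h (w.set c ζ x)
    obtain ⟨f0, hf0, hrf⟩ := (hW r).1 hr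
    have hg : BRel.bendMap _ _ f0 ∈ F.bend (((τ _ .head).atom c, (τ _ (.tail .head)).atom c),
      w.atom c) PUnit.unit := BRel.mem_bend.2 ⟨f0, hf0, rfl⟩
    obtain ⟨r3, hr3⟩ := exists_of₃ (BRel.bendMap _ _ f0)
    have hr3' : r3 ∈ F.graph₂ ((τ _ .head).atom c, ((τ _ (.tail .head)).atom c,
      (w.atom c, PUnit.unit))) := mem_of₃.2 ⟨_, hg, hr3⟩
    refine ⟨r3, hr3', fun z hxz => ?_⟩
    suffices h0 : f (Vecs.tensor Γ c z) = DualSpace.pairing (w.vec c z)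
        (f0 ((τ _ .head).vec c z ⊗ₜ[ℂ] (τ _ (.tail .head)).vec c z)) from
      h0.trans ((hr3 ((τ _ .head).vec c z) ((τ _ (.tail .head)).vec c z) (w.vec c z)).trans
        (BRel.bendMap_apply _ _ _)).symm
    obtain ⟨s, hs⟩ := hζ' (w.vec c z)
    obtain ⟨L, hL⟩ := w.exists_tensor_set c z
    have h1 := hz (w.set c ζ z) (Vecs.AgreeOff.set w (hxz.mono (by simp)) ζ)
    rw [Var.vec_set_of_ne w _ c ζ z hx, Var.vec_set_of_ne w _ c ζ z hy, hrf] at h1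
    have h2 : Vecs.tensor Γ c z = s • Vecs.tensor Γ c (w.set c ζ z) := by
      conv_lhs => rw [← w.set_vec_self c z]
      refine (hL _).trans ?_
      rw [← hs]
      exact (map_smul L s _).trans (congrArg (s • ·) (hL _).symm)
    rw [h2, map_smul, h1, ← hs]
    rfl

theorem atomic_of_prop {R : QRel Δ} {ρ : Ren Δ Γ} {c : (QSet.prodList Γ).At} {p : Prop}
    (hρ : (ρ.indices Δ).Nodup) (h : R (ρ.atoms Δ c) = ⨆ _ : p, ⊤) :
    atomic R ρ c = ⨆ _ : p, ⊤ := by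
  by_cases hp : p
  · rw [iSup_pos hp] at h ⊢; exact atomic_eq_top hρ h
  · rw [iSup_neg hp] at h ⊢; exact atomic_eq_bot h

theorem comap_evalTensor_iSup_prop {a : X.At} (hX : X.IsClassical) {c : (QSet.prodList Γ).At}
    (p : Prop) :
    (⨆ _ : p, (⊤ : Submodule ℂ (StrongDual ℂ ((QSet.prodList (X :: X.dual :: Γ)).H
      (a, (a, c)))))).comap (evalTensor (X.H a)) = ⨆ _ : p, ⊤ :=
  (comap_evalTensor_iSup (hX a) _).trans rfl

theorem exDiag_classical (hX : X.IsClassical) (φ : QRel (X :: X.dual :: Γ))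
    (c : (QSet.prodList Γ).At) :
    exDiag X φ c = ⨆ a : X.At, (φ (a, (a, c))).comap (evalTensor (X.H a)) := by
  rw [exDiag_apply]
  exact iSup_congr fun a => (comap_evalTensor (hX a) _).symm

end QRel

section Bra

variable {H K L : Type} [NormedAddCommGroup H] [InnerProductSpace ℂ H] [FiniteDimensional ℂ H]
  [NormedAddCommGroup K] [InnerProductSpace ℂ K] [FiniteDimensional ℂ K]
  [NormedAddCommGroup L] [InnerProductSpace ℂ L] [FiniteDimensional ℂ L]

theorem DualSpace.bra_zero : bra (0 : H) = 0 := (innerSL ℂ (E := H)).map_zero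

theorem DualSpace.bra_add (x y : H) : bra (x + y) = bra x + bra y :=
  (innerSL ℂ (E := H)).map_add x y

theorem DualSpace.bra_smul (c : ℂ) (x : H) : bra (c • x) = star c • bra x :=
  (innerSL ℂ (E := H)).map_smulₛₗ c x

theorem StrongDual.tensor_ext₃' {f g : StrongDual ℂ ((H ⊗[ℂ] K) ⊗[ℂ] L)}
    (h : ∀ x y z, f ((x ⊗ₜ y) ⊗ₜ z) = g ((x ⊗ₜ y) ⊗ₜ z)) : f = g := by
  refine StrongDual.tensor_ext fun t z => ?_
  induction t with
  | zero => simp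
  | add t s ht hs => rw [TensorProduct.add_tmul, map_add, map_add, ht, hs]
  | tmul x y => exact h x y z

end Bra

/-! ## Relations between classical sorts -/

namespace BRel

variable {X Y Z W : QSet.{u}}

theorem bendMap_injective (H K : Type) [NormedAddCommGroup H] [InnerProductSpace ℂ H]
    [FiniteDimensional ℂ H] [NormedAddCommGroup K] [InnerProductSpace ℂ K]
    [FiniteDimensional ℂ K] : Function.Injective (bendMap H K) := by
  refine (injective_iff_map_eq_zero _).2 fun r hr => ContinuousLinearMap.ext fun x => ?_
  have h := bendMap_apply r x (DualSpace.bra (r x))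
  rw [hr, DualSpace.pairing_bra] at h
  exact inner_self_eq_zero.1 h.symm

theorem bend_ne_bot {R : BRel X Y} {a : X.At} {b : Y.At} {u : QSet.one.{u}.At} :
    (∃ f ∈ R.bend (a, b) u, f ≠ 0) ↔ ∃ r ∈ R a b, r ≠ 0 := by
  constructor
  · rintro ⟨f, hf, h0⟩
    obtain ⟨r, hr, rfl⟩ := mem_bend.1 hf
    exact ⟨r, hr, by rintro rfl; exact h0 (map_zero _)⟩
  · rintro ⟨r, hr, h0⟩
    exact ⟨bendMap _ _ r, mem_bend.2 ⟨r, hr, rfl⟩, fun h =>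
      h0 (bendMap_injective _ _ (h.trans (map_zero _).symm))⟩

theorem iSup_prop_top_ne_bot {V : Type*} [AddCommGroup V] [Module ℂ V] [Nontrivial V] {p : Prop} :
    (∃ f ∈ (⨆ _ : p, ⊤ : Submodule ℂ V), f ≠ 0) ↔ p := by
  by_cases hp : p
  · simpa [hp] using exists_ne (0 : V)
  · simp [hp]

theorem mem_conj {R : BRel X Y} {a : X.At} {b : Y.At} {f : X.dual.H a →L[ℂ] Y.dual.H b} :
    f ∈ R.conj a b ↔ ∃ r ∈ R a b, ∀ x : X.H a, f (DualSpace.bra x) = DualSpace.bra (r x) := by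
  refine Submodule.mem_span_of_rel (fun x => ?_) ?_ ?_
  · exact DualSpace.bra_zero.symm
  · intro g g' f f' h h' x
    rw [add_apply, add_apply, h, h']
    exact (DualSpace.bra_add _ _).symm
  · intro c g f h
    refine ⟨star c, fun x => ?_⟩
    rw [smul_apply, smul_apply, h, DualSpace.bra_smul, star_star]

theorem mem_conj₂ {R : BRel (X.prod Y) Z} {a : X.At} {b : Y.At} {c : Z.At}
    {f : (X.dual.prod Y.dual).H (a, b) →L[ℂ] Z.dual.H c} :
    f ∈ R.conj₂ (a, b) c ↔ ∃ r ∈ R (a, b) c, ∀ (x : X.H a) (y : Y.H b),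
      f (DualSpace.bra x ⊗ₜ[ℂ] DualSpace.bra y) = DualSpace.bra (r (x ⊗ₜ[ℂ] y)) := by
  refine Submodule.mem_span_of_rel (fun x y => ?_) ?_ ?_
  · exact DualSpace.bra_zero.symm
  · intro g g' f f' h h' x y
    rw [add_apply, add_apply, h, h']
    exact (DualSpace.bra_add _ _).symm
  · intro c' g f h
    refine ⟨star c', fun x y => ?_⟩
    rw [smul_apply, smul_apply, h, DualSpace.bra_smul, star_star]

theorem mem_conjDual {R : BRel (X.prod Y.dual) Z} {a : X.At} {b : Y.At} {c : Z.At}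
    {f : (X.dual.prod Y).H (a, b) →L[ℂ] Z.dual.H c} :
    f ∈ R.conjDual (a, b) c ↔ ∃ r ∈ R (a, b) c, ∀ (x : X.H a) (y : Y.H b),
      f (DualSpace.bra x ⊗ₜ[ℂ] y) = DualSpace.bra (r (x ⊗ₜ[ℂ] DualSpace.bra y)) := by
  refine Submodule.mem_span_of_rel (fun x y => ?_) ?_ ?_
  · exact DualSpace.bra_zero.symm
  · intro g g' f f' h h' x y
    rw [add_apply, add_apply, h, h']
    exact (DualSpace.bra_add _ _).symm
  · intro c' g f h
    refine ⟨star c', fun x y => ?_⟩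
    rw [smul_apply, smul_apply, h, DualSpace.bra_smul, star_star]

theorem ofElemConj_ne_bot {A : Type} (α : A) {u : QSet.one.{u}.At}
    {d : (QSet.ofSet.{u} A).At} : (∃ f ∈ ofElemConj α u d, f ≠ 0) ↔ α = d.down := by
  constructor
  · rintro ⟨f, hf, h0⟩
    by_contra hα
    refine h0 ((Submodule.mem_bot ℂ).1 (Submodule.span_le.2 ?_ hf))
    rintro f ⟨v, s, hs, t, -, rfl⟩
    obtain ⟨r, hr, h⟩ := mem_conj.1 hs
    have hr0 : r = 0 := by
      have : r ∈ (⨆ _ : α = d.down, ⊤ : Submodule ℂ (ℂ →L[ℂ] ℂ)) := hr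
      simpa [hα] using this
    have : s = 0 := ContinuousLinearMap.ext fun ξ => by
      obtain ⟨x, rfl⟩ := DualSpace.exists_bra (H := ℂ) ξ
      rw [h, hr0]
      exact DualSpace.bra_zero
    rw [this]
    exact Submodule.zero_mem _
  · intro hα
    let b : DualSpace ℂ := DualSpace.bra (1 : ℂ)
    have hb : b ≠ 0 := fun h => by
      have h1 : DualSpace.pairing b 1 = 1 := by simp [b, DualSpace.pairing_bra]
      rw [h] at h1
      exact zero_ne_one h1
    refine ⟨(ContinuousLinearMap.id ℂ (DualSpace ℂ)) ∘L ContinuousLinearMap.toSpanSingleton ℂ b,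
      Submodule.subset_span ⟨PUnit.unit, ContinuousLinearMap.id ℂ (DualSpace ℂ),
        mem_conj.2 ⟨ContinuousLinearMap.id ℂ ℂ, ?_, fun _ => rfl⟩, _, Submodule.mem_top, rfl⟩,
        fun h => ?_⟩
    · change _ ∈ (⨆ _ : α = d.down, ⊤ : Submodule ℂ (ℂ →L[ℂ] ℂ))
      rw [iSup_pos hα]; exact Submodule.mem_top
    · have h1 := DFunLike.congr_fun h (1 : ℂ)
      exact hb ((one_smul ℂ b).symm.trans h1)

theorem conj₂_ofOp_ne_bot {A : Type} (op : A → A → A) {a b c : (QSet.ofSet.{u} A).At} :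
    (∃ f ∈ (ofOp op).conj₂ (a, b) c, f ≠ 0) ↔ op a.down b.down = c.down := by
  constructor
  · rintro ⟨f, hf, h0⟩
    by_contra hα
    obtain ⟨r, hr, h⟩ := mem_conj₂.1 hf
    have hr0 : r = 0 := by
      have : r ∈ (⨆ _ : op a.down b.down = c.down, ⊤ : Submodule ℂ (ℂ ⊗[ℂ] ℂ →L[ℂ] ℂ)) := hr
      simpa [hα] using this
    refine h0 (StrongDual.tensor_ext fun ξ η => ?_)
    obtain ⟨x, rfl⟩ := DualSpace.exists_bra (H := ℂ) ξ
    obtain ⟨y, rfl⟩ := DualSpace.exists_bra (H := ℂ) η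
    rw [h, hr0]
    exact DualSpace.bra_zero
  · intro hα
    -- The coordinate on ℂ* reads ⟨x| as the conjugate of x. The witness is the multiplication of
    -- these coordinates, which is the conjugate of the multiplication of numbers.
    let e : StrongDual ℂ (DualSpace ℂ) :=
      LinearMap.toContinuousLinearMap (DualSpace.pairingBilin ℂ 1)
    have he : ∀ x : ℂ, e (DualSpace.bra x) = star x := fun x => by
      simp [e, DualSpace.pairing_bra]
    let β : DualSpace ℂ := DualSpace.bra (1 : ℂ)
    have hb : ∀ x : ℂ, star x • β = DualSpace.bra x := fun x => by
      refine Eq.trans ?_ (congrArg DualSpace.bra (mul_one x))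
      exact (DualSpace.bra_smul x 1).symm
    refine ⟨(ContinuousLinearMap.toSpanSingleton ℂ β) ∘L StrongDual.tmul e e,
      mem_conj₂.2 ⟨StrongDual.tmul (ContinuousLinearMap.id ℂ ℂ) (ContinuousLinearMap.id ℂ ℂ), ?_,
        fun x y => ?_⟩, fun h => ?_⟩
    · change _ ∈ (⨆ _ : op a.down b.down = c.down, ⊤ : Submodule ℂ (ℂ ⊗[ℂ] ℂ →L[ℂ] ℂ))
      rw [iSup_pos hα]; exact Submodule.mem_top
    · rw [StrongDual.tmul_apply]
      change (StrongDual.tmul e e (DualSpace.bra x ⊗ₜ[ℂ] DualSpace.bra y)) • β = _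
      rw [StrongDual.tmul_apply, he, he, ← star_mul', hb]; rfl
    · have h1 := DFunLike.congr_fun h (β ⊗ₜ[ℂ] β)
      have h2 : (StrongDual.tmul e e (β ⊗ₜ[ℂ] β)) • β = 0 := h1
      have h3 : DualSpace.pairing ((StrongDual.tmul e e (β ⊗ₜ[ℂ] β)) • β) 1 = 0 := by rw [h2]; rfl
      rw [StrongDual.tmul_apply, he, star_one, mul_one, one_smul, DualSpace.pairing_bra] at h3
      simp at h3

end BRel

namespace QRel

variable {X Y Z : QSet.{u}}

theorem of₂_ne_bot {P : BRel (X.prod Y) QSet.one} {a : X.At} {b : Y.At}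
    {u : (QSet.prodList []).At} :
    (∃ f ∈ of₂ P (a, (b, u)), f ≠ 0) ↔ ∃ g ∈ P (a, b) PUnit.unit, g ≠ 0 := by
  constructor
  · rintro ⟨f, hf, h0⟩
    obtain ⟨g, hg, h⟩ := mem_of₂.1 hf
    refine ⟨g, hg, ?_⟩
    rintro rfl
    exact h0 (Vecs.functional_ext (Γ := [X, Y]) fun z => h z.1 z.2.1)
  · rintro ⟨g, hg, h0⟩
    obtain ⟨f, hf⟩ := exists_of₂ g
    refine ⟨f, mem_of₂.2 ⟨g, hg, hf⟩, ?_⟩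
    rintro rfl
    exact h0 (StrongDual.tensor_ext fun x y => (hf x y).symm)

theorem of₃_ne_bot {P : BRel ((X.prod Y).prod Z) QSet.one} {a : X.At} {b : Y.At} {c : Z.At}
    {u : (QSet.prodList []).At} :
    (∃ f ∈ of₃ P (a, (b, (c, u))), f ≠ 0) ↔ ∃ g ∈ P ((a, b), c) PUnit.unit, g ≠ 0 := by
  constructor
  · rintro ⟨f, hf, h0⟩
    obtain ⟨g, hg, h⟩ := mem_of₃.1 hf
    refine ⟨g, hg, ?_⟩
    rintro rfl
    exact h0 (Vecs.functional_ext (Γ := [X, Y, Z]) fun z => h z.1 z.2.1 z.2.2.1)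
  · rintro ⟨g, hg, h0⟩
    obtain ⟨f, hf⟩ := exists_of₃ g
    refine ⟨f, mem_of₃.2 ⟨g, hg, hf⟩, ?_⟩
    rintro rfl
    exact h0 (StrongDual.tensor_ext₃' fun x y z => (hf x y z).symm)

theorem finrank_dual_prodList {Δ : List QSet.{u}} (h : ∀ Y ∈ Δ, Y.IsClassical)
    (a : (QSet.prodList Δ).At) :
    Module.finrank ℂ (StrongDual ℂ ((QSet.prodList Δ).H a)) = 1 :=
  finrank_strongDual.trans (QSet.isClassical_prodList Δ h a)

theorem equality_classical (hY : Y.IsClassical) (a b : Y.At) (u : (QSet.prodList []).At) :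
    equality Y (a, (b, u)) = ⨆ _ : a = b, ⊤ := by
  refine Submodule.eq_iSup_prop (finrank_dual_prodList (Δ := [Y, Y.dual])
    (by simp [hY, hY.dual]) _) (of₂_ne_bot.trans ?_)
  constructor
  · rintro ⟨g, hg, h0⟩
    by_contra hab
    rw [BRel.eval_of_ne hab] at hg
    exact h0 hg
  · rintro rfl
    refine ⟨BRel.bendMap _ _ (ContinuousLinearMap.id ℂ (Y.H a)), BRel.mem_eval_self.2
      ⟨1, fun x ξ => ?_⟩, fun h => ?_⟩
    · rw [one_mul]; exact BRel.bendMap_apply _ _ _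
    · have h1 := BRel.bendMap_injective _ _ (h.trans (map_zero _).symm)
      obtain ⟨x, hx⟩ := exists_ne (0 : Y.H a)
      exact hx (DFunLike.congr_fun h1 x)

theorem of₂_bend_classical {R : BRel X Y} (hX : X.IsClassical) (hY : Y.IsClassical)
    {a : X.At} {b : Y.At} (u : (QSet.prodList []).At) {p : Prop}
    (h : (∃ r ∈ R a b, r ≠ 0) ↔ p) : of₂ R.bend (a, (b, u)) = ⨆ _ : p, ⊤ :=
  Submodule.eq_iSup_prop (finrank_dual_prodList (Δ := [X, Y.dual])
    (by simp [hX, hY.dual]) _) (of₂_ne_bot.trans (BRel.bend_ne_bot.trans h))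

theorem graph₀_ofElemConj {A : Type} (α : A) (d : (QSet.ofSet.{u} A).At)
    (u : (QSet.prodList []).At) : (BRel.ofElemConj α).graph₀ (d, u) = ⨆ _ : α = d.down, ⊤ := by
  refine Submodule.eq_iSup_prop (finrank_dual_prodList (Δ := [(QSet.ofSet A).dual.dual])
    (by simp [(QSet.isClassical_ofSet A).dual.dual]) _) ?_
  refine Iff.trans ?_ ((BRel.bend_ne_bot (a := PUnit.unit) (u := PUnit.unit)).trans
    (BRel.ofElemConj_ne_bot α))
  have hmem : ∀ f : StrongDual ℂ (DualSpace (DualSpace ℂ) ⊗[ℂ] ℂ),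
      f ∈ (BRel.ofElemConj α).graph₀ (d, u) ↔ ∃ g ∈ (BRel.ofElemConj α).bend (PUnit.unit, d)
        PUnit.unit, ∀ ζ : DualSpace (DualSpace ℂ), f (ζ ⊗ₜ[ℂ] (1 : ℂ)) = g ((1 : ℂ) ⊗ₜ[ℂ] ζ) := by
    intro f
    refine Submodule.mem_span_of_rel (fun _ => rfl) ?_ ?_
    · intro g g' f f' h h' x
      rw [add_apply, add_apply, h, h']
    · intro c g f h
      exact ⟨c, fun x => by rw [smul_apply, smul_apply, h]⟩
  constructor
  · rintro ⟨f, hf, h0⟩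
    obtain ⟨g, hg, h⟩ := (hmem f).1 hf
    refine ⟨g, hg, ?_⟩
    rintro rfl
    refine h0 (Vecs.functional_ext (Γ := [(QSet.ofSet A).dual.dual]) fun z => h z.1)
  · rintro ⟨g, hg, h0⟩
    let f : StrongDual ℂ (DualSpace (DualSpace ℂ) ⊗[ℂ] ℂ) := LinearMap.toContinuousLinearMap
      ((g : ℂ ⊗[ℂ] DualSpace (DualSpace ℂ) →ₗ[ℂ] ℂ) ∘ₗ (TensorProduct.comm ℂ _ _).toLinearMap)
    have hf : ∀ (x : ℂ) (ζ : DualSpace (DualSpace ℂ)), f (ζ ⊗ₜ[ℂ] x) = g (x ⊗ₜ[ℂ] ζ) :=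
      fun x ζ => rfl
    refine ⟨f, (hmem f).2 ⟨g, hg, hf 1⟩, fun h => ?_⟩
    refine h0 (StrongDual.tensor_ext fun x ζ => ?_)
    rw [← hf, h]; rfl

theorem graph₁_conjugation (A : Type) (a b : (QSet.ofSet.{u} A).At) (u : (QSet.prodList []).At) :
    (BRel.conjugation A).graph₁ (a, (b, u)) = ⨆ _ : a = b, ⊤ :=
  of₂_bend_classical (QSet.isClassical_ofSet A) (QSet.isClassical_ofSet A).dual u
    BRel.iSup_prop_top_ne_bot

theorem graph₂_conj₂_ofOp {A : Type} (op : A → A → A) (a b c : (QSet.ofSet.{u} A).At)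
    (u : (QSet.prodList []).At) :
    (BRel.ofOp op).conj₂.graph₂ (a, (b, (c, u))) = ⨆ _ : op a.down b.down = c.down, ⊤ :=
  Submodule.eq_iSup_prop (finrank_dual_prodList
    (Δ := [(QSet.ofSet A).dual, (QSet.ofSet A).dual, (QSet.ofSet A).dual.dual])
    (by simp [(QSet.isClassical_ofSet A).dual, (QSet.isClassical_ofSet A).dual.dual]) _)
    (of₃_ne_bot.trans (BRel.bend_ne_bot.trans (BRel.conj₂_ofOp_ne_bot op)))

theorem of₂_bend_ofRel {A B : Type} (r : A → B → Prop) (a : (QSet.ofSet.{u} A).At)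
    (b : (QSet.ofSet.{u} B).At) (u : (QSet.prodList []).At) :
    of₂ (BRel.ofRel r).bend (a, (b, u)) = ⨆ _ : r a.down b.down, ⊤ :=
  of₂_bend_classical (QSet.isClassical_ofSet A) (QSet.isClassical_ofSet B) u
    BRel.iSup_prop_top_ne_bot

end QRel

-- Elimination of variables of classical sorts

namespace QRel

variable {Γ Δ Θ : List QSet.{u}} {X Y Z : QSet.{u}}

/-- The predicates `f` with `E_X ⊗ f ∈ φ`, where `E_X` is evaluated at the atom `a`. -/
noncomputable def diagAt (Y : QSet.{u}) (a : Y.At) (φ : QRel (Y :: Y.dual :: Γ)) : QRel Γ := fun c =>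
  (φ (a, (a, c))).comap (evalTensor (Y.H a))

theorem exDiag_eq_iSup (hY : Y.IsClassical) (φ : QRel (Y :: Y.dual :: Γ)) :
    exDiag Y φ = ⨆ a, diagAt Y a φ := by
  funext c
  rw [iSup_apply]
  exact exDiag_classical hY φ c

/-- This is special to classical sorts: `evalTensor` is then bijective, and a preimage under a
bijective linear map commutes with suprema. -/
theorem diagAt_iSup (hY : Y.IsClassical) (a : Y.At) {ι : Sort*}
    (φ : ι → QRel (Y :: Y.dual :: Γ)) : diagAt Y a (⨆ i, φ i) = ⨆ i, diagAt Y a (φ i) := by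
  funext c
  rw [iSup_apply, diagAt]
  refine Eq.trans ?_ (comap_evalTensor_iSup (hY a) _)
  rw [iSup_apply]

/-- The relation that is `⊤` at the atoms that satisfy `p`, and `⊥` at the others. -/
noncomputable def test (p : (QSet.prodList Γ).At → Prop) : QRel Γ := fun c => ⨆ _ : p c, ⊤

theorem diagAt_test (hY : Y.IsClassical) (a : Y.At)
    (p : (QSet.prodList (Y :: Y.dual :: Γ)).At → Prop) :
    diagAt Y a (test p) = test fun c => p (a, (a, c)) := by
  funext c
  exact comap_evalTensor_iSup_prop hY _

theorem test_const_inf (p : Prop) (φ : QRel Γ) : test (fun _ => p) ⊓ φ = ⨆ _ : p, φ := by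
  funext c
  rw [iSup_apply]
  exact Submodule.iSup_prop_top_inf p (φ c)

/-- The relation whose slices in the two given variables belong to `W`. -/
noncomputable def locRel (vx : Var Γ X) (vy : Var Γ Y) (W : ∀ c : (QSet.prodList Γ).At,
    Submodule ℂ (StrongDual ℂ (X.H (vx.atom c) ⊗[ℂ] Y.H (vy.atom c)))) : QRel Γ :=
  fun c => loc vx vy c (W c)

theorem diagAt_locRel (a : Z.At) (vx : Var Γ X) (vy : Var Γ Y)
    (W : ∀ c : (QSet.prodList (Z :: Z.dual :: Γ)).At,
      Submodule ℂ (StrongDual ℂ (X.H (vx.tail.tail.atom c) ⊗[ℂ] Y.H (vy.tail.tail.atom c)))) :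
    diagAt Z a (locRel vx.tail.tail vy.tail.tail W) = locRel vx vy fun c => W (a, (a, c)) := by
  funext c
  exact comap_evalTensor_loc vx vy _

theorem atomic_eq_test {R : QRel Δ} {ρ : Ren Δ Γ} {p : (QSet.prodList Γ).At → Prop}
    (hρ : (ρ.indices Δ).Nodup) (h : ∀ c, R (ρ.atoms Δ c) = ⨆ _ : p c, ⊤) :
    atomic R ρ = test p :=
  funext fun c => atomic_of_prop hρ (h c)

theorem eqAtom_eq_test (hY : Y.IsClassical) (v : Var Γ Y) (w : Var Γ Y.dual)
    (h : v.index ≠ w.index) :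
    eqAtom v w = test fun c => v.atom c = w.atom c :=
  atomic_eq_test (by simpa [Ren.indices, Ren.cons, Ren.tail] using h)
    fun _ => equality_classical hY _ _ _

/-- The iteration of `diagAt` for two sorts. -/
noncomputable def diagAt₂ (a : X.At) (b : Y.At) (φ : QRel (diagCtx [X, Y] Γ)) : QRel Γ :=
  diagAt Y b (diagAt X a (Γ := diagCtx [Y] Γ) φ)

theorem exDiags_two (h1 : X.IsClassical) (h2 : Y.IsClassical) (φ : QRel (diagCtx [X, Y] Γ)) :
    exDiags [X, Y] φ = ⨆ (b : Y.At) (a : X.At), diagAt₂ a b φ := by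
  refine (exDiag_eq_iSup h2 _).trans (iSup_congr fun b => ?_)
  exact (congrArg (diagAt Y b) (exDiag_eq_iSup (Γ := diagCtx [Y] Γ) h1 φ)).trans
    (diagAt_iSup h2 b _)

theorem diagAt₂_inf {a : X.At} {b : Y.At} {φ ψ : QRel (diagCtx [X, Y] Γ)} {φ' ψ' : QRel Γ}
    (hφ : diagAt₂ a b φ = φ') (hψ : diagAt₂ a b ψ = ψ') :
    diagAt₂ a b (φ ⊓ ψ) = φ' ⊓ ψ' := by
  rw [← hφ, ← hψ]; rfl

theorem diagAt₂_iSup (h1 : X.IsClassical) (h2 : Y.IsClassical) (a : X.At) (b : Y.At) {ι : Sort*}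
    (φ : ι → QRel (diagCtx [X, Y] Γ)) :
    diagAt₂ a b (⨆ i, φ i) = ⨆ i, diagAt₂ a b (φ i) :=
  (congrArg (diagAt Y b) (diagAt_iSup (Γ := diagCtx [Y] Γ) h1 a φ)).trans (diagAt_iSup h2 b _)

theorem diagAt₂_test (h1 : X.IsClassical) (h2 : Y.IsClassical) (a : X.At) (b : Y.At)
    (p : (QSet.prodList (X :: X.dual :: Y :: Y.dual :: Γ)).At → Prop) :
    diagAt₂ a b (test p) = test fun c => p (a, (a, (b, (b, c)))) :=
  (congrArg (diagAt Y b) (diagAt_test h1 a p)).trans (diagAt_test h2 b _)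

theorem diagAt₂_locRel (a : X.At) (b : Y.At) {Z W : QSet.{u}} (vx : Var Γ Z) (vy : Var Γ W)
    (S : ∀ c : (QSet.prodList (X :: X.dual :: Y :: Y.dual :: Γ)).At, Submodule ℂ
      (StrongDual ℂ (Z.H (vx.atom c.2.2.2.2) ⊗[ℂ] W.H (vy.atom c.2.2.2.2)))) :
    diagAt₂ a b (locRel (Γ := X :: X.dual :: Y :: Y.dual :: Γ) vx.tail.tail.tail.tail
      vy.tail.tail.tail.tail S) = locRel vx vy fun c => S (a, (a, (b, (b, c)))) :=
  (congrArg (diagAt Y b) (diagAt_locRel a vx.tail.tail vy.tail.tail S)).trans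
    (diagAt_locRel b vx vy _)

theorem graphs_one (t : Term Γ X) (ρ : Ren Γ Θ) (ys : ∀ Z, Var [X] Z → Var Θ Z.dual) :
    (Terms.cons t .nil).graphs Θ ρ ys = t.graph Θ ρ (ys _ .head) := by
  rw [Terms.graphs, Terms.graphs, inf_top_eq]

theorem graphs_two (t : Term Γ X) (s : Term Γ Y) (ρ : Ren Γ Θ)
    (ys : ∀ Z, Var [X, Y] Z → Var Θ Z.dual) :
    (Terms.cons t (.cons s .nil)).graphs Θ ρ ys =
      t.graph Θ ρ (ys _ .head) ⊓ s.graph Θ ρ (ys _ (.tail .head)) := by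
  rw [Terms.graphs, graphs_one]

/-- The interpretation of `y ↦ G(s)` for a function `G` between classical sorts. -/
theorem graph_app_one (hX : X.IsClassical) (hY : Y.IsClassical) {G : QRel ([X] ++ [Y.dual])}
    {p : X.At → Y.At → Prop} (hG : ∀ a b u, G (a, (b, u)) = ⨆ _ : p a b, ⊤) (s : Term Γ X)
    (hs : (Terms.cons s .nil).vars? = none) (ρ : Ren Γ Θ) (y : Var Θ Y.dual) :
    (Term.app [X] Y G (.cons s .nil)).graph Θ ρ y = ⨆ (b : Y.At) (a : X.At),
      test (fun _ => p a b) ⊓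
        diagAt₂ (Y := Y.dual) (Γ := Θ) a b (s.graph (diagCtx [X] (Y.dual :: Y.dual.dual :: Θ))
          (fun Z v => diagOld [X] Z (.tail (.tail (ρ Z v)))) (.tail .head)) ⊓
        test (fun c => y.atom c = b) := by
  rw [Term.graph, hs]
  simp only
  refine (exDiags_two (X := X) (Y := Y.dual) hX hY.dual _).trans
    (iSup_congr fun b => iSup_congr fun a => ?_)
  -- The extended context is z, z_*, w, w_*, followed by Θ. The graph G reads positions 0 and 2,
  -- while the link to y is made at position 3.
  have h1 : atomic G (Ren.snoc [X] (diagNew [X])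
      (diagOld (Γ := Y.dual :: Y.dual.dual :: Θ) [X] _ .head)) =
      test (Γ := X :: X.dual :: Y.dual :: Y.dual.dual :: Θ) fun c => p c.1 c.2.2.1 :=
    atomic_eq_test (show [0, 2].Nodup by decide) fun c => hG _ _ _
  have h3 : eqAtom (diagOld (Γ := Y.dual :: Y.dual.dual :: Θ) [X] _ (.tail (.tail y)))
      (diagOld [X] _ (.tail .head)) =
      test (Γ := X :: X.dual :: Y.dual :: Y.dual.dual :: Θ) fun c =>
        y.atom c.2.2.2.2 = c.2.2.2.1 :=
    eqAtom_eq_test hY.dual _ _ fun h => by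
      change y.index + 1 + 1 + 1 + 1 = 0 + 1 + 1 + 1 at h; omega
  exact diagAt₂_inf (diagAt₂_inf
      ((congrArg (diagAt₂ a b) h1).trans (diagAt₂_test hX hY.dual a b _))
      (congrArg (diagAt₂ a b) (graphs_one s _ _)))
    ((congrArg (diagAt₂ a b) h3).trans (diagAt₂_test hX hY.dual a b _))

end QRel

-- Interpretation of the terms and atomic formulas of the four sentences

section
open QRel

namespace DistanceFunction

variable {X : QSet.{u}} {Γ Θ : List QSet.{u}}

theorem isClassical_dist : (QSet.dist.{u}).IsClassical := QSet.isClassical_ofSet _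

theorem graph_term (F : BRel (X.prod X.dual) QSet.dist) (x : Var Γ X) (y : Var Γ X.dual)
    (ρ : Ren Γ Θ) (w : Var Θ QSet.dist.dual) (hx : (ρ _ x).index ≠ w.index)
    (hy : (ρ _ y).index ≠ w.index) :
    (term F x y).graph Θ ρ w = locRel (ρ _ x) (ρ _ y) fun c =>
      F ((ρ _ x).atom c, (ρ _ y).atom c) (w.atom c) := by
  rw [term, Term.graph]
  simp only [Terms.vars?, Option.map_some]
  funext c
  refine atomic_graph₂ (F := F) _ w (Module.finrank_self ℂ) (ζ := ContinuousLinearMap.id ℂ ℂ)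
    ?_ hx hy ?_
  · intro h
    exact one_ne_zero (DFunLike.congr_fun h (1 : ℂ))
  · intro r
    exact ⟨fun hr => ⟨r, hr, fun _ => rfl⟩, fun ⟨f, hf, h⟩ =>
      (ContinuousLinearMap.ext h : r = f) ▸ hf⟩

theorem graph_termZeroConj (ρ : Ren Γ Θ) (w : Var Θ QSet.dist.dual.dual) :
    (termZeroConj (Γ := Γ)).graph Θ ρ w = test fun c => 0 = (w.atom c).down := by
  rw [termZeroConj, Term.graph]
  simp only [Terms.vars?]
  exact atomic_eq_test (by simp [Ren.snoc, Ren.indices]) fun c => graph₀_ofElemConj _ _ _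

/-- The slices of `F_*`. -/
def conjSlice (F : BRel (X.prod X.dual) QSet.dist) (a b : X.At) (α : (QSet.dist.{u}).At) :
    Submodule ℂ (StrongDual ℂ (X.dual.H a ⊗[ℂ] X.H b)) where
  carrier := {r | ∃ f ∈ F (a, b) α, ∀ (x : X.H a) (y : X.H b),
    r (DualSpace.bra x ⊗ₜ[ℂ] y) = star (f (x ⊗ₜ[ℂ] DualSpace.bra y) : ℂ)}
  add_mem' := by
    rintro r s ⟨f, hf, h⟩ ⟨g, hg, k⟩
    exact ⟨f + g, Submodule.add_mem _ hf hg, fun x y => by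
      rw [add_apply, add_apply, h, k]; exact (star_add _ _).symm⟩
  zero_mem' := ⟨0, Submodule.zero_mem _, fun x y => (star_zero _).symm⟩
  smul_mem' := by
    rintro t r ⟨f, hf, h⟩
    refine ⟨star t • f, Submodule.smul_mem _ _ hf, fun x y => ?_⟩
    rw [smul_apply, smul_apply, h]
    simp

/-- The evaluation of functionals on `ℂ` at `1`. -/
noncomputable def evalOne : StrongDual ℂ (DualSpace ℂ) :=
  LinearMap.toContinuousLinearMap (DualSpace.pairingBilin ℂ 1)

theorem evalOne_bra (t : ℂ) : evalOne (DualSpace.bra t) = star t := by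
  simp [evalOne, DualSpace.pairing_bra]

theorem evalOne_ne_zero : evalOne ≠ 0 := fun h => by
  have := evalOne_bra 1
  rw [h, star_one] at this
  exact zero_ne_one this

/-- Evaluation at 1 identifies the dual atom ℂ* with ℂ, so operators into ℂ* become functionals. The
Riesz map is antilinear, whence the complex conjugate in `conjSlice`. -/
theorem mem_conjSlice_iff {F : BRel (X.prod X.dual) QSet.dist} {a b : X.At}
    {α : (QSet.dist.{u}).At} {r : StrongDual ℂ (X.dual.H a ⊗[ℂ] X.H b)} :
    r ∈ conjSlice F a b α ↔ ∃ g ∈ F.conjDual (a, b) α, ∀ t, r t = evalOne (g t) := by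
  constructor
  · rintro ⟨f, hf, h⟩
    have hb : ∀ x : ℂ, star x • DualSpace.bra (1 : ℂ) = DualSpace.bra x := fun x =>
      (DualSpace.bra_smul x 1).symm.trans (congrArg DualSpace.bra (mul_one x))
    refine ⟨(ContinuousLinearMap.toSpanSingleton ℂ (DualSpace.bra (1 : ℂ))) ∘L r,
      BRel.mem_conjDual.2 ⟨f, hf, fun x y => ?_⟩, fun t => ?_⟩
    · change r (DualSpace.bra x ⊗ₜ[ℂ] y) • DualSpace.bra (1 : ℂ) = _
      rw [h, hb]
    · change _ = evalOne (r t • DualSpace.bra (1 : ℂ))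
      rw [map_smul, evalOne_bra]; simp
  · rintro ⟨g, hg, h⟩
    obtain ⟨f, hf, k⟩ := BRel.mem_conjDual.1 hg
    refine ⟨f, hf, fun x y => ?_⟩
    rw [h, k]
    exact evalOne_bra _

theorem graph_termConj (F : BRel (X.prod X.dual) QSet.dist) (x : Var Γ X.dual) (y : Var Γ X)
    (ρ : Ren Γ Θ) (w : Var Θ QSet.dist.dual.dual) (hx : (ρ _ x).index ≠ w.index)
    (hy : (ρ _ y).index ≠ w.index) :
    (termConj F x y).graph Θ ρ w = locRel (ρ _ x) (ρ _ y) fun c =>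
      conjSlice F ((ρ _ x).atom c) ((ρ _ y).atom c) (w.atom c) := by
  rw [termConj, Term.graph]
  simp only [Terms.vars?, Option.map_some]
  funext c
  exact atomic_graph₂ (F := F.conjDual) _ w
    (finrank_strongDual.trans (Module.finrank_self ℂ)) evalOne_ne_zero hx hy
    fun r => mem_conjSlice_iff

theorem diagAt₂_graph_term_left (F : BRel (X.prod X.dual) QSet.dist) (x : Var Γ X)
    (y : Var Γ X.dual) {Y : QSet.{u}} (ρ : Ren Γ Θ) (a : (QSet.dist.{u}).At) (b : Y.At)
    (ρ' : Ren Γ (diagCtx [QSet.dist, Y] Θ)) (hρ : ∀ Z v, ρ' Z v = (ρ Z v).tail.tail.tail.tail) :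
    diagAt₂ a b ((term F x y).graph (diagCtx [QSet.dist, Y] Θ) ρ' (.tail .head)) =
      locRel (ρ _ x) (ρ _ y) fun c => F ((ρ _ x).atom c, (ρ _ y).atom c) a := by
  obtain rfl : ρ' = fun Z v => (ρ Z v).tail.tail.tail.tail := by funext Z v; exact hρ Z v
  refine (congrArg (diagAt₂ a b) (graph_term F x y _ _ ?_ ?_)).trans
    (diagAt₂_locRel a b (ρ _ x) (ρ _ y) _)
  · simp [Var.index]
  · simp [Var.index]

/-- The last test forces the value b of the auxiliary variable to be g c, so the supremum over b is
a substitution. -/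
theorem iSup_test_inf {A B : Type*} (p : A → B → Prop) (g : (QSet.prodList Θ).At → B)
    (L : A → QRel Θ) :
    ⨆ (b : B) (a : A), test (fun _ => p a b) ⊓ L a ⊓ test (fun c => g c = b) =
      ⨆ a, test (fun c => p a (g c)) ⊓ L a := by
  funext c
  simp only [iSup_apply]
  refine le_antisymm (iSup_le fun b => iSup_le fun a => ?_) (iSup_le fun a => ?_)
  · refine le_iSup_of_le a ?_
    change (⨆ _ : p a b, ⊤) ⊓ L a c ⊓ (⨆ _ : g c = b, ⊤) ≤ (⨆ _ : p a (g c), ⊤) ⊓ L a c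
    rw [Submodule.inf_iSup_prop_top, Submodule.iSup_prop_top_inf, Submodule.iSup_prop_top_inf]
    exact iSup_le fun h => h ▸ le_rfl
  · refine le_iSup_of_le (g c) (le_iSup_of_le a ?_)
    change (⨆ _ : p a (g c), ⊤) ⊓ L a c ≤ (⨆ _ : p a (g c), ⊤) ⊓ L a c ⊓ (⨆ _ : g c = g c, ⊤)
    rw [iSup_pos rfl, inf_top_eq]

theorem iSup_test_eq_inf {A : Type*} (g : (QSet.prodList Θ).At → A) (L : A → QRel Θ)
    (c : (QSet.prodList Θ).At) : (⨆ a, test (fun c => a = g c) ⊓ L a) c = L (g c) c := by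
  simp only [iSup_apply]
  refine le_antisymm (iSup_le fun a => ?_) ?_
  · change (⨆ _ : a = g c, ⊤) ⊓ L a c ≤ _
    rw [Submodule.iSup_prop_top_inf]
    exact iSup_le fun h => h ▸ le_rfl
  · refine le_iSup_of_le (g c) ?_
    change _ ≤ (⨆ _ : g c = g c, ⊤) ⊓ L (g c) c
    rw [iSup_pos rfl, top_inf_eq]

/-- The conjugation function matches each distance with its own dual atom. Its intermediate argument
is therefore forced to equal the value of w, and the graph is the same as that of F itself. -/
theorem graph_termConjugation (F : BRel (X.prod X.dual) QSet.dist) (x : Var Γ X) (y : Var Γ X.dual)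
    (ρ : Ren Γ Θ) (w : Var Θ QSet.dist.dual.dual) :
    (termConjugation (term F x y)).graph Θ ρ w = locRel (ρ _ x) (ρ _ y) fun c =>
      F ((ρ _ x).atom c, (ρ _ y).atom c) (w.atom c) := by
  have hG : ∀ (a : (QSet.dist.{u}).At) (b : (QSet.dist.{u}).At) (u : (QSet.prodList []).At),
    (BRel.conjugation ℝ≥0∞).graph₁ (a, (b, u)) = ⨆ _ : a = b, ⊤ := graph₁_conjugation ℝ≥0∞
  refine (graph_app_one (X := QSet.dist) (Y := QSet.dist.dual) isClassical_dist
    isClassical_dist.dual (p := fun a b => a = b) hG (term F x y) rfl ρ w).trans ?_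
  have h : ∀ (b a : (QSet.dist.{u}).At), diagAt₂ (Y := QSet.dist.dual.dual) (Γ := Θ) a b
      ((term F x y).graph (diagCtx [QSet.dist] (QSet.dist.dual.dual :: QSet.dist.dual.dual.dual :: Θ))
          (fun Z v => diagOld [QSet.dist] Z (.tail (.tail (ρ Z v)))) (.tail .head)) =
      locRel (ρ _ x) (ρ _ y) fun c => F ((ρ _ x).atom c, (ρ _ y).atom c) a := fun b a =>
    diagAt₂_graph_term_left F x y (Y := QSet.dist.dual.dual) ρ a b
      (fun Z v => diagOld [QSet.dist] Z (.tail (.tail (ρ Z v)))) fun Z v => rfl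
  refine (iSup_congr fun b => iSup_congr fun a => congrArg (fun L => test (fun _ => a = b) ⊓ L ⊓
    test (fun c => w.atom c = b)) (h b a)).trans ?_
  refine (iSup_test_inf (fun a b : (QSet.dist.{u}).At => a = b) (fun c => w.atom c) fun a =>
    locRel (ρ _ x) (ρ _ y) fun c => F ((ρ _ x).atom c, (ρ _ y).atom c) a).trans ?_
  funext c
  exact iSup_test_eq_inf (fun c => w.atom c) (fun a =>
    locRel (ρ _ x) (ρ _ y) fun c => F ((ρ _ x).atom c, (ρ _ y).atom c) a) c

end DistanceFunction
end

namespace QRel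

variable {Γ Δ Θ : List QSet.{u}} {X Y Z : QSet.{u}}

/-- The iteration of `diagAt` for three sorts. -/
noncomputable def diagAt₃ (a : X.At) (b : Y.At) (d : Z.At) (φ : QRel (diagCtx [X, Y, Z] Γ)) :
    QRel Γ :=
  diagAt Z d (diagAt₂ a b (Γ := diagCtx [Z] Γ) φ)

theorem exDiags_three (h1 : X.IsClassical) (h2 : Y.IsClassical) (h3 : Z.IsClassical)
    (φ : QRel (diagCtx [X, Y, Z] Γ)) :
    exDiags [X, Y, Z] φ = ⨆ (d : Z.At) (b : Y.At) (a : X.At), diagAt₃ a b d φ := by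
  refine (exDiag_eq_iSup h3 (exDiags (Γ := diagCtx [Z] Γ) [X, Y] φ)).trans
    (iSup_congr fun d => ?_)
  refine (congrArg (diagAt Z d) (exDiags_two (Γ := diagCtx [Z] Γ) h1 h2 φ)).trans ?_
  exact (diagAt_iSup h3 d _).trans (iSup_congr fun b => diagAt_iSup h3 d _)

theorem diagAt₃_inf {a : X.At} {b : Y.At} {d : Z.At} {φ ψ : QRel (diagCtx [X, Y, Z] Γ)}
    {φ' ψ' : QRel Γ} (hφ : diagAt₃ a b d φ = φ') (hψ : diagAt₃ a b d ψ = ψ') :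
    diagAt₃ a b d (φ ⊓ ψ) = φ' ⊓ ψ' := by
  rw [← hφ, ← hψ]; rfl

theorem diagAt₃_test (h1 : X.IsClassical) (h2 : Y.IsClassical) (h3 : Z.IsClassical) (a : X.At)
    (b : Y.At) (d : Z.At)
    (p : (QSet.prodList (X :: X.dual :: Y :: Y.dual :: Z :: Z.dual :: Γ)).At → Prop) :
    diagAt₃ a b d (test p) = test fun c => p (a, (a, (b, (b, (d, (d, c)))))) :=
  (congrArg (diagAt Z d) (diagAt₂_test (Γ := diagCtx [Z] Γ) h1 h2 a b p)).trans
    (diagAt_test h3 d _)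

theorem diagAt₃_locRel (a : X.At) (b : Y.At) (d : Z.At) {V W : QSet.{u}} (vx : Var Γ V)
    (vy : Var Γ W)
    (S : ∀ c : (QSet.prodList (X :: X.dual :: Y :: Y.dual :: Z :: Z.dual :: Γ)).At, Submodule ℂ
      (StrongDual ℂ (V.H (vx.atom c.2.2.2.2.2.2) ⊗[ℂ] W.H (vy.atom c.2.2.2.2.2.2)))) :
    diagAt₃ a b d (locRel (Γ := X :: X.dual :: Y :: Y.dual :: Z :: Z.dual :: Γ)
      vx.tail.tail.tail.tail.tail.tail vy.tail.tail.tail.tail.tail.tail S) =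
      locRel vx vy fun c => S (a, (a, (b, (b, (d, (d, c)))))) :=
  (congrArg (diagAt Z d) (diagAt₂_locRel (Γ := diagCtx [Z] Γ) a b vx.tail.tail vy.tail.tail S)).trans
    (diagAt_locRel d vx vy _)

/-- The interpretation of `y ↦ G(s, t)` for a function `G` between classical sorts. -/
theorem graph_app_two {X₁ X₂ : QSet.{u}} (h1 : X₁.IsClassical) (h2 : X₂.IsClassical)
    (hY : Y.IsClassical) {G : QRel ([X₁, X₂] ++ [Y.dual])}
    {p : X₁.At → X₂.At → Y.At → Prop}
    (hG : ∀ a b d u, G (a, (b, (d, u))) = ⨆ _ : p a b d, ⊤) (s : Term Γ X₁) (t : Term Γ X₂)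
    (hs : (Terms.cons s (.cons t .nil)).vars? = none) (ρ : Ren Γ Θ) (y : Var Θ Y.dual) :
    (Term.app [X₁, X₂] Y G (.cons s (.cons t .nil))).graph Θ ρ y =
      ⨆ (d : Y.At) (b : X₂.At) (a : X₁.At), test (fun _ => p a b d) ⊓
        (diagAt₃ (Z := Y.dual) (Γ := Θ) a b d
            (s.graph (diagCtx [X₁, X₂] (Y.dual :: Y.dual.dual :: Θ))
              (fun Z v => diagOld [X₁, X₂] Z (.tail (.tail (ρ Z v)))) (.tail .head)) ⊓
          diagAt₃ (Z := Y.dual) (Γ := Θ) a b d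
            (t.graph (diagCtx [X₁, X₂] (Y.dual :: Y.dual.dual :: Θ))
              (fun Z v => diagOld [X₁, X₂] Z (.tail (.tail (ρ Z v))))
              (.tail (.tail (.tail .head))))) ⊓
        test (fun c => y.atom c = d) := by
  rw [Term.graph, hs]
  simp only
  refine (exDiags_three (X := X₁) (Y := X₂) (Z := Y.dual) h1 h2 hY.dual _).trans
    (iSup_congr fun d => iSup_congr fun b => iSup_congr fun a => ?_)
  have e1 : atomic G (Ren.snoc [X₁, X₂] (diagNew [X₁, X₂])
      (diagOld (Γ := Y.dual :: Y.dual.dual :: Θ) [X₁, X₂] _ .head)) =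
      test (Γ := X₁ :: X₁.dual :: X₂ :: X₂.dual :: Y.dual :: Y.dual.dual :: Θ) fun c =>
        p c.1 c.2.2.1 c.2.2.2.2.1 :=
    atomic_eq_test (show [0, 2, 4].Nodup by decide) fun c => hG _ _ _ _
  have e3 : eqAtom (diagOld (Γ := Y.dual :: Y.dual.dual :: Θ) [X₁, X₂] _ (.tail (.tail y)))
      (diagOld [X₁, X₂] _ (.tail .head)) =
      test (Γ := X₁ :: X₁.dual :: X₂ :: X₂.dual :: Y.dual :: Y.dual.dual :: Θ) fun c =>
        y.atom c.2.2.2.2.2.2 = c.2.2.2.2.2.1 :=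
    eqAtom_eq_test hY.dual _ _ fun h => by
      change y.index + 1 + 1 + 1 + 1 + 1 + 1 = 0 + 1 + 1 + 1 + 1 + 1 at h; omega
  exact diagAt₃_inf (diagAt₃_inf
      ((congrArg (diagAt₃ a b d) e1).trans (diagAt₃_test h1 h2 hY.dual a b d _))
      ((congrArg (diagAt₃ a b d) (graphs_two s t _ _)).trans (diagAt₃_inf rfl rfl)))
    ((congrArg (diagAt₃ a b d) e3).trans (diagAt₃_test h1 h2 hY.dual a b d _))

/-- The interpretation of `R(s, t)` for a classical relation `R`. -/
theorem interp_rel₂ (hX : X.IsClassical) (hY : Y.IsClassical) {R : QRel [X, Y]}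
    {p : X.At → Y.At → Prop} (hR : ∀ a b u, R (a, (b, u)) = ⨆ _ : p a b, ⊤) (s : Term Γ X)
    (t : Term Γ Y) (h : (s.indices ++ t.indices).Nodup)
    (hs : (Terms.cons s (.cons t .nil)).vars? = none) :
    (Formula.rel₂ R s t h).interp = ⨆ (b : Y.At) (a : X.At), test (fun _ => p a b) ⊓
      (diagAt₂ a b (s.graph (diagCtx [X, Y] Γ) (diagOld [X, Y]) (.tail .head)) ⊓
        diagAt₂ a b (t.graph (diagCtx [X, Y] Γ) (diagOld [X, Y]) (.tail (.tail (.tail .head))))) := by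
  rw [Formula.rel₂, Formula.interp, hs]
  simp only
  refine (exDiags_two (X := X) (Y := Y) hX hY _).trans
    (iSup_congr fun b => iSup_congr fun a => ?_)
  have e1 : atomic R (diagNew (Γ := Γ) [X, Y]) =
      test (Γ := X :: X.dual :: Y :: Y.dual :: Γ) fun c => p c.1 c.2.2.1 :=
    atomic_eq_test (show [0, 2].Nodup by decide) fun c => hR _ _ _
  exact diagAt₂_inf ((congrArg (diagAt₂ a b) e1).trans (diagAt₂_test hX hY a b _))
    ((congrArg (diagAt₂ a b) (graphs_two s t _ _)).trans (diagAt₂_inf rfl rfl))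

end QRel

namespace DistanceFunction
open QRel

variable {X : QSet.{u}} {Γ Θ : List QSet.{u}}

theorem diagAt₃_graph_termConj_left (F : BRel (X.prod X.dual) QSet.dist) (x : Var Γ X.dual)
    (y : Var Γ X) {Y Z : QSet.{u}} (ρ : Ren Γ Θ) (a : (QSet.dist.{u}).dual.At) (b : Y.At) (d : Z.At)
    (ρ' : Ren Γ (diagCtx [QSet.dist.dual, Y, Z] Θ))
    (hρ : ∀ Z v, ρ' Z v = (ρ Z v).tail.tail.tail.tail.tail.tail) :
    diagAt₃ (X := QSet.dist.dual) a b d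
      ((termConj F x y).graph (diagCtx [QSet.dist.dual, Y, Z] Θ) ρ' (.tail .head)) =
      locRel (ρ _ x) (ρ _ y) fun c => conjSlice F ((ρ _ x).atom c) ((ρ _ y).atom c) a := by
  obtain rfl : ρ' = fun Z v => (ρ Z v).tail.tail.tail.tail.tail.tail := by funext Z v; exact hρ Z v
  refine (congrArg (diagAt₃ (X := QSet.dist.dual) a b d) (graph_termConj F x y _ _ ?_ ?_)).trans
    (diagAt₃_locRel (X := QSet.dist.dual) a b d (ρ _ x) (ρ _ y) _)
  · simp [Var.index]
  · simp [Var.index]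

theorem diagAt₃_graph_termConj_right (F : BRel (X.prod X.dual) QSet.dist) (x : Var Γ X.dual)
    (y : Var Γ X) {Y Z : QSet.{u}} (ρ : Ren Γ Θ) (a : Y.At) (b : (QSet.dist.{u}).dual.At) (d : Z.At)
    (ρ' : Ren Γ (diagCtx [Y, QSet.dist.dual, Z] Θ))
    (hρ : ∀ Z v, ρ' Z v = (ρ Z v).tail.tail.tail.tail.tail.tail) :
    diagAt₃ (Y := QSet.dist.dual) a b d
      ((termConj F x y).graph (diagCtx [Y, QSet.dist.dual, Z] Θ) ρ'
        (.tail (.tail (.tail .head)))) =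
      locRel (ρ _ x) (ρ _ y) fun c => conjSlice F ((ρ _ x).atom c) ((ρ _ y).atom c) b := by
  obtain rfl : ρ' = fun Z v => (ρ Z v).tail.tail.tail.tail.tail.tail := by funext Z v; exact hρ Z v
  refine (congrArg (diagAt₃ (Y := QSet.dist.dual) a b d) (graph_termConj F x y _ _ ?_ ?_)).trans
    (diagAt₃_locRel (Y := QSet.dist.dual) a b d (ρ _ x) (ρ _ y) _)
  · simp [Var.index]
  · simp [Var.index]

theorem iSup_test_inf_inf {A B D : Type*} (p : A → B → D → Prop)
    (g : (QSet.prodList Θ).At → D) {L₁ L₂ : D → B → A → QRel Θ} {M₁ : A → QRel Θ}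
    {M₂ : B → QRel Θ} (h₁ : ∀ d b a, L₁ d b a = M₁ a) (h₂ : ∀ d b a, L₂ d b a = M₂ b) :
    ⨆ (d : D) (b : B) (a : A),
        test (fun _ => p a b d) ⊓ (L₁ d b a ⊓ L₂ d b a) ⊓ test (fun c => g c = d) =
      ⨆ (b : B) (a : A), test (fun c => p a b (g c)) ⊓ (M₁ a ⊓ M₂ b) := by
  simp only [h₁, h₂]
  rw [iSup_comm]
  exact iSup_congr fun b => iSup_test_inf (fun a d => p a b d) g fun a => M₁ a ⊓ M₂ b

theorem graph_termAddConj (F : BRel (X.prod X.dual) QSet.dist) (x₁ x₂ : Var Γ X.dual)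
    (y₁ y₂ : Var Γ X) (ρ : Ren Γ Θ) (w : Var Θ QSet.dist.dual.dual) :
    (termAddConj (termConj F x₁ y₁) (termConj F x₂ y₂)).graph Θ ρ w =
      ⨆ (β₂ : (QSet.dist.{u}).At) (β₁ : (QSet.dist.{u}).At),
        test (fun c => β₁.down + β₂.down = (w.atom c).down) ⊓
        (locRel (ρ _ x₁) (ρ _ y₁) (fun c => conjSlice F ((ρ _ x₁).atom c) ((ρ _ y₁).atom c) β₁) ⊓
         locRel (ρ _ x₂) (ρ _ y₂) fun c =>
          conjSlice F ((ρ _ x₂).atom c) ((ρ _ y₂).atom c) β₂) := by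
  have hd : (QSet.dist.{u}).dual.IsClassical := isClassical_dist.dual
  have hG : ∀ (a b d : (QSet.dist.{u}).At) (u : (QSet.prodList []).At),
    (BRel.ofOp (fun α β : ℝ≥0∞ => α + β)).conj₂.graph₂ (a, (b, (d, u))) =
      ⨆ _ : a.down + b.down = d.down, ⊤ := graph₂_conj₂_ofOp _
  have h1 := fun d b a : (QSet.dist.{u}).At => diagAt₃_graph_termConj_left F x₁ y₁
    (Y := QSet.dist.dual) (Z := QSet.dist.dual.dual) ρ a b d
      (fun Z v => diagOld [QSet.dist.dual, QSet.dist.dual] Z (.tail (.tail (ρ Z v))))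
      fun Z v => rfl
  have h2 := fun d b a : (QSet.dist.{u}).At => diagAt₃_graph_termConj_right F x₂ y₂
    (Y := QSet.dist.dual) (Z := QSet.dist.dual.dual) ρ a b d
      (fun Z v => diagOld [QSet.dist.dual, QSet.dist.dual] Z (.tail (.tail (ρ Z v))))
      fun Z v => rfl
  refine (graph_app_two (X₁ := QSet.dist.dual) (X₂ := QSet.dist.dual) (Y := QSet.dist.dual) hd hd
    hd (p := fun a b d => a.down + b.down = d.down) hG (termConj F x₁ y₁) (termConj F x₂ y₂) rfl
    ρ w).trans ?_
  exact iSup_test_inf_inf (fun a b d : (QSet.dist.{u}).At => a.down + b.down = d.down)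
      (fun c => w.atom c) h1 h2

end DistanceFunction

namespace DistanceFunction
open QRel

variable {X : QSet.{u}} {Γ Θ : List QSet.{u}}

theorem diagAt₂_graph_termZeroConj (a b : (QSet.dist.{u}).At)
    (ρ : Ren Γ (diagCtx [QSet.dist, QSet.dist.dual] Γ)) :
    diagAt₂ (X := QSet.dist) (Y := QSet.dist.dual) a b
      ((termZeroConj (Γ := Γ)).graph (diagCtx [QSet.dist, QSet.dist.dual] Γ) ρ
        (.tail (.tail (.tail .head)))) = test fun _ => 0 = b.down :=
  (congrArg (diagAt₂ (X := QSet.dist) (Y := QSet.dist.dual) a b)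
    (graph_termZeroConj _ _)).trans (diagAt₂_test isClassical_dist isClassical_dist.dual a b _)

theorem diagAt₂_graph_termConjugation (F : BRel (X.prod X.dual) QSet.dist) (x : Var Γ X)
    (y : Var Γ X.dual) (a b : (QSet.dist.{u}).At) :
    diagAt₂ (X := QSet.dist) (Y := QSet.dist.dual) a b
      ((termConjugation (term F x y)).graph (diagCtx [QSet.dist, QSet.dist.dual] Γ) (diagOld _)
        (.tail (.tail (.tail .head)))) =
      locRel x y fun c => F (x.atom c, y.atom c) b :=
  (congrArg (diagAt₂ (X := QSet.dist) (Y := QSet.dist.dual) a b)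
    (graph_termConjugation F x y _ _)).trans
    (diagAt₂_locRel (X := QSet.dist) (Y := QSet.dist.dual) a b x y _)

theorem diagAt₂_iSup_test_inf {Y Z X₁ Y₁ X₂ Y₂ : QSet.{u}} (hY : Y.IsClassical) (hZ : Z.IsClassical)
    (a : Y.At) (b : Z.At) {A B : Type*}
    (p : A → B → (QSet.prodList (Y :: Y.dual :: Z :: Z.dual :: Γ)).At → Prop)
    (x₁ : Var Γ X₁) (y₁ : Var Γ Y₁) (x₂ : Var Γ X₂) (y₂ : Var Γ Y₂)
    (W₁ : A → ∀ c : (QSet.prodList Γ).At,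
      Submodule ℂ (StrongDual ℂ (X₁.H (x₁.atom c) ⊗[ℂ] Y₁.H (y₁.atom c))))
    (W₂ : B → ∀ c : (QSet.prodList Γ).At,
      Submodule ℂ (StrongDual ℂ (X₂.H (x₂.atom c) ⊗[ℂ] Y₂.H (y₂.atom c)))) :
    diagAt₂ a b (⨆ (j : B) (i : A),
      test (Γ := Y :: Y.dual :: Z :: Z.dual :: Γ) (p i j) ⊓
        (locRel x₁.tail.tail.tail.tail y₁.tail.tail.tail.tail (fun c => W₁ i c.2.2.2.2) ⊓
         locRel x₂.tail.tail.tail.tail y₂.tail.tail.tail.tail fun c => W₂ j c.2.2.2.2)) =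
      ⨆ (j : B) (i : A), test (fun c => p i j (a, (a, (b, (b, c))))) ⊓
        (locRel x₁ y₁ (W₁ i) ⊓ locRel x₂ y₂ (W₂ j)) := by
  refine (diagAt₂_iSup hY hZ a b _).trans (iSup_congr fun j => ?_)
  refine (diagAt₂_iSup hY hZ a b _).trans (iSup_congr fun i => ?_)
  exact diagAt₂_inf (diagAt₂_test hY hZ a b _)
    (diagAt₂_inf (diagAt₂_locRel a b x₁ y₁ _) (diagAt₂_locRel a b x₂ y₂ _))

theorem diagAt₂_graph_termAddConj (F : BRel (X.prod X.dual) QSet.dist) (x₁ x₂ : Var Γ X.dual)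
    (y₁ y₂ : Var Γ X) {Y : QSet.{u}} (hY : Y.IsClassical) (ρ : Ren Γ (diagCtx [Y, QSet.dist.dual] Γ))
    (hρ : ∀ Z v, ρ Z v = v.tail.tail.tail.tail) (a : Y.At) (b : (QSet.dist.{u}).At) :
    diagAt₂ (Y := QSet.dist.dual) a b
      ((termAddConj (termConj F x₁ y₁) (termConj F x₂ y₂)).graph
        (diagCtx [Y, QSet.dist.dual] Γ) ρ (.tail (.tail (.tail .head)))) =
      ⨆ (β₂ : (QSet.dist.{u}).At) (β₁ : (QSet.dist.{u}).At),
        test (fun _ => β₁.down + β₂.down = b.down) ⊓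
        (locRel x₁ y₁ (fun c => conjSlice F (x₁.atom c) (y₁.atom c) β₁) ⊓
         locRel x₂ y₂ fun c => conjSlice F (x₂.atom c) (y₂.atom c) β₂) := by
  obtain rfl : ρ = fun Z v => v.tail.tail.tail.tail := by funext Z v; exact hρ Z v
  have e := graph_termAddConj F x₁ x₂ y₁ y₂ (Θ := Y :: Y.dual :: QSet.dist.dual ::
    QSet.dist.dual.dual :: Γ) (fun Z v => v.tail.tail.tail.tail) (.tail (.tail (.tail .head)))
  have e2 := diagAt₂_iSup_test_inf (Y := Y) (Z := QSet.dist.dual) hY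
      isClassical_dist.dual a b (fun (β₁ β₂ : (QSet.dist.{u}).At) c =>
        β₁.down + β₂.down = c.2.2.2.1.down) x₁ y₁ x₂ y₂
      (fun β₁ c => conjSlice F (x₁.atom c) (y₁.atom c) β₁)
      fun β₂ c => conjSlice F (x₂.atom c) (y₂.atom c) β₂
  have e1 := congrArg (diagAt₂ (Y := QSet.dist.dual) a b) e
  exact e1.trans e2

theorem iSup_test_apply {A B : Type*} (p : A → B → Prop) {L₁ L₂ : B → A → QRel Γ}
    {M₁ : A → QRel Γ} {M₂ : B → QRel Γ} (h₁ : ∀ b a, L₁ b a = M₁ a) (h₂ : ∀ b a, L₂ b a = M₂ b)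
    (c : (QSet.prodList Γ).At) :
    (⨆ (b : B) (a : A), test (fun _ => p a b) ⊓ (L₁ b a ⊓ L₂ b a)) c =
      ⨆ (b : B) (a : A) (_ : p a b), M₁ a c ⊓ M₂ b c := by
  simp only [h₁, h₂, test_const_inf, iSup_apply]
  rfl

theorem equality_dist (a b : (QSet.dist.{u}).At) (u : (QSet.prodList.{u} []).At) :
    equality QSet.dist (a, (b, u)) = ⨆ _ : a = b, ⊤ :=
  equality_classical isClassical_dist a b u

/-- The equality makes the two intermediate distances coincide and the graph of the constant makes
the second one 0, so only one term of the double supremum is nonzero. -/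
theorem interp_zeroDistance (F : BRel (X.prod X.dual) QSet.dist) (x : Var Γ X)
    (y : Var Γ X.dual) (h) :
    (Formula.rel₂ (equality QSet.dist) (term F x y) termZeroConj h).interp =
      locRel x y fun c => F (x.atom c, y.atom c) ⟨0⟩ := by
  refine (interp_rel₂ (X := QSet.dist) (Y := QSet.dist.dual) isClassical_dist
    isClassical_dist.dual (p := fun a b => a = b) equality_dist (term F x y) termZeroConj h
    rfl).trans ?_
  have h1 := fun b a : (QSet.dist.{u}).At => diagAt₂_graph_term_left F x y
    (Y := QSet.dist.dual) (fun Z v => v) a b (diagOld _) fun Z v => rfl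
  have h2 := fun b a : (QSet.dist.{u}).At => diagAt₂_graph_termZeroConj (Γ := Γ) a b (diagOld _)
  refine (iSup_congr fun b => iSup_congr fun a => congrArg₂ (fun L M =>
    test (fun _ => a = b) ⊓ (L ⊓ M)) (h1 b a) (h2 b a)).trans ?_
  funext c
  simp only [iSup_apply]
  refine le_antisymm (iSup_le fun b => iSup_le fun a => ?_) (le_iSup_of_le ⟨0⟩ (le_iSup_of_le ⟨0⟩ ?_))
  · change (⨆ _ : a = b, ⊤) ⊓ (loc x y c (F (x.atom c, y.atom c) a) ⊓ (⨆ _ : 0 = b.down, ⊤)) ≤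
      loc x y c (F (x.atom c, y.atom c) ⟨0⟩)
    rw [Submodule.inf_iSup_prop_top, Submodule.iSup_prop_top_inf]
    refine iSup_le fun h => iSup_le fun h' => ?_
    obtain ⟨b⟩ := b
    subst h h'
    exact le_rfl
  · change loc x y c (F (x.atom c, y.atom c) ⟨0⟩) ≤ (⨆ _ : ULift.up 0 = ULift.up 0, ⊤) ⊓
      (loc x y c (F (x.atom c, y.atom c) ⟨0⟩) ⊓ (⨆ _ : (0 : ℝ≥0∞) = 0, ⊤))
    rw [iSup_pos rfl, iSup_pos rfl, top_inf_eq, inf_top_eq]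

theorem interp_symmetric (F : BRel (X.prod X.dual) QSet.dist) (x₁ x₂ : Var Γ X)
    (y₁ y₂ : Var Γ X.dual) (h) (c : (QSet.prodList Γ).At) :
    (Formula.rel₂ (equality QSet.dist) (term F x₁ y₁) (termConjugation (term F x₂ y₂)) h).interp c =
      ⨆ α, loc x₁ y₁ c (F (x₁.atom c, y₁.atom c) α) ⊓ loc x₂ y₂ c (F (x₂.atom c, y₂.atom c) α) := by
  refine (congrFun (interp_rel₂ (X := QSet.dist) (Y := QSet.dist.dual) isClassical_dist
    isClassical_dist.dual (p := fun a b => a = b) equality_dist (term F x₁ y₁)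
    (termConjugation (term F x₂ y₂)) h rfl) c).trans ?_
  have h1 := fun b a : (QSet.dist.{u}).At => diagAt₂_graph_term_left F x₁ y₁
    (Y := QSet.dist.dual) (fun Z v => v) a b (diagOld _) fun Z v => rfl
  have h2 := fun b a : (QSet.dist.{u}).At => diagAt₂_graph_termConjugation F x₂ y₂ a b
  refine (congrFun (iSup_congr fun b => iSup_congr fun a => congrArg₂ (fun L M =>
    test (fun _ => a = b) ⊓ (L ⊓ M)) (h1 b a) (h2 b a)) c).trans ?_
  simp only [iSup_apply]
  rw [iSup_comm]
  refine iSup_congr fun a => ?_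
  refine le_antisymm (iSup_le fun b => ?_) (le_iSup_of_le a ?_)
  · change (⨆ _ : a = b, ⊤) ⊓ (loc x₁ y₁ c (F (x₁.atom c, y₁.atom c) a) ⊓
      loc x₂ y₂ c (F (x₂.atom c, y₂.atom c) b)) ≤ _
    rw [Submodule.iSup_prop_top_inf]
    exact iSup_le fun h => h ▸ le_rfl
  · change _ ≤ (⨆ _ : a = a, ⊤) ⊓ (loc x₁ y₁ c (F (x₁.atom c, y₁.atom c) a) ⊓
      loc x₂ y₂ c (F (x₂.atom c, y₂.atom c) a))
    rw [iSup_pos rfl, top_inf_eq]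

/-- The outer pair of distances comes from the bend of the order and the inner pair from the graph
of addition. Intersection cannot be distributed over the inner supremum, since the lattice of
subspaces is not distributive. -/
theorem interp_triangle (F : BRel (X.prod X.dual) QSet.dist) (x y' y'' : Var Γ X)
    (y x' x'' : Var Γ X.dual) (h) (c : (QSet.prodList Γ).At) :
    (Formula.rel₂ (of₂ (BRel.ofRel (fun α β : ℝ≥0∞ => α ≤ β)).bend) (term F x y)
      (termAddConj (termConj F x' y') (termConj F x'' y'')) h).interp c =
      ⨆ (β : (QSet.dist.{u}).At) (α : (QSet.dist.{u}).At) (_ : α.down ≤ β.down),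
        loc x y c (F (x.atom c, y.atom c) α) ⊓
          ⨆ (β₂ : (QSet.dist.{u}).At) (β₁ : (QSet.dist.{u}).At)
            (_ : β₁.down + β₂.down = β.down),
            loc x' y' c (conjSlice F (x'.atom c) (y'.atom c) β₁) ⊓
            loc x'' y'' c (conjSlice F (x''.atom c) (y''.atom c) β₂) := by
  have hG : ∀ (a b : (QSet.dist.{u}).At) (u : (QSet.prodList []).At),
    of₂ (BRel.ofRel (fun α β : ℝ≥0∞ => α ≤ β)).bend (a, (b, u)) =
      ⨆ _ : a.down ≤ b.down, ⊤ := of₂_bend_ofRel _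
  refine (congrFun (interp_rel₂ (X := QSet.dist) (Y := QSet.dist.dual) isClassical_dist
    isClassical_dist.dual (p := fun a b => a.down ≤ b.down) hG (term F x y)
    (termAddConj (termConj F x' y') (termConj F x'' y'')) h rfl) c).trans ?_
  have h1 := fun b a : (QSet.dist.{u}).At => diagAt₂_graph_term_left F x y
    (Y := QSet.dist.dual) (fun Z v => v) a b (diagOld _) fun Z v => rfl
  have h2 := fun b a : (QSet.dist.{u}).At => diagAt₂_graph_termAddConj F x' x'' y' y''
    (Y := QSet.dist) isClassical_dist (diagOld _) (fun Z v => rfl) a b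
  refine (iSup_test_apply (fun a b : (QSet.dist.{u}).At => a.down ≤ b.down) h1 h2 c).trans ?_
  refine iSup_congr fun b => iSup_congr fun a => iSup_congr fun _ => ?_
  refine congrArg (loc x y c (F (x.atom c, y.atom c) a) ⊓ ·) ?_
  simp only [iSup_apply]
  exact iSup_congr fun b => iSup_congr fun a => Submodule.iSup_prop_top_inf _ _

end DistanceFunction

-- Adapted bases and the Hilbert–Schmidt inner product

theorem exists_orthonormalBasis_of_iSup_eq_top {E : Type*} [NormedAddCommGroup E]
    [InnerProductSpace ℂ E] [FiniteDimensional ℂ E] {ι : Type*} (P : ι → Submodule ℂ E)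
    (hO : ∀ i j, i ≠ j → ∀ x ∈ P i, ∀ y ∈ P j, inner ℂ x y = 0) (hT : ⨆ i, P i = ⊤) :
    ∃ (n : ℕ) (b : OrthonormalBasis (Fin n) ℂ E) (α : Fin n → ι), ∀ k, b k ∈ P (α k) := by
  classical
  -- The index set may be infinite, but an independent family in a finite-dimensional space has only
  -- finitely many nonzero members. Discarding the others leaves a finite internal direct sum.
  let κ := {i // P i ≠ ⊥}
  have hV : OrthogonalFamily ℂ (fun i => P i) fun i => (P i).subtypeₗᵢ :=
    OrthogonalFamily.of_pairwise fun i j hij =>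
      Submodule.isOrtho_iff_inner_eq.2 (hO i j hij)
  have hV' : OrthogonalFamily ℂ (fun i : κ => P i.1) fun i => (P i.1).subtypeₗᵢ :=
    hV.comp Subtype.val_injective
  have : Finite κ := WellFoundedGT.finite_ne_bot_of_iSupIndep hV.independent
  have := Fintype.ofFinite κ
  have hT' : ⨆ i : κ, P i.1 = ⊤ := by
    refine eq_top_iff.2 (hT ▸ iSup_le fun i => ?_)
    by_cases h : P i = ⊥
    · rw [h]; exact bot_le
    · exact le_iSup (fun i : κ => P i.1) ⟨i, h⟩
  have hI : DirectSum.IsInternal fun i : κ => P i.1 :=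
    hV'.isInternal_iff.2 (by rw [hT', Submodule.top_orthogonal_eq_bot])
  refine ⟨_, hI.subordinateOrthonormalBasis rfl hV', fun k =>
    (hI.subordinateOrthonormalBasisIndex rfl k hV').1, fun k => ?_⟩
  exact hI.subordinateOrthonormalBasis_subordinate rfl k hV'

section

variable {H K L : Type} [NormedAddCommGroup H] [InnerProductSpace ℂ H] [FiniteDimensional ℂ H]
  [NormedAddCommGroup K] [InnerProductSpace ℂ K] [FiniteDimensional ℂ K]
  [NormedAddCommGroup L] [InnerProductSpace ℂ L] [FiniteDimensional ℂ L]

namespace BRel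

/-- The Riesz vector of the bend of r is ∑ᵢ eᵢ ⊗ ⟨r eᵢ|. Pairing with it is the contraction by which
components of F are separated below; between two bends it is the Hilbert–Schmidt inner product. -/
theorem inner_bendMap {ι : Type*} [Fintype ι] (e : OrthonormalBasis ι ℂ H) (r : H →L[ℂ] K)
    (g : StrongDual ℂ (H ⊗[ℂ] DualSpace K)) :
    inner ℂ (bendMap H K r) g = ∑ i, g (e i ⊗ₜ[ℂ] DualSpace.bra (r (e i))) := by
  rw [← map_sum]
  refine StrongDual.inner_eq_apply (fun t => ?_) g
  have : bendMap H K r = innerSL ℂ (∑ i, e i ⊗ₜ[ℂ] DualSpace.bra (r (e i))) := by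
    refine StrongDual.tensor_ext fun x ξ => ?_
    rw [bendMap_apply, innerSL_apply_apply, sum_inner]
    simp only [TensorProduct.inner_tmul, DualSpace.inner_bra]
    conv_lhs => rw [← e.sum_repr' x, map_sum, ← DualSpace.pairingBilin_apply, map_sum,
      LinearMap.sum_apply]
    simp
  rw [this]; rfl

theorem inner_bendMap_bendMap {ι : Type*} [Fintype ι] (e : OrthonormalBasis ι ℂ H)
    (r s : H →L[ℂ] K) :
    inner ℂ (bendMap H K r) (bendMap H K s) = ∑ i, inner ℂ (r (e i)) (s (e i)) := by
  rw [inner_bendMap e]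
  simp [DualSpace.pairing_bra]

theorem bendMap_surjective : Function.Surjective (bendMap H K) := by
  refine (LinearMap.injective_iff_surjective_of_finrank_eq_finrank ?_).1 (bendMap_injective H K)
  rw [finrank_strongDual, Module.finrank_tensorProduct,
    (LinearMap.toContinuousLinearMap (𝕜 := ℂ) (E := H) (F' := K)).symm.finrank_eq,
    Module.finrank_linearMap]
  exact congrArg _ finrank_strongDual.symm

/-- The inner product with a rank one operator. -/
theorem inner_bendMap_of_rankOne (r : H →L[ℂ] K) {g : StrongDual ℂ (H ⊗[ℂ] DualSpace K)}
    {ξ : DualSpace H} {y : K} (hg : ∀ x η, g (x ⊗ₜ[ℂ] η) = DualSpace.pairing η y *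
      DualSpace.pairing ξ x) :
    inner ℂ (bendMap H K r) g = DualSpace.pairing ξ (ContinuousLinearMap.adjoint r y) := by
  rw [inner_bendMap (stdOrthonormalBasis ℂ H)]
  conv_rhs => rw [DualSpace.pairing_eq_sum (stdOrthonormalBasis ℂ H)]
  simp only [hg, DualSpace.pairing_bra, ContinuousLinearMap.adjoint_inner_right]

/-- Parseval's identity for a rank one operator. -/
theorem sum_bendMap_mul {ι : Type*} [Fintype ι]
    (b : OrthonormalBasis ι ℂ (StrongDual ℂ (H ⊗[ℂ] DualSpace K))) (u : ι → H →L[ℂ] K)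
    (hu : ∀ i, b i = bendMap H K (u i)) (ξ : DualSpace H) (y : K) (x : H) (η : DualSpace K) :
    ∑ i, DualSpace.pairing ξ (ContinuousLinearMap.adjoint (u i) y) * DualSpace.pairing η (u i x) =
      DualSpace.pairing η y * DualSpace.pairing ξ x := by
  let g : StrongDual ℂ (H ⊗[ℂ] DualSpace K) :=
    StrongDual.tmul ξ (LinearMap.toContinuousLinearMap (DualSpace.pairingBilin K y))
  have hg : ∀ x η, g (x ⊗ₜ[ℂ] η) = DualSpace.pairing η y * DualSpace.pairing ξ x := fun x η =>
    (StrongDual.tmul_apply ξ _ x η).trans (mul_comm _ _)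
  rw [← hg]
  conv_rhs => rw [← b.sum_repr' g, sum_apply]
  refine Finset.sum_congr rfl fun i _ => ?_
  rw [hu, inner_bendMap_of_rankOne (u i) hg, smul_apply, bendMap_apply, smul_eq_mul]

/-- Parseval's identity with the functional on K removed, so that it can be applied twice in
succession for a composite of two operators. -/
theorem sum_inner_smul {ι : Type*} [Fintype ι]
    (b : OrthonormalBasis ι ℂ (StrongDual ℂ (H ⊗[ℂ] DualSpace K))) (u : ι → H →L[ℂ] K)
    (hu : ∀ i, b i = bendMap H K (u i)) (p : H) (y : K) (x : H) :
    ∑ i, (inner ℂ (u i p) y : ℂ) • u i x = (inner ℂ p x : ℂ) • y := by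
  refine ext_inner_left ℂ fun q => ?_
  have := sum_bendMap_mul b u hu (DualSpace.bra p) y x (DualSpace.bra q)
  simp only [DualSpace.pairing_bra, ContinuousLinearMap.adjoint_inner_right] at this
  rw [inner_sum, inner_smul_right, mul_comm, ← this]
  simp [inner_smul_right]

/-- Taking adjoints is antiunitary for the Hilbert–Schmidt inner product: both sides are the same
double sum of matrix entries in orthonormal bases of H and K. -/
theorem inner_bendMap_adjoint (r s : H →L[ℂ] K) :
    inner ℂ (bendMap K H (ContinuousLinearMap.adjoint r))
      (bendMap K H (ContinuousLinearMap.adjoint s)) =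
      inner ℂ (bendMap H K s) (bendMap H K r) := by
  let e := stdOrthonormalBasis ℂ H
  let f := stdOrthonormalBasis ℂ K
  rw [inner_bendMap_bendMap f, inner_bendMap_bendMap e]
  simp_rw [fun i => (e.sum_inner_mul_inner (ContinuousLinearMap.adjoint r (f i))
    (ContinuousLinearMap.adjoint s (f i))).symm, fun i => (f.sum_inner_mul_inner (s (e i))
    (r (e i))).symm]
  rw [Finset.sum_comm]
  refine Finset.sum_congr rfl fun i _ => Finset.sum_congr rfl fun j _ => ?_
  rw [ContinuousLinearMap.adjoint_inner_left, ContinuousLinearMap.adjoint_inner_right, mul_comm]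

end BRel

theorem StrongDual.exists_eq_sum_tmul (r : StrongDual ℂ (H ⊗[ℂ] K)) :
    ∃ (n : ℕ) (ξ : Fin n → StrongDual ℂ H) (η : Fin n → StrongDual ℂ K),
      ∀ x y, r (x ⊗ₜ[ℂ] y) = ∑ i, ξ i x * η i y := by
  let e := stdOrthonormalBasis ℂ H
  refine ⟨_, fun i => innerSL ℂ (e i), fun i => LinearMap.toContinuousLinearMap
    ((r : H ⊗[ℂ] K →ₗ[ℂ] ℂ) ∘ₗ TensorProduct.mk ℂ H K (e i)), fun x y => ?_⟩
  conv_lhs => rw [← e.sum_repr' x, TensorProduct.sum_tmul, map_sum]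
  refine Finset.sum_congr rfl fun i _ => ?_
  rw [← TensorProduct.smul_tmul', map_smul]
  rfl

end

namespace QRel

variable {Γ : List QSet.{u}} {X Y : QSet.{u}}

/-- One functional r serves for all values of the two free entries while the others stay frozen at
x. The lemma that follows is a converse for functionals in product form. -/
theorem exists_of_mem_loc {vx : Var Γ X} {vy : Var Γ Y} {c : (QSet.prodList Γ).At}
    {W : Submodule ℂ (StrongDual ℂ (X.H (vx.atom c) ⊗[ℂ] Y.H (vy.atom c)))}
    {f : StrongDual ℂ ((QSet.prodList Γ).H c)} (hf : f ∈ loc vx vy c W)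
    (hne : vy.index ≠ vx.index) (x : Vecs Γ c) :
    ∃ r ∈ W, ∀ h k, f (Vecs.tensor Γ c (vx.set c h (vy.set c k x))) = r (h ⊗ₜ[ℂ] k) := by
  obtain ⟨r, hr, hz⟩ := hf x
  refine ⟨r, hr, fun h k => (hz _ fun Z v hv => ?_).trans ?_⟩
  · rw [Var.vec_set_of_ne vx v c h _ fun e => hv (by simp [e]),
      Var.vec_set_of_ne vy v c k _ fun e => hv (by simp [e])]
  · rw [Var.vec_set_self, Var.vec_set_of_ne vx vy c h _ hne, Var.vec_set_self]

theorem mem_loc_of_eq_mul {vx : Var Γ X} {vy : Var Γ Y} {c : (QSet.prodList Γ).At}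
    {W : Submodule ℂ (StrongDual ℂ (X.H (vx.atom c) ⊗[ℂ] Y.H (vy.atom c)))}
    {f : StrongDual ℂ ((QSet.prodList Γ).H c)}
    {r : StrongDual ℂ (X.H (vx.atom c) ⊗[ℂ] Y.H (vy.atom c))} (hr : r ∈ W) (m : Vecs Γ c → ℂ)
    (hm : ∀ x z, Vecs.AgreeOff [vx.index, vy.index] x z → m x = m z)
    (hf : ∀ z, f (Vecs.tensor Γ c z) = m z * r (vx.vec c z ⊗ₜ[ℂ] vy.vec c z)) :
    f ∈ loc vx vy c W := fun x =>
  ⟨m x • r, W.smul_mem _ hr, fun z hz => by rw [hf, hm x z hz]; rfl⟩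

end QRel

namespace Formula

theorem interp_allDiag {Γ : List QSet.{u}} {X : QSet.{u}} (φ : Formula (X :: X.dual :: Γ)) :
    (Formula.allDiag X φ).interp = QRel.allDiag X φ.interp := rfl

/-- The generator of the predicates on the empty product. -/
noncomputable def unitPred : StrongDual ℂ ℂ := ContinuousLinearMap.id ℂ ℂ

/-- The empty product is the single atom ℂ, whose dual is spanned by `unitPred`. -/
theorem isTrue_iff {φ : Formula.{u} []} : φ.IsTrue ↔ unitPred ∈ φ.interp PUnit.unit := by
  constructor
  · intro h
    rw [IsTrue] at h
    rw [h]; trivial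
  · intro h
    refine funext fun a => eq_top_iff.2 fun f _ => ?_
    have : f = f (1 : ℂ) • unitPred := by
      refine ContinuousLinearMap.ext_ring ?_
      exact (mul_one (f (1 : ℂ))).symm
    rw [this]
    exact Submodule.smul_mem _ _ h

end Formula

-- Zero self-distance

namespace DistanceFunction
open QRel BRel Formula

variable {X : QSet.{u}}

/-- The binary relations on `X` whose bends are the components of `F`. -/
noncomputable def component (F : BRel (X.prod X.dual) QSet.dist) (α : ℝ≥0∞) : BRel X X :=
  fun a b => (F (a, b) ⟨α⟩).comap (bendMap (X.H a) (X.H b))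

theorem mem_component {F : BRel (X.prod X.dual) QSet.dist} {α : ℝ≥0∞} {a b : X.At}
    {r : X.H a →L[ℂ] X.H b} : r ∈ component F α a b ↔ bendMap (X.H a) (X.H b) r ∈ F (a, b) ⟨α⟩ :=
  Iff.rfl

theorem exists_component {F : BRel (X.prod X.dual) QSet.dist} {α : ℝ≥0∞} {a b : X.At}
    {f : StrongDual ℂ (X.H a ⊗[ℂ] DualSpace (X.H b))} (hf : f ∈ F (a, b) ⟨α⟩) :
    ∃ r ∈ component F α a b, f = bendMap _ _ r := by
  obtain ⟨r, rfl⟩ := bendMap_surjective f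
  exact ⟨r, hf, rfl⟩

theorem isTrue_zeroSelfDistance (F : BRel (X.prod X.dual) QSet.dist) :
    (zeroSelfDistance F).IsTrue ↔ ∀ a, ContinuousLinearMap.id ℂ (X.H a) ∈ component F 0 a a := by
  rw [isTrue_iff, zeroSelfDistance, interp_allDiag, mem_allDiag]
  refine forall_congr' fun a => ?_
  rw [interp_zeroDistance]
  constructor
  · intro h
    -- Both variables of the context are sliced, so the base tuple is irrelevant. The slice is ev
    -- itself, which is the bend of the identity.
    obtain ⟨r, hr, hrf⟩ := exists_of_mem_loc (vx := .head) (vy := .tail .head) h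
      (by simp [Var.index]) ((0 : X.H a), ((0 : DualSpace (X.H a)), ()))
    have : bendMap (X.H a) (X.H a) (ContinuousLinearMap.id ℂ (X.H a)) = r := by
      refine StrongDual.tensor_ext fun x ξ => ?_
      refine Eq.trans ?_ (hrf x ξ)
      rw [bendMap_apply]
      refine Eq.trans ?_ (evalTensor_apply unitPred x ξ (1 : ℂ)).symm
      exact (mul_one _).symm
    rw [mem_component, this]
    exact hr
  · intro h
    refine mem_loc_of_eq_mul (vx := .head) (vy := .tail .head) h (fun _ => 1) (fun _ _ _ => rfl)
      fun z => ?_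
    refine (evalTensor_apply unitPred z.1 z.2.1 (1 : ℂ)).trans ?_
    rw [one_mul]
    exact (mul_one _).trans (bendMap_apply (ContinuousLinearMap.id ℂ (X.H a)) z.1 z.2.1).symm

end DistanceFunction

theorem Submodule.mem_iff_of_eq {R M : Type*} [Semiring R] [AddCommMonoid M] [Module R M]
    {p q : Submodule R M} (h : p = q) {x : M} : x ∈ p ↔ x ∈ q := h ▸ Iff.rfl

-- Symmetry

namespace DistanceFunction
open QRel BRel Formula

variable {X : QSet.{u}}

/-- The component of `F` at given atoms. -/
abbrev slice (F : BRel (X.prod X.dual) QSet.dist) (a b : X.At) (α : (QSet.dist.{u}).At) :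
    Submodule ℂ (StrongDual ℂ (X.H a ⊗[ℂ] DualSpace (X.H b))) := F (a, b) α

/-- `F` decomposes each space of operators between atoms into mutually orthogonal subspaces. -/
structure IsDecomposition (F : BRel (X.prod X.dual) QSet.dist) : Prop where
  inner_eq_zero : ∀ a b α β, α ≠ β → ∀ f ∈ slice F a b α, ∀ g ∈ slice F a b β, inner ℂ f g = 0
  iSup_eq_top : ∀ a b, ⨆ α, slice F a b α = ⊤

theorem IsDecomposition.exists_basis {F : BRel (X.prod X.dual) QSet.dist}
    (hF : IsDecomposition F) (a b : X.At) :
    ∃ (n : ℕ) (e : OrthonormalBasis (Fin n) ℂ (StrongDual ℂ (X.H a ⊗[ℂ] DualSpace (X.H b))))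
      (u : Fin n → X.H a →L[ℂ] X.H b) (α : Fin n → ℝ≥0∞),
      ∀ k, e k = bendMap _ _ (u k) ∧ u k ∈ component F (α k) a b := by
  obtain ⟨n, e, α, h⟩ := exists_orthonormalBasis_of_iSup_eq_top (slice F a b)
    (hF.inner_eq_zero a b) (hF.iSup_eq_top a b)
  choose u hu hu' using fun k => exists_component (α := (α k).down) (h k)
  exact ⟨n, e, u, fun k => (α k).down, fun k => ⟨hu' k, hu k⟩⟩

variable (a₁ a₂ : X.At)

/-- The tuple of atoms for two pairs of variables. -/
@[reducible] def atoms₂ : (QSet.prodList.{u} [X, X.dual, X, X.dual]).At :=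
  (a₂, (a₂, (a₁, (a₁, PUnit.unit))))

variable {a₁ a₂}

theorem evalTensor_two (x₂ : X.H a₂) (ξ₂ : DualSpace (X.H a₂)) (x₁ : X.H a₁)
    (ξ₁ : DualSpace (X.H a₁)) :
    evalTensor (X.H a₂) (evalTensor (X.H a₁) unitPred)
      (x₂ ⊗ₜ[ℂ] (ξ₂ ⊗ₜ[ℂ] (x₁ ⊗ₜ[ℂ] (ξ₁ ⊗ₜ[ℂ] (1 : ℂ))))) =
      DualSpace.pairing ξ₂ x₂ * DualSpace.pairing ξ₁ x₁ := by
  refine (evalTensor_apply _ x₂ ξ₂ _).trans (congrArg _ ?_)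
  exact (evalTensor_apply unitPred x₁ ξ₁ (1 : ℂ)).trans (mul_one _)

/-- The functional `x₂ ⊗ ξ₂ ⊗ x₁ ⊗ ξ₁ ↦ r(x₁ ⊗ ξ₂) s(x₂ ⊗ ξ₁)`. -/
theorem exists_mul_two (r : StrongDual ℂ (X.H a₁ ⊗[ℂ] DualSpace (X.H a₂)))
    (s : StrongDual ℂ (X.H a₂ ⊗[ℂ] DualSpace (X.H a₁))) :
    ∃ f : StrongDual ℂ ((QSet.prodList.{u} [X, X.dual, X, X.dual]).H (atoms₂ a₁ a₂)),
      ∀ z : Vecs [X, X.dual, X, X.dual] (atoms₂ a₁ a₂), f (Vecs.tensor _ _ z) =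
        s (z.1 ⊗ₜ[ℂ] z.2.2.2.1) * r (z.2.2.1 ⊗ₜ[ℂ] z.2.1) := by
  obtain ⟨n, ξ, η, hr⟩ := StrongDual.exists_eq_sum_tmul r
  obtain ⟨m, ξ', η', hs⟩ := StrongDual.exists_eq_sum_tmul s
  refine ⟨∑ i, ∑ j, StrongDual.tmul (ξ' i) (StrongDual.tmul (η j) (StrongDual.tmul (ξ j)
    (StrongDual.tmul (η' i) (ContinuousLinearMap.id ℂ ℂ)))), fun z => ?_⟩
  rw [hr, hs, Finset.sum_mul_sum]
  simp only [sum_apply]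
  refine Finset.sum_congr rfl fun i _ => Finset.sum_congr rfl fun j _ => ?_
  refine Eq.trans (b := ξ' i z.1 * (η j z.2.1 * (ξ j z.2.2.1 * (η' i z.2.2.2.1 * (1 : ℂ))))) ?_ ?_
  · simp only [Vecs.tensor, StrongDual.tmul_apply]
    rfl
  · ring

/-- The sum is the inner product with the bend of r in the variables (x₁, x₂_*). In a summand with
distance β ≠ α these slices lie in a component orthogonal to r, and the result is 0. In the summand
at α the remaining variables (x₂, x₁_*) have their slices in the component at α, and so does the
sum. -/
theorem symmetry_aux {F : BRel (X.prod X.dual) QSet.dist} (hF : IsDecomposition F) {α : ℝ≥0∞}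
    {r : X.H a₁ →L[ℂ] X.H a₂} (hr : r ∈ component F α a₁ a₂)
    {f : StrongDual ℂ ((QSet.prodList.{u} [X, X.dual, X, X.dual]).H (atoms₂ a₁ a₂))}
    (hf : f ∈ ⨆ α, loc (Γ := [X, X.dual, X, X.dual]) (.tail (.tail .head)) (.tail .head)
        (atoms₂ a₁ a₂) (slice F a₁ a₂ α) ⊓
      loc (Γ := [X, X.dual, X, X.dual]) .head (.tail (.tail (.tail .head)))
        (atoms₂ a₁ a₂) (slice F a₂ a₁ α)) :
    ∃ w ∈ slice F a₂ a₁ ⟨α⟩, ∀ (x₂ : X.H a₂) (ξ₁ : DualSpace (X.H a₁)),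
      ∑ i, f (x₂ ⊗ₜ[ℂ] (DualSpace.bra (r (stdOrthonormalBasis ℂ (X.H a₁) i)) ⊗ₜ[ℂ]
        (stdOrthonormalBasis ℂ (X.H a₁) i ⊗ₜ[ℂ] (ξ₁ ⊗ₜ[ℂ] (1 : ℂ))))) = w (x₂ ⊗ₜ[ℂ] ξ₁) := by
  refine Submodule.iSup_induction _ (motive := fun f : StrongDual ℂ ((QSet.prodList.{u}
    [X, X.dual, X, X.dual]).H (atoms₂ a₁ a₂)) => ∃ w ∈ slice F a₂ a₁ ⟨α⟩,
      ∀ (x₂ : X.H a₂) (ξ₁ : DualSpace (X.H a₁)),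
      ∑ i, f (x₂ ⊗ₜ[ℂ] (DualSpace.bra (r (stdOrthonormalBasis ℂ (X.H a₁) i)) ⊗ₜ[ℂ]
        (stdOrthonormalBasis ℂ (X.H a₁) i ⊗ₜ[ℂ] (ξ₁ ⊗ₜ[ℂ] (1 : ℂ))))) = w (x₂ ⊗ₜ[ℂ] ξ₁)) hf ?_ ?_ ?_
  · rintro β f ⟨hf1, hf2⟩
    by_cases hβ : β = ⟨α⟩
    · subst hβ
      have := fun i => exists_of_mem_loc (vx := .head) (vy := .tail (.tail (.tail .head))) hf2
        (by simp [Var.index]) ((0 : X.H a₂), (DualSpace.bra (r (stdOrthonormalBasis ℂ (X.H a₁) i)),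
          (stdOrthonormalBasis ℂ (X.H a₁) i, ((0 : DualSpace (X.H a₁)), ()))))
      choose w hw h using this
      refine ⟨∑ i, w i, Submodule.sum_mem _ fun i _ => hw i, fun x₂ ξ₁ => ?_⟩
      exact (Finset.sum_congr rfl fun i _ => h i x₂ ξ₁).trans (sum_apply _ w _).symm
    · refine ⟨0, Submodule.zero_mem _, fun x₂ ξ₁ => ?_⟩
      obtain ⟨w, hw, h⟩ := exists_of_mem_loc (vx := .tail (.tail .head)) (vy := .tail .head) hf1
        (by simp [Var.index]) (x₂, ((0 : DualSpace (X.H a₂)), ((0 : X.H a₁), (ξ₁, ()))))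
      refine (Finset.sum_congr rfl fun i _ => h (stdOrthonormalBasis ℂ (X.H a₁) i)
        (DualSpace.bra (r (stdOrthonormalBasis ℂ (X.H a₁) i)))).trans ?_
      refine (inner_bendMap (stdOrthonormalBasis ℂ (X.H a₁)) r w).symm.trans ?_
      exact hF.inner_eq_zero _ _ _ _ (Ne.symm hβ) _ hr _ hw
  · exact ⟨0, Submodule.zero_mem _, fun _ _ => Finset.sum_eq_zero fun _ _ => rfl⟩
  · rintro f g ⟨w, hw, h⟩ ⟨v, hv, k⟩
    refine ⟨w + v, Submodule.add_mem _ hw hv, fun x₂ ξ₁ => ?_⟩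
    rw [add_apply, ← h, ← k, ← Finset.sum_add_distrib]
    rfl

theorem isTrue_allDiag_allDiag (φ : Formula [X, X.dual, X, X.dual]) :
    (Formula.allDiag X (.allDiag X φ)).IsTrue ↔ ∀ a₁ a₂ : X.At,
      evalTensor (X.H a₂) (evalTensor (X.H a₁) unitPred) ∈ φ.interp (atoms₂ a₁ a₂) := by
  rw [isTrue_iff, interp_allDiag, mem_allDiag]
  refine forall_congr' fun a₁ => ?_
  rw [interp_allDiag, mem_allDiag]

theorem symmetry_eq (F : BRel (X.prod X.dual) QSet.dist) : ∃ h, symmetry F =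
    .allDiag X (.allDiag X (.rel₂ (QRel.equality QSet.dist)
      (term F (Γ := [X, X.dual, X, X.dual]) (.tail (.tail .head)) (.tail .head))
      (termConjugation (term F .head (.tail (.tail (.tail .head))))) h)) := ⟨_, rfl⟩

set_option synthInstance.maxHeartbeats 200000 in
theorem isTrue_symmetry_iff_mem (F : BRel (X.prod X.dual) QSet.dist) :
    (symmetry F).IsTrue ↔ ∀ a₁ a₂ : X.At,
      evalTensor (X.H a₂) (evalTensor (X.H a₁) unitPred) ∈
      ⨆ α, loc (Γ := [X, X.dual, X, X.dual]) (.tail (.tail .head)) (.tail .head)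
        (atoms₂ a₁ a₂) (slice F a₁ a₂ α) ⊓
      loc (Γ := [X, X.dual, X, X.dual]) .head (.tail (.tail (.tail .head)))
        (atoms₂ a₁ a₂) (slice F a₂ a₁ α) := by
  obtain ⟨h, e⟩ := symmetry_eq F
  rw [e]
  refine (isTrue_allDiag_allDiag _).trans (forall_congr' fun a₁ => forall_congr' fun a₂ => ?_)
  have e' := interp_symmetric F (Γ := [X, X.dual, X, X.dual]) (.tail (.tail .head)) .head
    (.tail .head) (.tail (.tail (.tail .head))) h (atoms₂ a₁ a₂)
  exact Submodule.mem_iff_of_eq (e'.trans (iSup_congr fun α => rfl))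

theorem isTrue_symmetry {F : BRel (X.prod X.dual) QSet.dist} (hF : IsDecomposition F) :
    (symmetry F).IsTrue ↔ ∀ α a b, ∀ r ∈ component F α a b,
      ContinuousLinearMap.adjoint r ∈ component F α b a := by
  rw [isTrue_symmetry_iff_mem]
  constructor
  · intro h α a b r hr
    -- For the product of the two evaluations, the contraction with r is the bend of the adjoint of
    -- r.
    obtain ⟨w, hw, h⟩ := symmetry_aux hF hr (h a b)
    have : bendMap (X.H b) (X.H a) (ContinuousLinearMap.adjoint r) = w := by
      refine StrongDual.tensor_ext fun x ξ => ?_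
      rw [← h, bendMap_apply]
      simp only [evalTensor_two]
      conv_lhs => rw [DualSpace.pairing_eq_sum (stdOrthonormalBasis ℂ (X.H a))]
      simp only [DualSpace.pairing_bra, ContinuousLinearMap.adjoint_inner_right]
    rw [mem_component, this]
    exact hw
  · intro h a₁ a₂
    -- In a basis adapted to the decomposition, Parseval's identity writes ev ⊗ ev as the sum of
    -- bend(u_k)(x₁ ⊗ ξ₂) · bend(u_k†)(x₂ ⊗ ξ₁). The k-th term belongs to the summand at the
    -- distance of u_k, since u_k† has the same distance.
    obtain ⟨n, e, u, α, hu⟩ := hF.exists_basis a₁ a₂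
    choose f hf using fun k => exists_mul_two (bendMap _ _ (u k))
      (bendMap _ _ (ContinuousLinearMap.adjoint (u k)))
    have hsum : evalTensor (X.H a₂) (evalTensor (X.H a₁) unitPred) = ∑ k, f k := by
      refine Vecs.functional_ext (Γ := [X, X.dual, X, X.dual]) (a := atoms₂ a₁ a₂) fun z => ?_
      rw [sum_apply]
      refine (evalTensor_two z.1 z.2.1 z.2.2.1 z.2.2.2.1).trans ?_
      refine (sum_bendMap_mul e u (fun k => (hu k).1) z.2.2.2.1 z.1 z.2.2.1 z.2.1).symm.trans ?_
      refine Finset.sum_congr rfl fun k _ => ?_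
      refine Eq.trans ?_ (hf k z).symm
      rw [bendMap_apply, bendMap_apply]
    rw [hsum]
    refine Submodule.sum_mem _ fun k _ => Submodule.mem_iSup_of_mem ⟨α k⟩ ⟨?_, ?_⟩
    · refine mem_loc_of_eq_mul (vx := .tail (.tail .head)) (vy := .tail .head) (hu k).2
        (fun z => bendMap _ _ (ContinuousLinearMap.adjoint (u k)) (z.1 ⊗ₜ[ℂ] z.2.2.2.1))
        (fun x z hxz => ?_) (hf k)
      have h1 := hxz X .head (by simp [Var.index])
      have h2 := hxz X.dual (.tail (.tail (.tail .head))) (by simp [Var.index])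
      exact congrArg₂ (fun s t => bendMap _ _ (ContinuousLinearMap.adjoint (u k)) (s ⊗ₜ[ℂ] t)) h1 h2
    · refine mem_loc_of_eq_mul (vx := .head) (vy := .tail (.tail (.tail .head)))
        (h _ _ _ _ (hu k).2) (fun z => bendMap _ _ (u k) (z.2.2.1 ⊗ₜ[ℂ] z.2.1))
        (fun x z hxz => ?_) fun z => (hf k z).trans (mul_comm _ _)
      have h1 := hxz X (.tail (.tail .head)) (by simp [Var.index])
      have h2 := hxz X.dual (.tail .head) (by simp [Var.index])
      exact congrArg₂ (fun s t => bendMap _ _ (u k) (s ⊗ₜ[ℂ] t)) h1 h2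

end DistanceFunction

/-- The product of the equality predicate at the atom `a` with `f`. -/
noncomputable def QRel.evalAt {X : QSet.{u}} (a : X.At) {Γ : List QSet.{u}}
    {c : (QSet.prodList Γ).At} (f : StrongDual ℂ ((QSet.prodList Γ).H c)) :
    StrongDual ℂ ((QSet.prodList (X :: X.dual :: Γ)).H (a, (a, c))) := evalTensor (X.H a) f

theorem QRel.evalAt_tensor {X : QSet.{u}} {a : X.At} {Γ : List QSet.{u}}
    {c : (QSet.prodList Γ).At} (f : StrongDual ℂ ((QSet.prodList Γ).H c))
    (z : Vecs (X :: X.dual :: Γ) (a, (a, c))) :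
    evalAt a f (Vecs.tensor _ _ z) =
      DualSpace.pairing (z.2.1 : DualSpace (X.H a)) (z.1 : X.H a) * f (Vecs.tensor Γ c z.2.2) :=
  evalTensor_apply f z.1 z.2.1 (Vecs.tensor Γ c z.2.2)

/-- Membership of a functional in the component of a relation at a tuple of atoms. -/
def QRel.Holds {Γ : List QSet.{u}} (φ : QRel Γ) (c : (QSet.prodList Γ).At)
    (f : StrongDual ℂ ((QSet.prodList Γ).H c)) : Prop := f ∈ φ c

theorem QRel.allDiag_holds_iff {X : QSet.{u}} {Γ : List QSet.{u}}
    {φ : QRel (X :: X.dual :: Γ)} {c : (QSet.prodList Γ).At}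
    {f : StrongDual ℂ ((QSet.prodList Γ).H c)} :
    (allDiag X φ).Holds c f ↔ ∀ a : X.At, φ.Holds (a, (a, c)) (evalAt a f) :=
  mem_allDiag

-- The triangle inequality

namespace DistanceFunction
open QRel BRel Formula

variable {X : QSet.{u}}

/-- Up to complex conjugation the sum is the inner product of the bend of u with an element of a
different component. -/
theorem sum_conjSlice_eq_zero {F : BRel (X.prod X.dual) QSet.dist} (hF : IsDecomposition F)
    {a b : X.At} {α : ℝ≥0∞} {β : (QSet.dist.{u}).At} (h : ⟨α⟩ ≠ β) {u : X.H a →L[ℂ] X.H b}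
    (hu : u ∈ component F α a b) {w : StrongDual ℂ (DualSpace (X.H a) ⊗[ℂ] X.H b)}
    (hw : w ∈ conjSlice F a b β) :
    ∑ i, w (DualSpace.bra (stdOrthonormalBasis ℂ (X.H a) i) ⊗ₜ[ℂ]
      u (stdOrthonormalBasis ℂ (X.H a) i)) = 0 := by
  obtain ⟨g, hg, hgw⟩ := hw
  have h1 : inner ℂ (bendMap _ _ u) (g : StrongDual ℂ (X.H a ⊗[ℂ] DualSpace (X.H b))) = 0 :=
    hF.inner_eq_zero a b _ _ h _ hu g hg
  rw [inner_bendMap (stdOrthonormalBasis ℂ (X.H a))] at h1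
  rw [Finset.sum_congr rfl fun i _ => hgw _ _, ← star_sum]
  exact (congrArg star h1).trans (star_zero ℂ)

theorem mem_conjSlice_of_component {F : BRel (X.prod X.dual) QSet.dist} {a b : X.At} {α : ℝ≥0∞}
    {u : X.H a →L[ℂ] X.H b} (hu : u ∈ component F α a b) :
    ∃ w ∈ conjSlice F a b ⟨α⟩, ∀ x y, w (DualSpace.bra x ⊗ₜ[ℂ] y) = inner ℂ (u x) y := by
  refine ⟨StrongDual.ofBilin ((DualSpace.pairingBilin (X.H a)).flip ∘ₗ
    LinearMap.id |>.compl₂ (ContinuousLinearMap.adjoint u : X.H b →ₗ[ℂ] X.H a)), ⟨_, hu, ?_⟩, ?_⟩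
  all_goals intro x y
  all_goals rw [StrongDual.ofBilin_apply]
  all_goals simp [DualSpace.pairing_bra, ContinuousLinearMap.adjoint_inner_right]

section General

variable {Γ : List QSet.{u}} (F : BRel (X.prod X.dual) QSet.dist) (x y' y'' : Var Γ X)
  (y x' x'' : Var Γ X.dual) (c : (QSet.prodList Γ).At)

/-- The interpretation of `(+)_*(F_*(x', y'), F_*(x'', y'')) ↷ β`. -/
noncomputable def sumPred (β : (QSet.dist.{u}).At) :
    Submodule ℂ (StrongDual ℂ ((QSet.prodList Γ).H c)) :=
  ⨆ (β₂ : (QSet.dist.{u}).At) (β₁ : (QSet.dist.{u}).At) (_ : β₁.down + β₂.down = β.down),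
    loc x' y' c (conjSlice F (x'.atom c) (y'.atom c) β₁) ⊓
    loc x'' y'' c (conjSlice F (x''.atom c) (y''.atom c) β₂)

/-- The interpretation of the matrix of the triangle inequality. -/
noncomputable def trianglePred : Submodule ℂ (StrongDual ℂ ((QSet.prodList Γ).H c)) :=
  ⨆ (β : (QSet.dist.{u}).At) (α : (QSet.dist.{u}).At) (_ : α.down ≤ β.down),
    loc x y c (slice F (x.atom c) (y.atom c) α) ⊓ sumPred F y' y'' x' x'' c β

variable {F x y x' y' x'' y'' c}

theorem sumPred_induction {motive : StrongDual ℂ ((QSet.prodList Γ).H c) → Prop}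
    (zero : motive 0) (add : ∀ f g, motive f → motive g → motive (f + g))
    {β : (QSet.dist.{u}).At}
    (mem : ∀ β₁ β₂ : (QSet.dist.{u}).At, β₁.down + β₂.down = β.down → ∀ f,
      f ∈ loc x' y' c (conjSlice F (x'.atom c) (y'.atom c) β₁) →
      f ∈ loc x'' y'' c (conjSlice F (x''.atom c) (y''.atom c) β₂) → motive f)
    {f : StrongDual ℂ ((QSet.prodList Γ).H c)} (hf : f ∈ sumPred F y' y'' x' x'' c β) :
    motive f := by
  refine Submodule.iSup_induction _ (motive := motive) hf (fun β₂ f hf => ?_) zero add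
  refine Submodule.iSup_induction _ (motive := motive) hf (fun β₁ f hf => ?_) zero add
  refine Submodule.iSup_induction _ (motive := motive) hf (fun h f hf => ?_) zero add
  exact mem β₁ β₂ h f hf.1 hf.2

theorem trianglePred_induction {motive : StrongDual ℂ ((QSet.prodList Γ).H c) → Prop}
    (zero : motive 0) (add : ∀ f g, motive f → motive g → motive (f + g))
    (mem : ∀ β α : (QSet.dist.{u}).At, α.down ≤ β.down → ∀ f,
      f ∈ loc x y c (slice F (x.atom c) (y.atom c) α) →
      f ∈ sumPred F y' y'' x' x'' c β → motive f)
    {f : StrongDual ℂ ((QSet.prodList Γ).H c)}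
    (hf : f ∈ trianglePred F x y' y'' y x' x'' c) : motive f := by
  refine Submodule.iSup_induction _ (motive := motive) hf (fun β₂ f hf => ?_) zero add
  refine Submodule.iSup_induction _ (motive := motive) hf (fun β₁ f hf => ?_) zero add
  refine Submodule.iSup_induction _ (motive := motive) hf (fun h f hf => ?_) zero add
  exact mem β₂ β₁ h f hf.1 hf.2

theorem mem_trianglePred {α β₁ β₂ : (QSet.dist.{u}).At} (h : α.down ≤ β₁.down + β₂.down)
    {f : StrongDual ℂ ((QSet.prodList Γ).H c)}
    (h1 : f ∈ loc x y c (slice F (x.atom c) (y.atom c) α))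
    (h2 : f ∈ loc x' y' c (conjSlice F (x'.atom c) (y'.atom c) β₁))
    (h3 : f ∈ loc x'' y'' c (conjSlice F (x''.atom c) (y''.atom c) β₂)) :
    f ∈ trianglePred F x y' y'' y x' x'' c :=
  Submodule.mem_iSup_of_mem ⟨β₁.down + β₂.down⟩ (Submodule.mem_iSup_of_mem α
    (Submodule.mem_iSup_of_mem h ⟨h1, Submodule.mem_iSup_of_mem β₂ (Submodule.mem_iSup_of_mem β₁
      (Submodule.mem_iSup_of_mem rfl ⟨h2, h3⟩))⟩))

theorem interp_triangle_eq (h) :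
    (Formula.rel₂ (of₂ (BRel.ofRel (fun α β : ℝ≥0∞ => α ≤ β)).bend) (term F x y)
      (termAddConj (termConj F x' y') (termConj F x'' y'')) h).interp c =
      trianglePred F x y' y'' y x' x'' c :=
  interp_triangle F x y' y'' y x' x'' h c

end General

variable (a₁ a₂ a₃ : X.At)

/-- The tuple of atoms for three pairs of variables. -/
@[reducible] def atoms₃ : (QSet.prodList.{u} [X, X.dual, X, X.dual, X, X.dual]).At :=
  (a₃, (a₃, (a₂, (a₂, (a₁, (a₁, PUnit.unit))))))

/-- The predicate `E_X(x₁, x₁_*) ∧ E_X(x₂, x₂_*) ∧ E_X(x₃, x₃_*)`. -/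
noncomputable def evalThree :
    StrongDual ℂ ((QSet.prodList.{u} [X, X.dual, X, X.dual, X, X.dual]).H (atoms₃ a₁ a₂ a₃)) :=
  evalAt (Γ := [X, X.dual, X, X.dual]) (c := (a₂, (a₂, (a₁, (a₁, PUnit.unit))))) a₃
    (evalAt (Γ := [X, X.dual]) (c := (a₁, (a₁, PUnit.unit))) a₂
      (evalAt (Γ := []) (c := PUnit.unit) a₁ unitPred))

theorem isTrue_allDiag_three (φ : Formula [X, X.dual, X, X.dual, X, X.dual]) :
    (Formula.allDiag X (.allDiag X (.allDiag X φ))).IsTrue ↔ ∀ a₁ a₂ a₃ : X.At,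
      φ.interp.Holds (atoms₃ a₁ a₂ a₃) (evalThree a₁ a₂ a₃) := by
  refine isTrue_iff.trans ((allDiag_holds_iff (Γ := []) (X := X)
    (φ := (Formula.allDiag X (.allDiag X φ)).interp)).trans (forall_congr' fun a₁ => ?_))
  refine (allDiag_holds_iff (Γ := [X, X.dual]) (X := X)
    (φ := (Formula.allDiag X φ).interp)).trans (forall_congr' fun a₂ => ?_)
  exact allDiag_holds_iff (Γ := [X, X.dual, X, X.dual]) (X := X) (φ := φ.interp)

/-- The interpretation of the matrix of the sentence `triangle`. -/
noncomputable def triangleMatrix (F : BRel (X.prod X.dual) QSet.dist) :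
    QRel [X, X.dual, X, X.dual, X, X.dual] :=
  trianglePred F (Γ := [X, X.dual, X, X.dual, X, X.dual]) (.tail (.tail (.tail (.tail .head))))
    .head (.tail (.tail .head)) (.tail (.tail (.tail .head)))
    (.tail (.tail (.tail (.tail (.tail .head))))) (.tail .head)

theorem triangle_eq (F : BRel (X.prod X.dual) QSet.dist) : ∃ h, triangle F =
    .allDiag X (.allDiag X (.allDiag X (.rel₂ (of₂ (BRel.ofRel (fun α β : ℝ≥0∞ => α ≤ β)).bend)
      (term F (Γ := [X, X.dual, X, X.dual, X, X.dual]) (.tail (.tail (.tail (.tail .head))))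
        (.tail (.tail (.tail .head))))
      (termAddConj (termConj F (.tail (.tail (.tail (.tail (.tail .head))))) .head)
        (termConj F (.tail .head) (.tail (.tail .head)))) h))) := ⟨_, rfl⟩

theorem isTrue_triangle_iff_mem (F : BRel (X.prod X.dual) QSet.dist) :
    (triangle F).IsTrue ↔ ∀ a₁ a₂ a₃ : X.At,
      (triangleMatrix F).Holds (atoms₃ a₁ a₂ a₃) (evalThree a₁ a₂ a₃) := by
  obtain ⟨h, e⟩ := triangle_eq F
  rw [e]
  refine (isTrue_allDiag_three _).trans
    (forall_congr' fun a₁ => forall_congr' fun a₂ => forall_congr' fun a₃ => ?_)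
  exact Iff.of_eq (congrArg (fun φ => QRel.Holds φ (atoms₃ a₁ a₂ a₃) (evalThree a₁ a₂ a₃))
    (funext fun c => interp_triangle_eq (c := c) h))

theorem evalThree_tensor {a₁ a₂ a₃ : X.At}
    (z : Vecs [X, X.dual, X, X.dual, X, X.dual] (atoms₃ a₁ a₂ a₃)) :
    evalThree a₁ a₂ a₃ (Vecs.tensor _ _ z) =
      DualSpace.pairing (z.2.1 : DualSpace (X.H a₃)) (z.1 : X.H a₃) *
      (DualSpace.pairing (z.2.2.2.1 : DualSpace (X.H a₂)) (z.2.2.1 : X.H a₂) *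
        DualSpace.pairing (z.2.2.2.2.2.1 : DualSpace (X.H a₁)) (z.2.2.2.2.1 : X.H a₁)) := by
  refine (evalAt_tensor _ z).trans (congrArg _ ?_)
  refine (evalAt_tensor _ z.2.2).trans (congrArg _ ?_)
  exact (evalAt_tensor _ z.2.2.2.2).trans (mul_one _)

end DistanceFunction

/-- The functional `r(x₁ ⊗ ξ₂) s(ξ₁ ⊗ x₃) t(ξ₃ ⊗ x₂)`. -/
theorem StrongDual.exists_mul_three {A A' B B' C C' : Type}
    [NormedAddCommGroup A] [InnerProductSpace ℂ A] [FiniteDimensional ℂ A]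
    [NormedAddCommGroup A'] [InnerProductSpace ℂ A'] [FiniteDimensional ℂ A']
    [NormedAddCommGroup B] [InnerProductSpace ℂ B] [FiniteDimensional ℂ B]
    [NormedAddCommGroup B'] [InnerProductSpace ℂ B'] [FiniteDimensional ℂ B']
    [NormedAddCommGroup C] [InnerProductSpace ℂ C] [FiniteDimensional ℂ C]
    [NormedAddCommGroup C'] [InnerProductSpace ℂ C'] [FiniteDimensional ℂ C']
    (r : StrongDual ℂ (A ⊗[ℂ] B')) (s : StrongDual ℂ (A' ⊗[ℂ] C)) (t : StrongDual ℂ (C' ⊗[ℂ] B)) :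
    ∃ f : StrongDual ℂ (C ⊗[ℂ] (C' ⊗[ℂ] (B ⊗[ℂ] (B' ⊗[ℂ] (A ⊗[ℂ] (A' ⊗[ℂ] ℂ)))))),
      ∀ x₃ ξ₃ x₂ ξ₂ x₁ ξ₁, f (x₃ ⊗ₜ[ℂ] (ξ₃ ⊗ₜ[ℂ] (x₂ ⊗ₜ[ℂ] (ξ₂ ⊗ₜ[ℂ] (x₁ ⊗ₜ[ℂ]
        (ξ₁ ⊗ₜ[ℂ] (1 : ℂ))))))) = r (x₁ ⊗ₜ[ℂ] ξ₂) * (s (ξ₁ ⊗ₜ[ℂ] x₃) * t (ξ₃ ⊗ₜ[ℂ] x₂)) := by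
  obtain ⟨n, p, p', hr⟩ := StrongDual.exists_eq_sum_tmul r
  obtain ⟨m, q, q', hs⟩ := StrongDual.exists_eq_sum_tmul s
  obtain ⟨l, o, o', ht⟩ := StrongDual.exists_eq_sum_tmul t
  refine ⟨∑ i, ∑ j, ∑ k, StrongDual.tmul (q' j) (StrongDual.tmul (o k)
    (StrongDual.tmul (o' k) (StrongDual.tmul (p' i) (StrongDual.tmul (p i)
      (StrongDual.tmul (q j) (ContinuousLinearMap.id ℂ ℂ)))))), fun x₃ ξ₃ x₂ ξ₂ x₁ ξ₁ => ?_⟩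
  rw [hr, hs, ht, Finset.sum_mul_sum, Finset.sum_mul, sum_apply]
  refine Finset.sum_congr rfl fun i _ => ?_
  rw [Finset.mul_sum, sum_apply]
  refine Finset.sum_congr rfl fun j _ => ?_
  rw [Finset.mul_sum, sum_apply]
  refine Finset.sum_congr rfl fun k _ => ?_
  simp only [StrongDual.tmul_apply, ContinuousLinearMap.id_apply]
  ring

namespace QRel

variable {Γ : List QSet.{u}} {φ : QRel Γ} {c : (QSet.prodList Γ).At}

theorem Holds.zero : φ.Holds c 0 := (φ c).zero_mem

theorem Holds.add {f g : StrongDual ℂ ((QSet.prodList Γ).H c)} (hf : φ.Holds c f)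
    (hg : φ.Holds c g) : φ.Holds c (f + g) := (φ c).add_mem hf hg

theorem Holds.sum_of_eq {ι : Type*} [Fintype ι] {f : ι → StrongDual ℂ ((QSet.prodList Γ).H c)}
    (hf : ∀ i, φ.Holds c (f i)) {g : StrongDual ℂ ((QSet.prodList Γ).H c)}
    (hg : ∀ z, g (Vecs.tensor Γ c z) = ∑ i, f i (Vecs.tensor Γ c z)) : φ.Holds c g := by
  have : g = ∑ i, f i := Vecs.functional_ext fun z => by rw [hg, sum_apply]
  rw [this]
  exact (φ c).sum_mem fun i _ => hf i

end QRel

namespace DistanceFunction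
open QRel BRel Formula

variable {X : QSet.{u}} {a₁ a₂ a₃ : X.At}

/-- A tuple of vectors for three pairs of variables. -/
@[reducible] def vecs₃ (x₃ : X.H a₃) (ξ₃ : DualSpace (X.H a₃)) (x₂ : X.H a₂)
    (ξ₂ : DualSpace (X.H a₂)) (x₁ : X.H a₁) (ξ₁ : DualSpace (X.H a₁)) :
    Vecs [X, X.dual, X, X.dual, X, X.dual] (atoms₃ a₁ a₂ a₃) :=
  (x₃, (ξ₃, (x₂, (ξ₂, (x₁, (ξ₁, ()))))))

/-- The value of a functional at an elementary tensor. -/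
noncomputable def value₃ (f : StrongDual ℂ ((QSet.prodList.{u}
    [X, X.dual, X, X.dual, X, X.dual]).H (atoms₃ a₁ a₂ a₃)))
    (x₃ : X.H a₃) (ξ₃ : DualSpace (X.H a₃)) (x₂ : X.H a₂)
    (ξ₂ : DualSpace (X.H a₂)) (x₁ : X.H a₁) (ξ₁ : DualSpace (X.H a₁)) : ℂ :=
  f (Vecs.tensor _ _ (vecs₃ x₃ ξ₃ x₂ ξ₂ x₁ ξ₁))

theorem value₃_evalThree (x₃ : X.H a₃) (ξ₃ : DualSpace (X.H a₃)) (x₂ : X.H a₂)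
    (ξ₂ : DualSpace (X.H a₂)) (x₁ : X.H a₁) (ξ₁ : DualSpace (X.H a₁)) :
    value₃ (evalThree a₁ a₂ a₃) x₃ ξ₃ x₂ ξ₂ x₁ ξ₁ = DualSpace.pairing ξ₃ x₃ *
      (DualSpace.pairing ξ₂ x₂ * DualSpace.pairing ξ₁ x₁) :=
  evalThree_tensor (vecs₃ x₃ ξ₃ x₂ ξ₂ x₁ ξ₁)

/-- The functional `r(x₁ ⊗ ξ₂) s(ξ₁ ⊗ x₃) t(ξ₃ ⊗ x₂)`. -/
theorem exists_mul_three (r : StrongDual ℂ (X.H a₁ ⊗[ℂ] DualSpace (X.H a₂)))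
    (s : StrongDual ℂ (DualSpace (X.H a₁) ⊗[ℂ] X.H a₃))
    (t : StrongDual ℂ (DualSpace (X.H a₃) ⊗[ℂ] X.H a₂)) :
    ∃ f : StrongDual ℂ ((QSet.prodList.{u} [X, X.dual, X, X.dual, X, X.dual]).H (atoms₃ a₁ a₂ a₃)),
      ∀ x₃ ξ₃ x₂ ξ₂ x₁ ξ₁, value₃ f x₃ ξ₃ x₂ ξ₂ x₁ ξ₁ =
        r (x₁ ⊗ₜ[ℂ] ξ₂) * (s (ξ₁ ⊗ₜ[ℂ] x₃) * t (ξ₃ ⊗ₜ[ℂ] x₂)) := by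
  obtain ⟨f, hf⟩ := StrongDual.exists_mul_three r s t
  exact ⟨f, fun x₃ ξ₃ x₂ ξ₂ x₁ ξ₁ => hf x₃ ξ₃ x₂ ξ₂ x₁ ξ₁⟩

end DistanceFunction

namespace DistanceFunction
open QRel BRel Formula

variable {X : QSet.{u}} {a₁ a₂ a₃ : X.At} {F : BRel (X.prod X.dual) QSet.dist}

/-- The contraction of a functional with operators `u` and `v`. -/
noncomputable def contract₃ (u : X.H a₁ →L[ℂ] X.H a₃) (v : X.H a₃ →L[ℂ] X.H a₂)
    (f : StrongDual ℂ ((QSet.prodList.{u}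
      [X, X.dual, X, X.dual, X, X.dual]).H (atoms₃ a₁ a₂ a₃)))
    (x : X.H a₁) (ξ : DualSpace (X.H a₂)) : ℂ :=
  ∑ i, ∑ j, value₃ f (u (stdOrthonormalBasis ℂ (X.H a₁) i))
    (DualSpace.bra (stdOrthonormalBasis ℂ (X.H a₃) j)) (v (stdOrthonormalBasis ℂ (X.H a₃) j)) ξ x
    (DualSpace.bra (stdOrthonormalBasis ℂ (X.H a₁) i))

theorem contract₃_add (u : X.H a₁ →L[ℂ] X.H a₃) (v : X.H a₃ →L[ℂ] X.H a₂)
    (f g : StrongDual ℂ ((QSet.prodList.{u}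
      [X, X.dual, X, X.dual, X, X.dual]).H (atoms₃ a₁ a₂ a₃)))
    (x : X.H a₁) (ξ : DualSpace (X.H a₂)) :
    contract₃ u v (f + g) x ξ = contract₃ u v f x ξ + contract₃ u v g x ξ := by
  unfold contract₃
  rw [← Finset.sum_add_distrib]
  refine Finset.sum_congr rfl fun i _ => ?_
  rw [← Finset.sum_add_distrib]
  rfl

theorem contract₃_zero (u : X.H a₁ →L[ℂ] X.H a₃) (v : X.H a₃ →L[ℂ] X.H a₂)
    (x : X.H a₁) (ξ : DualSpace (X.H a₂)) : contract₃ u v 0 x ξ = 0 :=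
  Finset.sum_eq_zero fun _ _ => Finset.sum_eq_zero fun _ _ => rfl

/-- The sum is ∑ᵢⱼ ⟨fⱼ, u eᵢ⟩ ξ(v fⱼ) ⟨eᵢ, x⟩. The resolutions of the identity over j and then over
i collapse it to ξ(v u x). -/
theorem contract₃_evalThree (u : X.H a₁ →L[ℂ] X.H a₃) (v : X.H a₃ →L[ℂ] X.H a₂)
    (x : X.H a₁) (ξ : DualSpace (X.H a₂)) :
    contract₃ u v (evalThree a₁ a₂ a₃) x ξ = bendMap _ _ (v ∘L u) (x ⊗ₜ[ℂ] ξ) := by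
  unfold contract₃
  simp only [value₃_evalThree, DualSpace.pairing_bra]
  rw [bendMap_apply]
  refine Eq.trans (b := ∑ i, inner ℂ (stdOrthonormalBasis ℂ (X.H a₁) i) x *
    DualSpace.pairing ξ (v (u (stdOrthonormalBasis ℂ (X.H a₁) i)))) ?_ ?_
  · refine Finset.sum_congr rfl fun i _ => ?_
    conv_rhs => rw [← (stdOrthonormalBasis ℂ (X.H a₃)).sum_repr'
      (u (stdOrthonormalBasis ℂ (X.H a₁) i)), map_sum, ← DualSpace.pairingBilin_apply, map_sum,
      LinearMap.sum_apply, Finset.mul_sum]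
    refine Finset.sum_congr rfl fun j _ => ?_
    simp only [map_smul, LinearMap.smul_apply, DualSpace.pairingBilin_apply, smul_eq_mul]
    ring
  · conv_rhs => rw [← (stdOrthonormalBasis ℂ (X.H a₁)).sum_repr' x, map_sum,
      ← DualSpace.pairingBilin_apply, map_sum, LinearMap.sum_apply]
    simp

/-- The interpretation of the second argument of the triangle inequality. -/
noncomputable def sumMatrix (F : BRel (X.prod X.dual) QSet.dist) (β : (QSet.dist.{u}).At) :
    QRel [X, X.dual, X, X.dual, X, X.dual] := fun c =>
  sumPred F (Γ := [X, X.dual, X, X.dual, X, X.dual])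
    .head (.tail (.tail .head)) (.tail (.tail (.tail (.tail (.tail .head))))) (.tail .head) c β

/-- A summand carries distances with γ₁ + γ₂ ≠ β₁ + β₂, so γ₁ ≠ β₁ or γ₂ ≠ β₂. The contraction with
the corresponding one of u and v vanishes by orthogonality. -/
theorem contract₃_eq_zero (hF : IsDecomposition F) {β₁ β₂ : ℝ≥0∞} {u : X.H a₁ →L[ℂ] X.H a₃}
    {v : X.H a₃ →L[ℂ] X.H a₂} (hu : u ∈ component F β₁ a₁ a₃) (hv : v ∈ component F β₂ a₃ a₂)
    {β : (QSet.dist.{u}).At} (hβ : β₁ + β₂ ≠ β.down) {f : StrongDual ℂ ((QSet.prodList.{u}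
      [X, X.dual, X, X.dual, X, X.dual]).H (atoms₃ a₁ a₂ a₃))}
    (hf : (sumMatrix F β).Holds (atoms₃ a₁ a₂ a₃) f) (x : X.H a₁) (ξ : DualSpace (X.H a₂)) :
    contract₃ u v f x ξ = 0 := by
  let M : StrongDual ℂ ((QSet.prodList.{u}
      [X, X.dual, X, X.dual, X, X.dual]).H (atoms₃ a₁ a₂ a₃)) → Prop := fun f =>
    contract₃ u v f x ξ = 0
  have h0 : M 0 := contract₃_zero u v x ξ
  have hadd : ∀ f g, M f → M g → M (f + g) := fun f g h h' => by
    change contract₃ u v (f + g) x ξ = 0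
    rw [contract₃_add]
    exact (congrArg₂ (· + ·) h h').trans (add_zero 0)
  refine sumPred_induction (motive := M) h0 hadd (fun γ₁ γ₂ hγ f h1 h2 => ?_) hf
  change contract₃ u v f x ξ = 0
  by_cases hγ1 : (⟨β₁⟩ : (QSet.dist.{u}).At) = γ₁
  · have hγ2 : (⟨β₂⟩ : (QSet.dist.{u}).At) ≠ γ₂ := by
      rintro rfl; subst hγ1; exact hβ hγ
    unfold contract₃
    refine Finset.sum_eq_zero fun i _ => ?_
    obtain ⟨w, hw, h⟩ := exists_of_mem_loc h2 (by simp [Var.index])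
      (vecs₃ (u (stdOrthonormalBasis ℂ (X.H a₁) i)) 0 0 ξ x
        (DualSpace.bra (stdOrthonormalBasis ℂ (X.H a₁) i)))
    refine Eq.trans (Finset.sum_congr rfl fun j _ => ?_)
      (sum_conjSlice_eq_zero hF hγ2 hv hw)
    exact h _ _
  -- Here the first distance is wrong, so the sum over i, which contracts with u, has to be carried
  -- out first.
  · unfold contract₃
    rw [Finset.sum_comm]
    refine Finset.sum_eq_zero fun j _ => ?_
    obtain ⟨w, hw, h⟩ := exists_of_mem_loc h1 (by simp [Var.index])
      (vecs₃ 0 (DualSpace.bra (stdOrthonormalBasis ℂ (X.H a₃) j))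
        (v (stdOrthonormalBasis ℂ (X.H a₃) j)) ξ x 0)
    refine Eq.trans (Finset.sum_congr rfl fun i _ => ?_)
      (sum_conjSlice_eq_zero hF hγ1 hu hw)
    exact h _ _

/-- Contraction with u and v leaves only the summands whose intermediate distance β equals β₁ + β₂,
and in these the slices in (x₁, x₂_*) belong to components with α ≤ β. -/
theorem triangle_contract (hF : IsDecomposition F) {β₁ β₂ : ℝ≥0∞} {u : X.H a₁ →L[ℂ] X.H a₃}
    {v : X.H a₃ →L[ℂ] X.H a₂} (hu : u ∈ component F β₁ a₁ a₃) (hv : v ∈ component F β₂ a₃ a₂)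
    {f : StrongDual ℂ ((QSet.prodList.{u}
      [X, X.dual, X, X.dual, X, X.dual]).H (atoms₃ a₁ a₂ a₃))}
    (hf : (triangleMatrix F).Holds (atoms₃ a₁ a₂ a₃) f) :
    ∃ w ∈ ⨆ (α : ℝ≥0∞) (_ : α ≤ β₁ + β₂), slice F a₁ a₂ ⟨α⟩,
      ∀ x ξ, contract₃ u v f x ξ = w (x ⊗ₜ[ℂ] ξ) := by
  refine trianglePred_induction (motive := fun f : StrongDual ℂ ((QSet.prodList.{u}
      [X, X.dual, X, X.dual, X, X.dual]).H (atoms₃ a₁ a₂ a₃)) =>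
    ∃ w ∈ ⨆ (α : ℝ≥0∞) (_ : α ≤ β₁ + β₂), slice F a₁ a₂ ⟨α⟩,
      ∀ x ξ, contract₃ u v f x ξ = w (x ⊗ₜ[ℂ] ξ)) ?_ ?_ ?_ hf
  · exact ⟨0, Submodule.zero_mem _, fun x ξ => contract₃_zero u v x ξ⟩
  · rintro f g ⟨w, hw, h⟩ ⟨w', hw', h'⟩
    exact ⟨w + w', Submodule.add_mem _ hw hw', fun x ξ =>
      (contract₃_add u v f g x ξ).trans (congrArg₂ (· + ·) (h x ξ) (h' x ξ))⟩
  · intro β α hα f hf1 hf2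
    by_cases hβ : β₁ + β₂ = β.down
    · have := fun i j => exists_of_mem_loc hf1 (by simp [Var.index])
        (vecs₃ (u (stdOrthonormalBasis ℂ (X.H a₁) i))
          (DualSpace.bra (stdOrthonormalBasis ℂ (X.H a₃) j))
          (v (stdOrthonormalBasis ℂ (X.H a₃) j)) 0 0
          (DualSpace.bra (stdOrthonormalBasis ℂ (X.H a₁) i)))
      choose w hw h using this
      let w' : Fin (Module.finrank ℂ (X.H a₁)) → Fin (Module.finrank ℂ (X.H a₃)) →
        StrongDual ℂ (X.H a₁ ⊗[ℂ] DualSpace (X.H a₂)) := w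
      refine ⟨∑ i, ∑ j, w' i j, ?_, fun x ξ => ?_⟩
      · refine Submodule.mem_iSup_of_mem α.down (Submodule.mem_iSup_of_mem (hβ ▸ hα) ?_)
        exact Submodule.sum_mem _ fun i _ => Submodule.sum_mem _ fun j _ => hw i j
      · refine Eq.trans (Finset.sum_congr rfl fun i _ => ?_) (sum_apply _ _ _).symm
        exact (Finset.sum_congr rfl fun j _ => h i j x ξ).trans (sum_apply _ (w' i) _).symm
    · refine ⟨0, Submodule.zero_mem _, fun x ξ => ?_⟩
      exact contract₃_eq_zero hF hu hv hβ hf2 x ξ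

theorem mul_mul_comm_aux (a b c : ℂ) : a * (b * c) = a * c * b := by ring

/-- By linearity w may be taken in a single component. The product of w, s and t then has its slices
in each of the three pairs of variables proportional to one factor, and the intermediate distance is
β₁ + β₂. -/
theorem triangleMatrix_holds {β₁ β₂ : (QSet.dist.{u}).At}
    {w : StrongDual ℂ (X.H a₁ ⊗[ℂ] DualSpace (X.H a₂))}
    {s : StrongDual ℂ (DualSpace (X.H a₁) ⊗[ℂ] X.H a₃)}
    {t : StrongDual ℂ (DualSpace (X.H a₃) ⊗[ℂ] X.H a₂)}
    (hw : w ∈ ⨆ (α : ℝ≥0∞) (_ : α ≤ β₁.down + β₂.down), slice F a₁ a₂ ⟨α⟩)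
    (hs : s ∈ conjSlice F a₁ a₃ β₁) (ht : t ∈ conjSlice F a₃ a₂ β₂) :
    ∃ f, (triangleMatrix F).Holds (atoms₃ a₁ a₂ a₃) f ∧
      ∀ x₃ ξ₃ x₂ ξ₂ x₁ ξ₁, value₃ f x₃ ξ₃ x₂ ξ₂ x₁ ξ₁ =
        w (x₁ ⊗ₜ[ℂ] ξ₂) * (s (ξ₁ ⊗ₜ[ℂ] x₃) * t (ξ₃ ⊗ₜ[ℂ] x₂)) := by
  let M : StrongDual ℂ (X.H a₁ ⊗[ℂ] DualSpace (X.H a₂)) → Prop := fun w =>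
    ∃ f, (triangleMatrix F).Holds (atoms₃ a₁ a₂ a₃) f ∧
      ∀ x₃ ξ₃ x₂ ξ₂ x₁ ξ₁, value₃ f x₃ ξ₃ x₂ ξ₂ x₁ ξ₁ =
        w (x₁ ⊗ₜ[ℂ] ξ₂) * (s (ξ₁ ⊗ₜ[ℂ] x₃) * t (ξ₃ ⊗ₜ[ℂ] x₂))
  have h0 : M 0 := ⟨0, Holds.zero, fun x₃ ξ₃ x₂ ξ₂ x₁ ξ₁ => by
    rw [zero_apply, zero_mul]; rfl⟩
  have hadd : ∀ w w', M w → M w' → M (w + w') := by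
    rintro w w' ⟨f, hf, h⟩ ⟨f', hf', h'⟩
    refine ⟨f + f', hf.add hf', fun x₃ ξ₃ x₂ ξ₂ x₁ ξ₁ => ?_⟩
    rw [add_apply, add_mul, ← h, ← h']
    rfl
  refine Submodule.iSup_induction _ (motive := M) hw (fun α w hw => ?_) h0 hadd
  refine Submodule.iSup_induction _ (motive := M) hw (fun hα w hw => ?_) h0 hadd
  obtain ⟨f, hf⟩ := exists_mul_three w s t
  refine ⟨f, ?_, hf⟩
  refine mem_trianglePred (F := F) (c := atoms₃ a₁ a₂ a₃) (α := ⟨α⟩) (β₁ := β₁) (β₂ := β₂) hα ?_ ?_ ?_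
  · refine mem_loc_of_eq_mul (c := atoms₃ a₁ a₂ a₃) hw
      (fun z => s (z.2.2.2.2.2.1 ⊗ₜ[ℂ] z.1) * t (z.2.1 ⊗ₜ[ℂ] z.2.2.1))
      (fun x z h => ?_) fun z => (hf z.1 z.2.1 z.2.2.1 z.2.2.2.1 z.2.2.2.2.1 z.2.2.2.2.2.1).trans
        (mul_comm _ _)
    have h1 := h X .head (by simp [Var.index])
    have h2 := h X.dual (.tail .head) (by simp [Var.index])
    have h3 := h X (.tail (.tail .head)) (by simp [Var.index])
    have h4 := h X.dual (.tail (.tail (.tail (.tail (.tail .head))))) (by simp [Var.index])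
    exact congrArg₂ (· * ·) (congrArg₂ (fun a b => s (a ⊗ₜ[ℂ] b)) h4 h1)
      (congrArg₂ (fun a b => t (a ⊗ₜ[ℂ] b)) h2 h3)
  · refine mem_loc_of_eq_mul (c := atoms₃ a₁ a₂ a₃) hs
      (fun z => w (z.2.2.2.2.1 ⊗ₜ[ℂ] z.2.2.2.1) * t (z.2.1 ⊗ₜ[ℂ] z.2.2.1))
      (fun x z h => ?_) fun z => (hf z.1 z.2.1 z.2.2.1 z.2.2.2.1 z.2.2.2.2.1 z.2.2.2.2.2.1).trans
        (mul_mul_comm_aux _ _ _)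
    have h1 := h X (.tail (.tail (.tail (.tail .head)))) (by simp [Var.index])
    have h2 := h X.dual (.tail .head) (by simp [Var.index])
    have h3 := h X (.tail (.tail .head)) (by simp [Var.index])
    have h4 := h X.dual (.tail (.tail (.tail .head))) (by simp [Var.index])
    exact congrArg₂ (· * ·) (congrArg₂ (fun a b => w (a ⊗ₜ[ℂ] b)) h1 h4)
      (congrArg₂ (fun a b => t (a ⊗ₜ[ℂ] b)) h2 h3)
  · refine mem_loc_of_eq_mul (c := atoms₃ a₁ a₂ a₃) ht
      (fun z => w (z.2.2.2.2.1 ⊗ₜ[ℂ] z.2.2.2.1) * s (z.2.2.2.2.2.1 ⊗ₜ[ℂ] z.1))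
      (fun x z h => ?_) fun z => (hf z.1 z.2.1 z.2.2.1 z.2.2.2.1 z.2.2.2.2.1 z.2.2.2.2.2.1).trans
        (mul_assoc _ _ _).symm
    have h1 := h X (.tail (.tail (.tail (.tail .head)))) (by simp [Var.index])
    have h2 := h X.dual (.tail (.tail (.tail (.tail (.tail .head))))) (by simp [Var.index])
    have h3 := h X .head (by simp [Var.index])
    have h4 := h X.dual (.tail (.tail (.tail .head))) (by simp [Var.index])
    exact congrArg₂ (· * ·) (congrArg₂ (fun a b => w (a ⊗ₜ[ℂ] b)) h1 h4)
      (congrArg₂ (fun a b => s (a ⊗ₜ[ℂ] b)) h2 h3)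

end DistanceFunction

-- Composition of components, and separation

theorem Submodule.comap_iSup_of_bijective {V W : Type*} [AddCommGroup V] [Module ℂ V]
    [AddCommGroup W] [Module ℂ W] {B : V →ₗ[ℂ] W} (hB : Function.Bijective B) {ι : Sort*}
    (P : ι → Submodule ℂ W) : (⨆ i, P i).comap B = ⨆ i, (P i).comap B := by
  let e := LinearEquiv.ofBijective B hB
  have h : ∀ Q : Submodule ℂ W, Q.comap B = Q.map (e.symm : W →ₗ[ℂ] V) := fun Q =>
    Submodule.comap_equiv_eq_map_symm e Q
  simp only [h, Submodule.map_iSup]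

/-- The Sasaki arrow is total only for an inclusion, by modus ponens. For an inclusion, E ⊓ P is E,
and E meets its orthocomplement trivially. -/
theorem Submodule.orthogonal_inf_orthogonal_eq_top_iff {V : Type*} [NormedAddCommGroup V]
    [InnerProductSpace ℂ V] [FiniteDimensional ℂ V] (E P : Submodule ℂ V) :
    (E ⊓ (E ⊓ P)ᗮ)ᗮ = ⊤ ↔ E ≤ P := by
  constructor
  · intro h v hv
    exact QRel.mem_of_mem_imp hv (h ▸ Submodule.mem_top)
  · intro h
    rw [inf_eq_left.2 h, Submodule.inf_orthogonal_eq_bot, Submodule.bot_orthogonal_eq_top]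

section

variable {H K : Type} [NormedAddCommGroup H] [InnerProductSpace ℂ H] [FiniteDimensional ℂ H]
  [NormedAddCommGroup K] [InnerProductSpace ℂ K] [FiniteDimensional ℂ K]

theorem BRel.bendMap_bijective : Function.Bijective (BRel.bendMap H K) :=
  ⟨BRel.bendMap_injective H K, BRel.bendMap_surjective⟩

theorem StrongDual.exists_swap (r : StrongDual ℂ (H ⊗[ℂ] K)) :
    ∃ f : StrongDual ℂ (K ⊗[ℂ] (H ⊗[ℂ] ℂ)), ∀ x y, f (y ⊗ₜ[ℂ] (x ⊗ₜ[ℂ] (1 : ℂ))) = r (x ⊗ₜ[ℂ] y) := by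
  obtain ⟨n, p, q, hr⟩ := StrongDual.exists_eq_sum_tmul r
  refine ⟨∑ i, StrongDual.tmul (q i) (StrongDual.tmul (p i) (ContinuousLinearMap.id ℂ ℂ)),
    fun x y => ?_⟩
  rw [hr, sum_apply]
  refine Finset.sum_congr rfl fun i _ => ?_
  simp only [StrongDual.tmul_apply, ContinuousLinearMap.id_apply]
  ring

theorem StrongDual.eq_top_of_tmul_mem {S : Submodule ℂ (StrongDual ℂ (K ⊗[ℂ] (H ⊗[ℂ] ℂ)))}
    (h : ∀ (η : StrongDual ℂ K) (ξ : StrongDual ℂ H),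
      StrongDual.tmul η (StrongDual.tmul ξ (ContinuousLinearMap.id ℂ ℂ)) ∈ S) : S = ⊤ := by
  refine eq_top_iff.2 fun f _ => ?_
  obtain ⟨n, p, q, hf⟩ := StrongDual.exists_eq_sum_tmul f
  obtain ⟨hq⟩ : Nonempty (∀ i, ∃ ξ : StrongDual ℂ H, q i =
      StrongDual.tmul ξ (ContinuousLinearMap.id ℂ ℂ)) := ⟨fun i =>
    ⟨LinearMap.toContinuousLinearMap ((q i : H ⊗[ℂ] ℂ →ₗ[ℂ] ℂ) ∘ₗ
      (TensorProduct.mk ℂ H ℂ).flip 1), StrongDual.tensor_ext fun x t => by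
        have : x ⊗ₜ[ℂ] t = t • (x ⊗ₜ[ℂ] (1 : ℂ)) := by
          rw [← TensorProduct.tmul_smul, smul_eq_mul, mul_one]
        rw [StrongDual.tmul_apply, this, map_smul]
        exact mul_comm _ _⟩⟩
  choose ξ hξ using hq
  have : f = ∑ i, StrongDual.tmul (p i) (StrongDual.tmul (ξ i) (ContinuousLinearMap.id ℂ ℂ)) := by
    refine StrongDual.tensor_ext fun x y => ?_
    rw [hf, sum_apply]
    exact Finset.sum_congr rfl fun i _ => by rw [hξ, StrongDual.tmul_apply]
  rw [this]
  exact S.sum_mem fun i _ => h _ _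

end

theorem QRel.imp_eq_top_iff {Γ : List QSet.{u}} (E P : QRel Γ) (c : (QSet.prodList Γ).At) :
    imp E P c = ⊤ ↔ ∀ f, E.Holds c f → P.Holds c f := by
  rw [imp_apply, Submodule.orthogonal_inf_orthogonal_eq_top_iff]
  rfl

theorem QRel.atomic_of₂ {Γ : List QSet.{u}} {X Y : QSet.{u}} (v : Var Γ X) (w : Var Γ Y)
    (P : BRel (X.prod Y) QSet.one) (c : (QSet.prodList Γ).At) :
    atomic (of₂ P) (.cons v (.cons w .nil)) c = loc v w c (P (v.atom c, w.atom c) PUnit.unit) := by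
  ext f
  rw [mem_atomic]
  refine forall_congr' fun x => ⟨?_, ?_⟩
  · rintro ⟨r, hr, h⟩
    obtain ⟨g, hg, hgr⟩ := mem_of₂.1 hr
    exact ⟨g, hg, fun z hz => (h z hz).trans (hgr _ _)⟩
  · rintro ⟨g, hg, h⟩
    obtain ⟨r, hr⟩ := exists_of₂ g
    exact ⟨r, mem_of₂.2 ⟨g, hg, hr⟩, fun z hz => (h z hz).trans (hr _ _).symm⟩

namespace DistanceFunction
open QRel BRel Formula

variable {X : QSet.{u}} {a₁ a₂ a₃ : X.At} {F : BRel (X.prod X.dual) QSet.dist}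

theorem comap_iSup_slice (F : BRel (X.prod X.dual) QSet.dist) (p : ℝ≥0∞ → Prop) (a b : X.At) :
    (⨆ (α : ℝ≥0∞) (_ : p α), slice F a b ⟨α⟩).comap (bendMap (X.H a) (X.H b)) =
      ⨆ (α : ℝ≥0∞) (_ : p α), component F α a b := by
  refine (Submodule.comap_iSup_of_bijective (B := bendMap (X.H a) (X.H b)) bendMap_bijective
    fun α => ⨆ _ : p α, slice F a b ⟨α⟩).trans (iSup_congr fun α => ?_)
  exact Submodule.comap_iSup_of_bijective (B := bendMap (X.H a) (X.H b)) bendMap_bijective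
    fun _ : p α => slice F a b ⟨α⟩

theorem isTrue_triangle (hF : IsDecomposition F) :
    (triangle F).IsTrue ↔ ∀ (β₁ β₂ : ℝ≥0∞) (a b c : X.At), ∀ u ∈ component F β₁ a c,
      ∀ v ∈ component F β₂ c b, v ∘L u ∈ ⨆ (α : ℝ≥0∞) (_ : α ≤ β₁ + β₂), component F α a b := by
  rw [isTrue_triangle_iff_mem]
  constructor
  · intro h β₁ β₂ a b c u hu v hv
    obtain ⟨w, hw, hwx⟩ := triangle_contract hF hu hv (h a b c)
    have : bendMap _ _ (v ∘L u) = w := StrongDual.tensor_ext fun x ξ => by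
      rw [← hwx, contract₃_evalThree]
    rw [← comap_iSup_slice F (fun α => α ≤ β₁ + β₂), Submodule.mem_comap, this]
    exact hw
  · intro h a₁ a₂ a₃
    -- Two adapted bases expand the product of the three evaluations as the sum over k and l of
    -- bend(v_l u_k)(x₁ ⊗ ξ₂) · s_k(ξ₁ ⊗ x₃) · t_l(ξ₃ ⊗ x₂), where s_k and t_l are the conjugates of
    -- the bends of u_k and v_l. The hypothesis on v_l u_k places each term in the predicate.
    obtain ⟨n, e, u, α, hu⟩ := hF.exists_basis a₁ a₃
    obtain ⟨m, d, v, β, hv⟩ := hF.exists_basis a₃ a₂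
    choose s hs hs' using fun k => mem_conjSlice_of_component (hu k).2
    choose t ht ht' using fun k => mem_conjSlice_of_component (hv k).2
    have hw : ∀ k l, bendMap _ _ (v l ∘L u k) ∈ ⨆ (γ : ℝ≥0∞) (_ : γ ≤ α k + β l),
        slice F a₁ a₂ ⟨γ⟩ := fun k l => by
      have := h _ _ _ _ _ _ (hu k).2 _ (hv l).2
      rw [← comap_iSup_slice F (fun γ => γ ≤ α k + β l)] at this
      exact this
    choose f hf hfv using fun kl : Fin n × Fin m =>
      triangleMatrix_holds (β₁ := ⟨α kl.1⟩) (β₂ := ⟨β kl.2⟩) (hw kl.1 kl.2) (hs kl.1) (ht kl.2)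
    refine Holds.sum_of_eq hf fun z => ?_
    refine (evalThree_tensor z).trans ?_
    refine Eq.trans ?_ (Finset.sum_congr rfl fun kl _ =>
      (hfv kl z.1 z.2.1 z.2.2.1 z.2.2.2.1 z.2.2.2.2.1 z.2.2.2.2.2.1).symm)
    obtain ⟨x₃, ξ₃, x₂, ξ₂, x₁, ξ₁, _⟩ := z
    change DualSpace.pairing (ξ₃ : DualSpace (X.H a₃)) (x₃ : X.H a₃) *
      (DualSpace.pairing (ξ₂ : DualSpace (X.H a₂)) (x₂ : X.H a₂) *
        DualSpace.pairing (ξ₁ : DualSpace (X.H a₁)) (x₁ : X.H a₁)) =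
      ∑ kl : Fin n × Fin m, bendMap _ _ (v kl.2 ∘L u kl.1) (x₁ ⊗ₜ[ℂ] ξ₂) *
        (s kl.1 (ξ₁ ⊗ₜ[ℂ] x₃) * t kl.2 (ξ₃ ⊗ₜ[ℂ] x₂))
    obtain ⟨p, rfl⟩ := DualSpace.exists_bra ξ₁
    obtain ⟨q, rfl⟩ := DualSpace.exists_bra ξ₃
    obtain ⟨o, rfl⟩ := DualSpace.exists_bra ξ₂
    simp only [hs', ht', bendMap_apply, DualSpace.pairing_bra, ContinuousLinearMap.comp_apply,
      Fintype.sum_prod_type]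
    -- Parseval's identity for the v_l at the vector u_k x₁ carries out the sum over l; the one for
    -- the u_k then carries out the sum over k.
    have h1 := fun y => sum_inner_smul d v (fun k => (hv k).1) q x₂ y
    have h2 := sum_inner_smul e u (fun k => (hu k).1) p x₃ x₁
    have h3 : ∀ k, ∑ l, inner ℂ o (v l (u k x₁)) * (inner ℂ (u k p) x₃ * inner ℂ (v l q) x₂) =
        inner ℂ q ((inner ℂ (u k p) x₃ : ℂ) • u k x₁) * inner ℂ o x₂ := fun k => by
      have := congrArg (inner ℂ o) (h1 (u k x₁))
      rw [inner_sum, inner_smul_right] at this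
      rw [inner_smul_right, mul_assoc, ← this, Finset.mul_sum]
      refine Finset.sum_congr rfl fun l _ => ?_
      rw [inner_smul_right]
      ring
    rw [Finset.sum_congr rfl fun k _ => h3 k, ← Finset.sum_mul, ← inner_sum, h2, inner_smul_right]
    ring

theorem separation_eq (F : BRel (X.prod X.dual) QSet.dist) : ∃ h h', separation F =
    .all X (.all X.dual (.imp
      (.rel₂ (equality QSet.dist) (term F (Γ := [X.dual, X]) (.tail .head) .head) termZeroConj h)
      (.rel₂ (equality X) (.var (.tail .head)) (.var .head) h'))) := ⟨_, _, rfl⟩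

/-- Here the quantifiers carry no equality guard. Product functionals span all predicates, so truth
means that the matrix is total at every pair of atoms. -/
theorem isTrue_all_all (φ : Formula [X.dual, X]) :
    (Formula.all X (.all X.dual φ)).IsTrue ↔
      ∀ a b : X.At, φ.interp (b, (a, PUnit.unit)) = ⊤ := by
  refine isTrue_iff.trans ((mem_all (Γ := []) (X := X)
    (φ := (Formula.all X.dual φ).interp)).trans (forall_congr' fun a => ?_))
  constructor
  · intro h b
    refine StrongDual.eq_top_of_tmul_mem (K := DualSpace (X.H b)) (H := X.H a) fun η ξ => ?_
    exact (mem_all (Γ := [X]) (X := X.dual) (φ := φ.interp)).1 (h ξ) b η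
  · intro h ξ
    refine (mem_all (Γ := [X]) (X := X.dual) (φ := φ.interp)).2 fun b η => ?_
    exact (h b).symm ▸ Submodule.mem_top

theorem mem_locRel_separation {F : BRel (X.prod X.dual) QSet.dist} {a b : X.At}
    (f : StrongDual ℂ ((QSet.prodList.{u} [X.dual, X]).H (b, (a, PUnit.unit)))) :
    f ∈ locRel (Γ := [X.dual, X]) (.tail .head) .head (fun c => slice F c.2.1 c.1 ⟨0⟩)
      (b, (a, PUnit.unit)) ↔ ∃ r ∈ component F 0 a b,
        ∀ x ξ, f (ξ ⊗ₜ[ℂ] (x ⊗ₜ[ℂ] (1 : ℂ))) = bendMap (X.H a) (X.H b) r (x ⊗ₜ[ℂ] ξ) := by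
  constructor
  · intro h
    obtain ⟨w, hw, hwf⟩ := exists_of_mem_loc h (by simp [Var.index])
      ((0 : DualSpace (X.H b)), ((0 : X.H a), ()))
    obtain ⟨r, hr, rfl⟩ := exists_component hw
    exact ⟨r, hr, hwf⟩
  · rintro ⟨r, hr, h⟩
    refine mem_loc_of_eq_mul (Γ := [X.dual, X]) (c := (b, (a, PUnit.unit))) (vx := .tail .head)
      (vy := .head) hr (fun _ => 1) (fun _ _ _ => rfl)
      fun z => (h z.2.1 z.1).trans (one_mul _).symm

theorem eval_iff {a b : X.At} {u} {g : StrongDual ℂ (X.H a ⊗[ℂ] DualSpace (X.H b))} :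
    g ∈ eval X (a, b) u ↔ ∃ r ∈ BRel.id X a b, g = bendMap _ _ r := by
  by_cases hab : a = b
  · subst hab
    refine mem_eval_self.trans ⟨fun ⟨t, ht⟩ => ⟨t • ContinuousLinearMap.id ℂ _,
      mem_id_self.2 ⟨t, fun x => rfl⟩, StrongDual.tensor_ext fun x ξ => ?_⟩, ?_⟩
    · rw [map_smul, smul_apply, bendMap_apply]
      exact ht x ξ
    · rintro ⟨r, hr, rfl⟩
      obtain ⟨t, ht⟩ := mem_id_self.1 hr
      refine ⟨t, fun x ξ => ?_⟩
      rw [bendMap_apply, ht, ← DualSpace.pairingBilin_apply, map_smul]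
      rfl
  · rw [eval_of_ne hab, id_of_ne hab]
    constructor
    · intro h
      exact ⟨0, Submodule.zero_mem _, by rw [map_zero]; exact (Submodule.mem_bot ℂ).1 h⟩
    · rintro ⟨r, hr, rfl⟩
      rw [(Submodule.mem_bot ℂ).1 hr, map_zero]
      exact Submodule.zero_mem _

theorem mem_eqAtom_separation {a b : X.At}
    (f : StrongDual ℂ ((QSet.prodList.{u} [X.dual, X]).H (b, (a, PUnit.unit)))) :
    f ∈ eqAtom (Γ := [X.dual, X]) (.tail .head) .head (b, (a, PUnit.unit)) ↔
      ∃ r ∈ BRel.id X a b,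
        ∀ x ξ, f (ξ ⊗ₜ[ℂ] (x ⊗ₜ[ℂ] (1 : ℂ))) = bendMap (X.H a) (X.H b) r (x ⊗ₜ[ℂ] ξ) := by
  refine (Iff.of_eq (congrArg (f ∈ ·)
    (atomic_of₂ (Γ := [X.dual, X]) (.tail .head) .head (eval X) (b, (a, PUnit.unit))))).trans ?_
  constructor
  · intro h
    obtain ⟨w, hw, hwf⟩ := exists_of_mem_loc h (by simp [Var.index])
      ((0 : DualSpace (X.H b)), ((0 : X.H a), ()))
    obtain ⟨r, hr, rfl⟩ := eval_iff.1 hw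
    exact ⟨r, hr, hwf⟩
  · rintro ⟨r, hr, h⟩
    refine mem_loc_of_eq_mul (Γ := [X.dual, X]) (c := (b, (a, PUnit.unit))) (vx := .tail .head)
      (vy := .head) (eval_iff.2 ⟨r, hr, rfl⟩) (fun _ => 1) (fun _ _ _ => rfl)
      fun z => (h z.2.1 z.1).trans (one_mul _).symm

/-- Premise and conclusion are, with the two factors exchanged, the bends of R_0 and of the identity
relation. A Sasaki arrow is total exactly for an inclusion, and bending is injective. -/
theorem isTrue_separation (F : BRel (X.prod X.dual) QSet.dist) :
    (separation F).IsTrue ↔ ∀ a b, component F 0 a b ≤ BRel.id X a b := by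
  obtain ⟨h, h', e⟩ := separation_eq F
  rw [e]
  refine (isTrue_all_all _).trans (forall_congr' fun a => forall_congr' fun b => ?_)
  have e1 : (Formula.rel₂ (equality QSet.dist) (term F (Γ := [X.dual, X]) (.tail .head) .head)
      termZeroConj h).interp =
      locRel (Γ := [X.dual, X]) (.tail .head) .head (fun c => slice F c.2.1 c.1 ⟨0⟩) :=
    interp_zeroDistance F _ _ h
  have e2 : (Formula.rel₂ (equality X) (.var (.tail .head)) (.var .head) h').interp =
      eqAtom (Γ := [X.dual, X]) (.tail .head) .head := rfl
  refine (imp_eq_top_iff _ _ _).trans ?_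
  rw [e1, e2]
  constructor
  · intro hle r hr
    obtain ⟨f, hf⟩ := StrongDual.exists_swap (bendMap (X.H a) (X.H b) r)
    obtain ⟨s, hs, hfs⟩ := (mem_eqAtom_separation f).1
      (hle f ((mem_locRel_separation f).2 ⟨r, hr, hf⟩))
    have : r = s := bendMap_injective _ _ (StrongDual.tensor_ext fun x ξ => by
      rw [← hf, hfs])
    exact this ▸ hs
  · intro hle f hf
    obtain ⟨r, hr, hrf⟩ := (mem_locRel_separation f).1 hf
    exact (mem_eqAtom_separation f).2 ⟨r, hle hr, hrf⟩

end DistanceFunction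

-- Functions into an ordinary set as orthogonal decompositions

namespace BRel

variable {X Y : QSet.{u}}

theorem mem_dagger {R : BRel X Y} {a : X.At} {b : Y.At} {f : Y.H b →L[ℂ] X.H a} :
    f ∈ R.dagger b a ↔ ∃ r ∈ R a b, f = ContinuousLinearMap.adjoint r := by
  refine Submodule.mem_span_of_rel ?_ ?_ ?_
  · rw [map_zero]
  · rintro g g' _ _ rfl rfl
    rw [map_add]
  · rintro c g _ rfl
    exact ⟨star c, by rw [map_smulₛₗ]; simp⟩

/-- Since f and g have values in ℂ, the operator g f† is a scalar, namely their inner product. So F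
∘ F† ≤ I is the orthogonality of different components. -/
theorem comp_adjoint_apply {H : Type} [NormedAddCommGroup H] [InnerProductSpace ℂ H]
    [FiniteDimensional ℂ H] (f g : H →L[ℂ] ℂ) :
    g (ContinuousLinearMap.adjoint f 1) = inner ℂ (f : StrongDual ℂ H) g := by
  rw [StrongDual.inner_eq_apply_symm]
  congr 1
  refine ext_inner_left ℂ fun y => ?_
  rw [ContinuousLinearMap.adjoint_inner_right, ← inner_conj_symm,
    ← inner_conj_symm y ((InnerProductSpace.toDual ℂ H).symm f),
    InnerProductSpace.toDual_symm_apply]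
  simp

variable {A : Type} (F : BRel X (QSet.ofSet.{u} A))

/-- The components of a relation with values in an ordinary set. -/
abbrev level (b : X.At) (α : (QSet.ofSet.{u} A).At) : Submodule ℂ (StrongDual ℂ (X.H b)) := F b α

theorem comp_dagger_le_iff : F.comp F.dagger ≤ id (QSet.ofSet A) ↔
    ∀ b α β, α ≠ β → ∀ f ∈ F b α, ∀ g ∈ F b β,
      inner ℂ (f : StrongDual ℂ (X.H b)) (g : StrongDual ℂ (X.H b)) = 0 := by
  constructor
  · intro h b α β hαβ f hf g hg
    have h1 : g ∘L ContinuousLinearMap.adjoint f ∈ id (QSet.ofSet A) α β :=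
      h α β (Submodule.subset_span ⟨b, g, hg, _, mem_dagger.2 ⟨f, hf, rfl⟩, rfl⟩)
    rw [id_of_ne hαβ, Submodule.mem_bot] at h1
    rw [← comp_adjoint_apply]
    exact DFunLike.congr_fun h1 (1 : ℂ)
  · intro h α β
    refine Submodule.span_le.2 ?_
    rintro _ ⟨b, g, hg, r, hr, rfl⟩
    obtain ⟨f, hf, rfl⟩ := mem_dagger.1 hr
    by_cases hαβ : α = β
    · subst hαβ
      refine mem_id_self.2 ⟨g (ContinuousLinearMap.adjoint f (1 : ℂ)), fun x => ?_⟩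
      have : x = x • (1 : ℂ) := (mul_one x).symm
      conv_lhs => rw [this]
      rw [map_smul, smul_eq_mul, smul_eq_mul, mul_comm]
      rfl
    · have h1 := h b α β hαβ f hf g hg
      rw [← comp_adjoint_apply] at h1
      have : g ∘L ContinuousLinearMap.adjoint f = 0 := ContinuousLinearMap.ext_ring h1
      rw [this]
      exact Submodule.zero_mem _

/-- The identity is a sum of operators s r with r in some component at α. Following each by f gives
f(s(1)) · r, so f is a sum of elements of the components. -/
theorem iSup_eq_top_of_le_comp (h : id X ≤ F.dagger.comp F) (b : X.At) :
    ⨆ α, F.level b α = ⊤ := by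
  refine eq_top_iff.2 fun f _ => ?_
  have h1 := h b b (mem_id_self.2 ⟨1, fun x => (one_smul ℂ x).symm⟩ :
    ContinuousLinearMap.id ℂ (X.H b) ∈ id X b b)
  have key : ∀ t ∈ F.dagger.comp F b b, (f ∘L t : StrongDual ℂ (X.H b)) ∈
      ⨆ α, F.level b α := by
    intro t ht
    refine Submodule.span_induction (p := fun t _ => (f ∘L t : StrongDual ℂ (X.H b)) ∈
      ⨆ α, F.level b α) ?_ ?_ ?_ ?_ ht
    · rintro _ ⟨α, s, hs, r, hr, rfl⟩
      refine Submodule.mem_iSup_of_mem α ?_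
      have : f ∘L s ∘L r = f (s (1 : ℂ)) • r := ContinuousLinearMap.ext fun x => by
        have hx : r x = r x • (1 : ℂ) := (mul_one _).symm
        change f (s (r x)) = f (s (1 : ℂ)) * r x
        conv_lhs => rw [hx]
        rw [map_smul, map_smul, smul_eq_mul, mul_comm]
      rw [this]
      exact Submodule.smul_mem _ _ hr
    · rw [ContinuousLinearMap.comp_zero]; exact Submodule.zero_mem _
    · intro s t _ _ hs ht
      rw [ContinuousLinearMap.comp_add]; exact Submodule.add_mem _ hs ht
    · intro c s _ hs
      rw [ContinuousLinearMap.comp_smul]; exact Submodule.smul_mem _ _ hs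
  exact key _ h1

theorem isFunction_iff : F.IsFunction ↔ (∀ b α β, α ≠ β → ∀ f ∈ F b α, ∀ g ∈ F b β,
      inner ℂ (f : StrongDual ℂ (X.H b)) (g : StrongDual ℂ (X.H b)) = 0) ∧
    ∀ b, ⨆ α, F.level b α = ⊤ := by
  constructor
  · rintro ⟨h1, h2⟩
    exact ⟨(comp_dagger_le_iff F).1 h1, iSup_eq_top_of_le_comp F h2⟩
  · rintro ⟨h1, h2⟩
    refine ⟨(comp_dagger_le_iff F).2 h1, fun b b' => ?_⟩
    refine Submodule.span_le.2 ?_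
    rintro f ⟨rfl, hf⟩
    obtain ⟨n, e, α, he⟩ := exists_orthonormalBasis_of_iSup_eq_top
      (fun α => F.level b α) (h1 b) (h2 b)
    -- The expansion of the functional ⟨y| in the adapted basis is the resolution of the identity ∑ₖ
    -- eₖ† eₖ = 1, whose terms belong to F† ∘ F.
    have key : f = ∑ k, (ContinuousLinearMap.adjoint (e k : X.H b →L[ℂ] ℂ) ∘L e k) := by
      ext x
      rw [hf, sum_apply]
      refine ext_inner_left ℂ fun y => ?_
      let g : StrongDual ℂ (X.H b) := innerSL ℂ y
      have hg := congrArg (fun g : StrongDual ℂ (X.H b) => g x) (e.sum_repr' g)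
      simp only [sum_apply, smul_apply, ← comp_adjoint_apply] at hg
      refine hg.symm.trans ?_
      rw [inner_sum]
      refine Finset.sum_congr rfl fun k _ => ?_
      change inner ℂ y (ContinuousLinearMap.adjoint (e k : X.H b →L[ℂ] ℂ) 1) * e k x = inner ℂ y
        (ContinuousLinearMap.adjoint (e k : X.H b →L[ℂ] ℂ) (e k x))
      have hx : e k x = e k x • (1 : ℂ) := (mul_one _).symm
      conv_rhs => rw [hx]
      rw [map_smul, inner_smul_right, mul_comm]
    rw [key]
    exact Submodule.sum_mem _ fun k _ => Submodule.subset_span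
      ⟨α k, _, mem_dagger.2 ⟨e k, he k, rfl⟩, e k, he k, rfl⟩

end BRel

namespace DistanceFunction
open BRel

variable {X : QSet.{u}}

theorem isFunction_iff_isDecomposition (F : BRel (X.prod X.dual) QSet.dist) :
    F.IsFunction ↔ IsDecomposition F :=
  (isFunction_iff F).trans ⟨fun h => ⟨fun a b => h.1 (a, b), fun a b => h.2 (a, b)⟩,
    fun h => ⟨fun ab => h.1 ab.1 ab.2, fun ab => h.2 ab.1 ab.2⟩⟩

theorem comp_dagger_ofElem (F : BRel (X.prod X.dual) QSet.dist) (α : ℝ≥0∞) (ab : (X.prod X.dual).At)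
    (u : QSet.one.At) : (ofElem α).dagger.comp F ab u = slice F ab.1 ab.2 ⟨α⟩ := by
  refine le_antisymm (Submodule.span_le.2 ?_) fun f hf => ?_
  · rintro _ ⟨β, s, hs, r, hr, rfl⟩
    obtain ⟨t, ht, rfl⟩ := mem_dagger.1 hs
    by_cases hβ : β = ⟨α⟩
    · subst hβ
      have : (ContinuousLinearMap.adjoint t ∘L r : StrongDual ℂ (X.H ab.1 ⊗[ℂ] DualSpace (X.H ab.2)))
          = (ContinuousLinearMap.adjoint t (1 : ℂ) : ℂ) • r := ContinuousLinearMap.ext fun x => by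
        have hx : r x = r x • (1 : ℂ) := (mul_one _).symm
        change ContinuousLinearMap.adjoint t (r x) = ContinuousLinearMap.adjoint t (1 : ℂ) * r x
        conv_lhs => rw [hx]
        rw [map_smul, smul_eq_mul, mul_comm]
      change (ContinuousLinearMap.adjoint t ∘L r : StrongDual ℂ
        (X.H ab.1 ⊗[ℂ] DualSpace (X.H ab.2))) ∈ _
      rw [this]
      exact Submodule.smul_mem _ _ hr
    · have ht0 : t = 0 := by
        rw [ofElem, iSup_neg fun h => hβ (by rw [h])] at ht
        exact (Submodule.mem_bot ℂ).1 ht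
      rw [ht0, map_zero, ContinuousLinearMap.zero_comp]
      exact Submodule.zero_mem _
  · refine Submodule.subset_span ⟨⟨α⟩, ContinuousLinearMap.id ℂ ℂ, mem_dagger.2
      ⟨ContinuousLinearMap.id ℂ ℂ, ?_, ContinuousLinearMap.adjoint_id.symm⟩, f, hf, rfl⟩
    rw [ofElem, iSup_pos rfl]
    exact Submodule.mem_top

/-- Bending is injective, so the relations R_α in the definition of the correspondence exist and are
unique. -/
theorem bend_eq_iff (F : BRel (X.prod X.dual) QSet.dist) (α : ℝ≥0∞) (R : BRel X X) :
    R.bend = (ofElem α).dagger.comp F ↔ R = component F α := by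
  constructor
  · intro h
    funext a b
    ext r
    have h1 := congrFun (congrFun h (a, b)) PUnit.unit
    rw [comp_dagger_ofElem] at h1
    constructor
    · intro hr
      exact h1.le (mem_bend.2 ⟨r, hr, rfl⟩)
    · intro hr
      obtain ⟨s, hs, hsr⟩ := mem_bend.1 (h1.ge hr)
      exact bendMap_injective _ _ hsr ▸ hs
  · rintro rfl
    funext ab u
    rw [comp_dagger_ofElem]
    ext f
    refine mem_bend.trans ⟨?_, fun hf => ?_⟩
    · rintro ⟨r, hr, rfl⟩
      exact hr
    · obtain ⟨r, hr, rfl⟩ := exists_component hf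
      exact ⟨r, hr, rfl⟩

end DistanceFunction

/-! ## The ultraweak topology -/

section Ultraweak

open Filter

variable {H : Type u} [NormedAddCommGroup H] [InnerProductSpace ℂ H] [CompleteSpace H]

theorem summable_norm_mul_norm (x y : lp (fun _ : ℕ => H) 2) :
    Summable fun n => ‖x n‖ * ‖y n‖ := by
  refine lp.summable_mul (p := 2) (q := 2) ?_ x y
  norm_num [Real.holderConjugate_iff]

/-- A bounded net that converges in the weak operator topology converges ultraweakly. -/
theorem tendsto_ultraweak {ι : Type*} {l : Filter ι} {A : ι → H →L[ℂ] H} {T : H →L[ℂ] H} {C : ℝ}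
    (hC : ∀ i x y, ‖(inner ℂ x (A i y) : ℂ)‖ ≤ C * (‖x‖ * ‖y‖))
    (hA : ∀ x y, Tendsto (fun i => (inner ℂ x (A i y) : ℂ)) l (𝓝 (inner ℂ x (T y)))) :
    Tendsto A l (@nhds _ (ultraweak H) T) := by
  rw [ultraweak, nhds_iInf, tendsto_iInf]
  intro x
  rw [nhds_iInf, tendsto_iInf]
  intro y
  rw [nhds_induced, tendsto_comap_iff]
  exact tendsto_tsum_of_dominated_convergence ((summable_norm_mul_norm x y).mul_left C)
    (fun n => hA (x n) (y n)) (Eventually.of_forall fun i n => hC i (x n) (y n))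

theorem continuous_inner_apply_ultraweak (x y : H) :
    @Continuous _ _ (ultraweak H) _ fun T : H →L[ℂ] H => (inner ℂ x (T y) : ℂ) := by
  -- A single matrix coefficient is one of the defining functionals, for the sequences with x and y
  -- at index 0 and zeros elsewhere.
  have key : (fun T : H →L[ℂ] H => (inner ℂ x (T y) : ℂ)) = fun T : H →L[ℂ] H =>
      ∑' n, inner ℂ ((lp.single 2 0 x : lp (fun _ : ℕ => H) 2) n)
        (T ((lp.single 2 0 y : lp (fun _ : ℕ => H) 2) n)) := by
    funext T
    rw [tsum_eq_single 0 fun n hn => by rw [lp.single_apply_ne _ _ _ hn, inner_zero_left],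
      lp.single_apply_self, lp.single_apply_self]
  rw [key]
  exact continuous_iInf_dom (continuous_iInf_dom continuous_induced_dom)

theorem continuous_of_inner {S E F : Type*} [TopologicalSpace S] [NormedAddCommGroup E]
    [InnerProductSpace ℂ E] [FiniteDimensional ℂ E] [NormedAddCommGroup F] [InnerProductSpace ℂ F]
    [FiniteDimensional ℂ F] {f : S → E →L[ℂ] F}
    (h : ∀ x y, Continuous fun s => (inner ℂ y (f s x) : ℂ)) : Continuous f := by
  refine continuous_clm_apply.2 fun x => ?_
  have key : (fun s => f s x) = fun s => ∑ i, (inner ℂ (stdOrthonormalBasis ℂ F i) (f s x) : ℂ) •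
      stdOrthonormalBasis ℂ F i := by
    funext s
    exact ((stdOrthonormalBasis ℂ F).sum_repr' (f s x)).symm
  rw [key]
  exact continuous_finsetSum _ fun i _ => (h x _).smul continuous_const

end Ultraweak

/-! ## Compressions of operators on the direct sum of the atoms -/

namespace QSet

open Filter ContinuousLinearMap

variable (X : QSet.{u})

theorem adjoint_inc_apply (a : X.At) (ψ : X.hilbertSum) : adjoint (X.inc a) ψ = ψ a := by
  classical
  refine ext_inner_left ℂ fun x => ?_
  rw [adjoint_inner_right, inc, lp.singleContinuousLinearMap_apply, lp.inner_single_left]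

theorem inc_apply_self (a : X.At) (x : X.H a) : X.inc a x a = x := by
  classical
  rw [inc, lp.singleContinuousLinearMap_apply, lp.single_apply_self]

theorem inc_apply_of_ne {a b : X.At} (h : b ≠ a) (x : X.H a) : X.inc a x b = 0 := by
  classical
  rw [inc, lp.singleContinuousLinearMap_apply, lp.single_apply_ne _ _ _ h]

theorem compress_apply (a b : X.At) (v : X.hilbertSum →L[ℂ] X.hilbertSum) (x : X.H a) :
    X.compress a b v x = v (X.inc a x) b :=
  X.adjoint_inc_apply b _

/-- The extension by zero of an operator between two atoms. -/
noncomputable def extend (a b : X.At) : (X.H a →L[ℂ] X.H b) →ₗ[ℂ] (X.hilbertSum →L[ℂ] X.hilbertSum) where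
  toFun r := X.inc b ∘L r ∘L adjoint (X.inc a)
  map_add' v w := by ext; simp
  map_smul' c v := by ext; simp

theorem extend_apply (a b : X.At) (r : X.H a →L[ℂ] X.H b) (ψ : X.hilbertSum) :
    X.extend a b r ψ = X.inc b (r (ψ a)) :=
  congrArg (fun x => X.inc b (r x)) (X.adjoint_inc_apply a ψ)

theorem compress_extend_self (a b : X.At) (r : X.H a →L[ℂ] X.H b) :
    X.compress a b (X.extend a b r) = r := by
  ext x
  rw [compress_apply, extend_apply, inc_apply_self, inc_apply_self]

theorem compress_extend_of_ne {a b c d : X.At} (r : X.H a →L[ℂ] X.H b) (h : ¬(c = a ∧ d = b)) :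
    X.compress c d (X.extend a b r) = 0 := by
  ext x
  rw [compress_apply, extend_apply, zero_apply]
  by_cases hd : d = b
  · rw [X.inc_apply_of_ne (fun hc => h ⟨hc.symm, hd⟩), map_zero, map_zero]
    rfl
  · exact X.inc_apply_of_ne hd _

theorem adjoint_compress (a b : X.At) (v : X.hilbertSum →L[ℂ] X.hilbertSum) :
    adjoint (X.compress a b v) = X.compress b a (adjoint v) := by
  change adjoint (adjoint (X.inc b) ∘L v ∘L X.inc a) = adjoint (X.inc a) ∘L adjoint v ∘L X.inc b
  rw [adjoint_comp, adjoint_comp, adjoint_adjoint]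
  rfl

/-- The projection onto the sum of finitely many atoms. -/
noncomputable def proj (s : Finset X.At) : X.hilbertSum →L[ℂ] X.hilbertSum :=
  ∑ a ∈ s, X.extend a a (ContinuousLinearMap.id ℂ (X.H a))

theorem proj_apply (s : Finset X.At) (ψ : X.hilbertSum) : X.proj s ψ = ∑ a ∈ s, X.inc a (ψ a) := by
  rw [proj, sum_apply]
  exact Finset.sum_congr rfl fun a _ => X.extend_apply a a _ ψ

theorem norm_proj_apply_le (s : Finset X.At) (ψ : X.hilbertSum) : ‖X.proj s ψ‖ ≤ ‖ψ‖ := by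
  classical
  have h0 : 0 < (2 : ℝ≥0∞).toReal := by norm_num
  have h1 := lp.norm_sum_single h0 (fun a => ψ a) s
  have h2 := lp.sum_rpow_le_norm_rpow h0 ψ s
  rw [← h1] at h2
  rw [proj_apply]
  exact (Real.rpow_le_rpow_iff (norm_nonneg _) (norm_nonneg _) h0).1 h2

theorem tendsto_proj_apply (ψ : X.hilbertSum) :
    Tendsto (fun s => X.proj s ψ) atTop (𝓝 ψ) := by
  classical
  have h := lp.hasSum_single (p := 2) (by norm_num) ψ
  refine Tendsto.congr (fun s => ?_) h
  exact (X.proj_apply s ψ).symm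

theorem inner_proj_left (s : Finset X.At) (φ ψ : X.hilbertSum) :
    inner ℂ φ (X.proj s ψ) = inner ℂ (X.proj s φ) ψ := by
  rw [proj_apply, proj_apply, inner_sum, sum_inner]
  refine Finset.sum_congr rfl fun a _ => ?_
  rw [← adjoint_inner_left, adjoint_inc_apply, ← adjoint_inner_right, adjoint_inc_apply]

theorem proj_mul_mul_proj (s : Finset X.At) (v : X.hilbertSum →L[ℂ] X.hilbertSum) :
    X.proj s * v * X.proj s = ∑ b ∈ s, ∑ a ∈ s, X.extend a b (X.compress a b v) := by
  rw [proj, Finset.sum_mul, Finset.sum_mul]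
  refine Finset.sum_congr rfl fun b _ => ?_
  rw [Finset.mul_sum]
  rfl

theorem compress_mul_proj_mul (s : Finset X.At) (a b : X.At)
    (v w : X.hilbertSum →L[ℂ] X.hilbertSum) :
    X.compress a b (v * X.proj s * w) = ∑ c ∈ s, X.compress c b v ∘L X.compress a c w := by
  rw [proj, Finset.mul_sum, Finset.sum_mul, map_sum]
  rfl

/-- The finite projections are contractions that tend strongly to 1, so the cut-downs converge
weakly and are bounded, hence converge ultraweakly. An ultraweakly closed space is thereby
determined by finite cut-downs. -/
theorem tendsto_proj_mul_mul_proj (v : X.hilbertSum →L[ℂ] X.hilbertSum) :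
    Tendsto (fun s => X.proj s * v * X.proj s) atTop (@nhds _ (ultraweak X.hilbertSum) v) := by
  refine tendsto_ultraweak (C := ‖v‖) (fun s x y => ?_) fun x y => ?_
  · change ‖(inner ℂ x (X.proj s (v (X.proj s y))) : ℂ)‖ ≤ _
    rw [inner_proj_left]
    refine (norm_inner_le_norm _ _).trans ?_
    calc ‖X.proj s x‖ * ‖v (X.proj s y)‖ ≤ ‖x‖ * (‖v‖ * ‖y‖) :=
          mul_le_mul (X.norm_proj_apply_le s x)
            ((v.le_opNorm _).trans (mul_le_mul_of_nonneg_left (X.norm_proj_apply_le s y)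
              (norm_nonneg _))) (norm_nonneg _) (norm_nonneg _)
      _ = ‖v‖ * (‖x‖ * ‖y‖) := by ring
  · refine Tendsto.congr (fun s => (X.inner_proj_left s x (v (X.proj s y))).symm) ?_
    exact (X.tendsto_proj_apply x).inner ((v.continuous.tendsto y).comp (X.tendsto_proj_apply y))

theorem tendsto_mul_proj_mul (v w : X.hilbertSum →L[ℂ] X.hilbertSum) :
    Tendsto (fun s => v * X.proj s * w) atTop (@nhds _ (ultraweak X.hilbertSum) (v * w)) := by
  refine tendsto_ultraweak (C := ‖v‖ * ‖w‖) (fun s x y => ?_) fun x y => ?_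
  · refine (norm_inner_le_norm _ _).trans ?_
    change ‖x‖ * ‖v (X.proj s (w y))‖ ≤ _
    calc ‖x‖ * ‖v (X.proj s (w y))‖ ≤ ‖x‖ * (‖v‖ * (‖w‖ * ‖y‖)) :=
          mul_le_mul_of_nonneg_left ((v.le_opNorm _).trans (mul_le_mul_of_nonneg_left
            ((X.norm_proj_apply_le s _).trans (w.le_opNorm y)) (norm_nonneg _))) (norm_nonneg _)
      _ = ‖v‖ * ‖w‖ * (‖x‖ * ‖y‖) := by ring
  · exact tendsto_const_nhds.inner ((v.continuous.tendsto (w y)).comp (X.tendsto_proj_apply (w y)))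

/-- Matrix coefficients of a compression are matrix coefficients of the operator, and a subspace of
a finite-dimensional space is closed. -/
theorem isClosed_compress (a b : X.At) (W : Submodule ℂ (X.H a →L[ℂ] X.H b)) :
    IsClosed[ultraweak X.hilbertSum]
      {v : X.hilbertSum →L[ℂ] X.hilbertSum | X.compress a b v ∈ W} := by
  have h : @Continuous _ _ (ultraweak X.hilbertSum) _ fun v => X.compress a b v := by
    refine @continuous_of_inner _ _ _ (ultraweak X.hilbertSum) _ _ _ _ _ _ _ fun x y => ?_
    have : (fun v => (inner ℂ y (X.compress a b v x) : ℂ)) =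
        fun v : X.hilbertSum →L[ℂ] X.hilbertSum => inner ℂ (X.inc b y) (v (X.inc a x)) := by
      funext v
      exact adjoint_inner_right (X.inc b) y _
    rw [this]
    exact continuous_inner_apply_ultraweak _ _
  exact @IsClosed.preimage _ _ (ultraweak X.hilbertSum) _ _ h _ W.closed_of_finiteDimensional

theorem hasSum_compress (T : X.hilbertSum →L[ℂ] X.hilbertSum) (ψ : X.hilbertSum) (b : X.At) :
    HasSum (fun a => X.compress a b T (ψ a)) (T ψ b) := by
  classical
  have h := lp.hasSum_single (p := 2) (by norm_num) ψ
  have h1 := h.mapL (adjoint (X.inc b) ∘L T)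
  rw [comp_apply, adjoint_inc_apply] at h1
  exact h1

/-- The commutant of `ℓ^∞(X)` consists of the operators that act on each atom as a scalar. -/
theorem mem_centralizer_linfty_iff (T : X.hilbertSum →L[ℂ] X.hilbertSum) :
    T ∈ X.linfty.centralizer ↔ ∀ a b, X.compress a b T ∈ BRel.id X a b := by
  classical
  rw [Set.mem_centralizer_iff]
  constructor
  · intro h
    -- Operators on one atom, extended by zero, belong to ℓ^∞(X); commuting with these suffices.
    have key : ∀ a (t : X.H a →L[ℂ] X.H a), X.extend a a t * T = T * X.extend a a t := by
      intro a t
      refine h _ ⟨fun b => if hb : b = a then hb ▸ t else 0, ⟨‖t‖, fun b => ?_⟩, fun ψ b => ?_⟩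
      · by_cases hb : b = a
        · subst hb; simp
        · simp [hb]
      · rw [extend_apply]
        by_cases hb : b = a
        · subst hb; simp [inc_apply_self]
        · simp [hb, X.inc_apply_of_ne hb]
    intro a b
    by_cases hab : a = b
    · subst hab
      obtain ⟨x₀, hx₀⟩ := exists_ne (0 : X.H a)
      have hne : (inner ℂ x₀ x₀ : ℂ) ≠ 0 := inner_self_ne_zero.2 hx₀
      refine BRel.mem_id_self.2 ⟨inner ℂ x₀ (X.compress a a T x₀) / inner ℂ x₀ x₀, fun x => ?_⟩
      -- Commuting with the rank one operator y ↦ ⟨x₀, y⟩ x and evaluating at x₀ shows that the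
      -- compression multiplies x by ⟨x₀, T x₀⟩ / ⟨x₀, x₀⟩, which does not depend on x.
      let t : X.H a →L[ℂ] X.H a := (innerSL ℂ x₀).smulRight x
      have h1 := congrArg (fun S : X.hilbertSum →L[ℂ] X.hilbertSum => S (X.inc a x₀) a) (key a t)
      have h2 : t (X.compress a a T x₀) = X.compress a a T (t x₀) := by
        rw [compress_apply, compress_apply]
        have e1 : (X.extend a a t * T) (X.inc a x₀) a = t (T (X.inc a x₀) a) := by
          rw [mul_apply_eq_comp, extend_apply, inc_apply_self]
        have e2 : (T * X.extend a a t) (X.inc a x₀) a = T (X.inc a (t x₀)) a := by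
          rw [mul_apply_eq_comp, extend_apply, inc_apply_self]
        exact e1.symm.trans (h1.trans e2)
      have h3 : (inner ℂ x₀ (X.compress a a T x₀) : ℂ) • x =
          (inner ℂ x₀ x₀ : ℂ) • X.compress a a T x := by
        rw [← map_smul]
        exact h2
      rw [div_eq_inv_mul, mul_smul, h3, smul_smul, inv_mul_cancel₀ hne, one_smul]
    · rw [BRel.id_of_ne hab, Submodule.mem_bot]
      ext x
      have h1 := congrArg (fun S : X.hilbertSum →L[ℂ] X.hilbertSum => S (X.inc a x) b)
        (key b (ContinuousLinearMap.id ℂ _))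
      have e1 : (X.extend b b (ContinuousLinearMap.id ℂ _) * T) (X.inc a x) b =
          T (X.inc a x) b := by
        rw [mul_apply_eq_comp, extend_apply, inc_apply_self]
        rfl
      have e2 : (T * X.extend b b (ContinuousLinearMap.id ℂ _)) (X.inc a x) b = 0 := by
        rw [mul_apply_eq_comp, extend_apply, X.inc_apply_of_ne (Ne.symm hab), map_zero,
          map_zero, map_zero]
        rfl
      rw [compress_apply]
      exact e1.symm.trans (h1.trans e2)
  · intro h
    -- The b-th entry of T ψ is the sum of the compressions applied to all entries of ψ, and only
    -- the diagonal term is nonzero.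
    have hT : ∀ b, ∃ t : ℂ, ∀ ψ : X.hilbertSum, T ψ b = t • ψ b := by
      intro b
      obtain ⟨t, ht⟩ := BRel.mem_id_self.1 (h b b)
      refine ⟨t, fun ψ => ?_⟩
      refine (X.hasSum_compress T ψ b).unique ?_
      rw [← ht]
      refine hasSum_single b fun a ha => ?_
      have h0 := h a b
      rw [BRel.id_of_ne ha, Submodule.mem_bot] at h0
      rw [h0, zero_apply]
    rintro m ⟨t, -, ht⟩
    ext ψ b
    obtain ⟨s, hs⟩ := hT b
    rw [mul_apply_eq_comp, mul_apply_eq_comp, ht, hs, hs, ht, map_smul]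

end QSet

-- Quantum pseudometrics and filtrations between atoms

section
open ContinuousLinearMap Filter

/-- A filtration of the operators between the atoms of a quantum set. -/
structure IsOperatorFiltration {X : QSet.{u}} (U : ℝ≥0 → BRel X X) : Prop where
  id_mem : ∀ a, ContinuousLinearMap.id ℂ (X.H a) ∈ U 0 a a
  adjoint_mem : ∀ β a b, ∀ r ∈ U β a b, adjoint r ∈ U β b a
  comp_mem : ∀ α β a b c, ∀ u ∈ U α a c, ∀ v ∈ U β c b, v ∘L u ∈ U (α + β) a b
  eq_iInf : ∀ α a b, U α a b = ⨅ (β : ℝ≥0) (_ : α < β), U β a b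

namespace IsOperatorFiltration

variable {X : QSet.{u}} {U : ℝ≥0 → BRel X X} (hU : IsOperatorFiltration U)
include hU

theorem mono {α β : ℝ≥0} (h : α ≤ β) (a b : X.At) : U α a b ≤ U β a b := by
  rw [hU.eq_iInf α, hU.eq_iInf β]
  exact le_iInf fun γ => le_iInf fun hγ => iInf₂_le γ (h.trans_lt hγ)

theorem id_rel_le (β : ℝ≥0) (a b : X.At) : BRel.id X a b ≤ U β a b := by
  by_cases hab : a = b
  · subst hab
    intro f hf
    obtain ⟨t, ht⟩ := BRel.mem_id_self.1 hf
    have : f = t • ContinuousLinearMap.id ℂ (X.H a) := ContinuousLinearMap.ext ht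
    rw [this]
    exact Submodule.smul_mem _ _ (hU.mono zero_le a a (hU.id_mem a))
  · rw [BRel.id_of_ne hab]
    exact bot_le

end IsOperatorFiltration

/-- The operators on the direct sum of the atoms whose compressions belong to `U`. -/
noncomputable def ofCompressions {X : QSet.{u}} (U : ℝ≥0 → BRel X X) (β : ℝ≥0) :
    Submodule ℂ (X.hilbertSum →L[ℂ] X.hilbertSum) :=
  ⨅ (a : X.At) (b : X.At), (U β a b).comap (X.compress a b)

theorem mem_ofCompressions {X : QSet.{u}} {U : ℝ≥0 → BRel X X} {β : ℝ≥0}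
    {v : X.hilbertSum →L[ℂ] X.hilbertSum} :
    v ∈ ofCompressions U β ↔ ∀ a b, X.compress a b v ∈ U β a b := by
  simp only [ofCompressions, Submodule.mem_iInf, Submodule.mem_comap]

theorem QSet.compress_one {X : QSet.{u}} (a b : X.At) : X.compress a b 1 ∈ BRel.id X a b := by
  by_cases hab : a = b
  · subst hab
    refine BRel.mem_id_self.2 ⟨1, fun x => ?_⟩
    rw [compress_apply, one_smul]
    exact X.inc_apply_self a x
  · rw [BRel.id_of_ne hab, Submodule.mem_bot]
    ext x
    rw [compress_apply]
    exact X.inc_apply_of_ne (Ne.symm hab) x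

namespace IsOperatorFiltration

variable {X : QSet.{u}} {U : ℝ≥0 → BRel X X} (hU : IsOperatorFiltration U)
include hU

theorem extend_mem {β : ℝ≥0} {a b : X.At} {r : X.H a →L[ℂ] X.H b} (hr : r ∈ U β a b) :
    X.extend a b r ∈ ofCompressions U β := by
  refine mem_ofCompressions.2 fun c d => ?_
  by_cases h : c = a ∧ d = b
  · obtain ⟨rfl, rfl⟩ := h
    rw [X.compress_extend_self]
    exact hr
  · rw [X.compress_extend_of_ne r h]
    exact Submodule.zero_mem _

theorem map_ofCompressions (β : ℝ≥0) (a b : X.At) :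
    (ofCompressions U β).map (X.compress a b) = U β a b := by
  refine le_antisymm (Submodule.map_le_iff_le_comap.2 fun v hv => mem_ofCompressions.1 hv a b)
    fun r hr => ⟨_, hU.extend_mem hr, X.compress_extend_self a b r⟩

theorem isQuantumPseudometric : IsQuantumPseudometric X.linfty (ofCompressions U) where
  isClosed β := by
    have : ((ofCompressions U β : Submodule ℂ _) : Set (X.hilbertSum →L[ℂ] X.hilbertSum)) =
        ⋂ (a : X.At) (b : X.At), {v | X.compress a b v ∈ U β a b} := by
      ext v
      simp only [SetLike.mem_coe, mem_ofCompressions, Set.mem_iInter, Set.mem_ofPred_eq]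
    rw [this]
    exact @isClosed_iInter _ _ (ultraweak X.hilbertSum) _ fun a =>
      @isClosed_iInter _ _ (ultraweak X.hilbertSum) _ fun b => X.isClosed_compress a b _
  one_mem β := mem_ofCompressions.2 fun a b => hU.id_rel_le β a b (X.compress_one a b)
  adjoint_mem β T hT := mem_ofCompressions.2 fun a b => by
    rw [← X.adjoint_compress]
    exact hU.adjoint_mem β b a _ (mem_ofCompressions.1 hT b a)
  mul_mem α β S hS T hT := mem_ofCompressions.2 fun a b => by
    -- The compression of S T runs through infinitely many intermediate atoms. With a finite
    -- projection inserted it is a finite sum of composites of compressions, and the condition is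
    -- ultraweakly closed.
    refine @IsClosed.mem_of_tendsto _ (ultraweak X.hilbertSum) _ _ _ _ _ _
      (X.isClosed_compress a b (U (α + β) a b)) (X.tendsto_mul_proj_mul S T)
      (Eventually.of_forall fun s => ?_)
    change X.compress a b (S * X.proj s * T) ∈ U (α + β) a b
    rw [X.compress_mul_proj_mul, add_comm]
    exact Submodule.sum_mem _ fun c _ => hU.comp_mem β α a b c _ (mem_ofCompressions.1 hT a c) _
      (mem_ofCompressions.1 hS c b)
  eq_iInf α := by
    ext v
    simp only [Submodule.mem_iInf, mem_ofCompressions]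
    constructor
    · exact fun h β hβ a b => hU.mono hβ.le a b (h a b)
    · intro h a b
      rw [hU.eq_iInf]
      simp only [Submodule.mem_iInf]
      exact fun β hβ => h β hβ a b
  commutant_le T hT := mem_ofCompressions.2 fun a b =>
    hU.id_rel_le 0 a b ((X.mem_centralizer_linfty_iff T).1 hT a b)

end IsOperatorFiltration

theorem IsQuantumMetric.iff_le_id {X : QSet.{u}} {U : ℝ≥0 → BRel X X} (hU : IsOperatorFiltration U) :
    IsQuantumMetric X.linfty (ofCompressions U) ↔ ∀ a b, U 0 a b ≤ BRel.id X a b := by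
  constructor
  · intro h a b r hr
    have h1 : X.extend a b r ∈ X.linfty.centralizer := h.eq_commutant ▸ hU.extend_mem hr
    have h2 := (X.mem_centralizer_linfty_iff _).1 h1 a b
    rwa [X.compress_extend_self] at h2
  · intro h
    refine ⟨hU.isQuantumPseudometric, Set.Subset.antisymm (fun T hT => ?_)
      hU.isQuantumPseudometric.commutant_le⟩
    exact (X.mem_centralizer_linfty_iff T).2 fun a b => h a b (mem_ofCompressions.1 hT a b)

/-- The compressions of a family of spaces of operators. -/
noncomputable def compressions {X : QSet.{u}}
    (V : ℝ≥0 → Submodule ℂ (X.hilbertSum →L[ℂ] X.hilbertSum)) (β : ℝ≥0) : BRel X X :=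
  fun a b => (V β).map (X.compress a b)

namespace IsQuantumPseudometric

variable {X : QSet.{u}} {V : ℝ≥0 → Submodule ℂ (X.hilbertSum →L[ℂ] X.hilbertSum)}
  (hV : IsQuantumPseudometric X.linfty V)
include hV

/-- The projection onto an atom commutes with ℓ^∞(X), so it has distance 0. Multiplication by it on
either side keeps every V β invariant, and this gives compressions access to the axioms for V. -/
theorem extend_id_mem (a : X.At) : X.extend a a (ContinuousLinearMap.id ℂ (X.H a)) ∈ V 0 := by
  refine hV.commutant_le ((X.mem_centralizer_linfty_iff _).2 fun c d => ?_)
  by_cases h : c = a ∧ d = a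
  · obtain ⟨rfl, rfl⟩ := h
    rw [X.compress_extend_self]
    exact BRel.mem_id_self.2 ⟨1, fun x => (one_smul ℂ x).symm⟩
  · rw [X.compress_extend_of_ne _ h]
    exact Submodule.zero_mem _

theorem extend_compress_mem {β : ℝ≥0} {v : X.hilbertSum →L[ℂ] X.hilbertSum} (hv : v ∈ V β)
    (a b : X.At) : X.extend a b (X.compress a b v) ∈ V β := by
  have h := hV.mul_mem _ _ _ (hV.mul_mem _ _ _ (hV.extend_id_mem b) _ hv) _ (hV.extend_id_mem a)
  rw [zero_add, add_zero] at h
  exact h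

theorem mem_compressions_iff {β : ℝ≥0} {a b : X.At} {r : X.H a →L[ℂ] X.H b} :
    r ∈ compressions V β a b ↔ X.extend a b r ∈ V β := by
  constructor
  · rintro ⟨v, hv, rfl⟩
    exact hV.extend_compress_mem hv a b
  · exact fun h => ⟨_, h, X.compress_extend_self a b r⟩

/-- If all compressions of v come from V β, then so do the finite cut-downs of v, which are finite
sums of compressions extended by zero; they tend ultraweakly to v, and V β is closed. -/
theorem ofCompressions_compressions : ofCompressions (compressions V) = V := by
  funext β
  ext v
  rw [mem_ofCompressions]
  refine ⟨fun h => ?_, fun hv a b => ⟨v, hv, rfl⟩⟩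
  refine @IsClosed.mem_of_tendsto _ (ultraweak X.hilbertSum) _ _ _ _ _ _
    (hV.isClosed β) (X.tendsto_proj_mul_mul_proj v) (Eventually.of_forall fun s => ?_)
  rw [X.proj_mul_mul_proj]
  exact Submodule.sum_mem _ fun b _ => Submodule.sum_mem _ fun a _ =>
    hV.mem_compressions_iff.1 (h a b)

theorem isOperatorFiltration : IsOperatorFiltration (compressions V) where
  id_mem a := hV.mem_compressions_iff.2 (hV.extend_id_mem a)
  adjoint_mem β a b := by
    rintro _ ⟨v, hv, rfl⟩
    exact ⟨adjoint v, hV.adjoint_mem β v hv, (X.adjoint_compress a b v).symm⟩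
  comp_mem α β a b c := by
    rintro _ ⟨S, hS, rfl⟩ _ ⟨T, hT, rfl⟩
    -- The composite of the compressions is the compression of T S with the projection onto the
    -- intermediate atom c inserted, which costs no distance.
    refine ⟨T * X.extend c c (ContinuousLinearMap.id ℂ (X.H c)) * S, ?_, rfl⟩
    have h := hV.mul_mem _ _ _ (hV.mul_mem _ _ _ hT _ (hV.extend_id_mem c)) _ hS
    rw [add_zero, add_comm] at h
    exact h
  eq_iInf α a b := by
    ext r
    simp only [Submodule.mem_iInf, hV.mem_compressions_iff]
    have h := hV.eq_iInf α
    constructor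
    · intro hr β hβ
      rw [h] at hr
      simp only [Submodule.mem_iInf] at hr
      exact hr β hβ
    · intro hr
      rw [h]
      simpa only [Submodule.mem_iInf] using hr

end IsQuantumPseudometric

/-- Quantum pseudometrics on `ℓ^∞(X)` correspond to filtrations of the operators between atoms. -/
noncomputable def filtrationEquiv (X : QSet.{u}) :
    {U : ℝ≥0 → BRel X X // IsOperatorFiltration U} ≃
      {V : ℝ≥0 → Submodule ℂ (X.hilbertSum →L[ℂ] X.hilbertSum) //
        IsQuantumPseudometric X.linfty V} where
  toFun U := ⟨ofCompressions U.1, U.2.isQuantumPseudometric⟩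
  invFun V := ⟨compressions V.1, V.2.isOperatorFiltration⟩
  left_inv U := Subtype.ext (funext fun β => funext fun a => funext fun b =>
    U.2.map_ofCompressions β a b)
  right_inv V := Subtype.ext V.2.ofCompressions_compressions
end

/-! ## Orthogonal decompositions and filtrations of a finite-dimensional space -/

section Decomposition

variable {E : Type*} [NormedAddCommGroup E] [InnerProductSpace ℂ E]

/-- A decomposition into mutually orthogonal subspaces that are indexed by `[0, ∞]`. -/
structure IsOrthogonalDecomposition (D : ℝ≥0∞ → Submodule ℂ E) : Prop where
  inner_eq_zero : ∀ α β, α ≠ β → ∀ x ∈ D α, ∀ y ∈ D β, inner ℂ x y = 0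
  iSup_eq_top : ⨆ α, D α = ⊤

/-- The components satisfying p and the others have sums that are mutually orthogonal and together
span E. Writing x = k + l accordingly, l is orthogonal both to x and to k, hence to itself. -/
theorem IsOrthogonalDecomposition.mem_iSup_iff {D : ℝ≥0∞ → Submodule ℂ E}
    (hD : IsOrthogonalDecomposition D) {p : ℝ≥0∞ → Prop} {x : E} :
    x ∈ ⨆ (α : ℝ≥0∞) (_ : p α), D α ↔ ∀ α, ¬p α → ∀ y ∈ D α, inner ℂ y x = 0 := by
  have horth : ∀ x ∈ ⨆ (α : ℝ≥0∞) (_ : p α), D α, ∀ α, ¬p α → ∀ y ∈ D α, inner ℂ y x = 0 := by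
    intro x hx α hα
    have hle : ⨆ (α : ℝ≥0∞) (_ : p α), D α ≤ (D α)ᗮ := iSup₂_le fun β hβ z hz =>
      (Submodule.mem_orthogonal _ _).2 fun y hy =>
        hD.inner_eq_zero α β (fun h => hα (h ▸ hβ)) y hy z hz
    exact (Submodule.mem_orthogonal _ _).1 (hle hx)
  refine ⟨horth x, fun h => ?_⟩
  have htop : (⨆ (α : ℝ≥0∞) (_ : p α), D α) ⊔ (⨆ (α : ℝ≥0∞) (_ : ¬p α), D α) = ⊤ := by
    refine eq_top_iff.2 (hD.iSup_eq_top ▸ iSup_le fun α => ?_)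
    by_cases hα : p α
    · exact le_sup_of_le_left (le_iSup₂_of_le α hα le_rfl)
    · exact le_sup_of_le_right (le_iSup₂_of_le α hα le_rfl)
  obtain ⟨k, hk, l, hl, rfl⟩ := Submodule.mem_sup.1 (htop ▸ Submodule.mem_top : x ∈ _)
  have h1 : ∀ z, (∀ α, ¬p α → ∀ y ∈ D α, inner ℂ y z = 0) → inner ℂ l z = 0 := by
    intro z hz
    have hle : ⨆ (α : ℝ≥0∞) (_ : ¬p α), D α ≤ (ℂ ∙ z)ᗮ := iSup₂_le fun α hα y hy =>
      Submodule.mem_orthogonal_singleton_iff_inner_left.2 (hz α hα y hy)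
    exact Submodule.mem_orthogonal_singleton_iff_inner_left.1 (hle hl)
  have h2 := h1 _ h
  rw [inner_add_right, h1 k (horth k hk), zero_add, inner_self_eq_zero] at h2
  rw [h2, add_zero]
  exact hk

/-- The extension of a filtration to the index set `[0, ∞]`. -/
noncomputable def extendLevels (W : ℝ≥0 → Submodule ℂ E) (α : ℝ≥0∞) : Submodule ℂ E :=
  ⨅ (β : ℝ≥0) (_ : α ≤ β), W β

/-- The part of the filtration `W` that is new at `α`. -/
noncomputable def jumps (W : ℝ≥0 → Submodule ℂ E) (α : ℝ≥0∞) : Submodule ℂ E :=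
  extendLevels W α ⊓ (⨆ (β : ℝ≥0) (_ : (β : ℝ≥0∞) < α), W β)ᗮ

theorem mem_jumps {W : ℝ≥0 → Submodule ℂ E} {α : ℝ≥0∞} {x : E} :
    x ∈ jumps W α ↔ (∀ β : ℝ≥0, α ≤ β → x ∈ W β) ∧
      ∀ β : ℝ≥0, (β : ℝ≥0∞) < α → ∀ y ∈ W β, inner ℂ y x = 0 := by
  rw [jumps, Submodule.mem_inf, extendLevels]
  simp only [Submodule.mem_iInf]
  refine and_congr_right fun _ => ⟨fun h β hβ y hy => ?_, fun h => ?_⟩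
  · exact (Submodule.mem_orthogonal _ _).1 h y
      (Submodule.mem_iSup_of_mem β (Submodule.mem_iSup_of_mem hβ hy))
  · have hle : ⨆ (β : ℝ≥0) (_ : (β : ℝ≥0∞) < α), W β ≤ (ℂ ∙ x)ᗮ := iSup₂_le fun β hβ y hy =>
      Submodule.mem_orthogonal_singleton_iff_inner_left.2 (h β hβ y hy)
    exact (Submodule.mem_orthogonal _ _).2 fun y hy =>
      Submodule.mem_orthogonal_singleton_iff_inner_left.1 (hle hy)

/-- An element of the jump at α is orthogonal to D γ for γ < α because it is orthogonal to the
levels below α, and for γ > α because it belongs to the level at α, which is then a finite index. -/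
theorem jumps_levels {D : ℝ≥0∞ → Submodule ℂ E} (hD : IsOrthogonalDecomposition D) (α : ℝ≥0∞) :
    jumps (fun β => ⨆ (γ : ℝ≥0∞) (_ : γ ≤ β), D γ) α = D α := by
  have h : D α = ⨆ (γ : ℝ≥0∞) (_ : γ = α), D γ := by rw [iSup_iSup_eq_left]
  ext x
  rw [mem_jumps]
  constructor
  · rintro ⟨h1, h2⟩
    rw [h]
    refine hD.mem_iSup_iff.2 fun γ hγ y hy => ?_
    rcases lt_or_gt_of_ne hγ with hlt | hgt
    · lift γ to ℝ≥0 using (hlt.trans_le le_top).ne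
      exact h2 γ hlt y (Submodule.mem_iSup_of_mem _ (Submodule.mem_iSup_of_mem le_rfl hy))
    · lift α to ℝ≥0 using (hgt.trans_le le_top).ne
      exact hD.mem_iSup_iff.1 (h1 α le_rfl) γ (not_le.2 hgt) y hy
  · intro hx
    refine ⟨fun β hβ => Submodule.mem_iSup_of_mem _ (Submodule.mem_iSup_of_mem hβ hx),
      fun β hβ y hy => ?_⟩
    rw [← inner_conj_symm, hD.mem_iSup_iff.1 hy α (not_le.2 hβ) x hx, map_zero]

/-- Right continuity: for γ > α there is a finite β with α < β < γ, and the level at β is already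
orthogonal to D γ. -/
theorem levels_eq_iInf {D : ℝ≥0∞ → Submodule ℂ E} (hD : IsOrthogonalDecomposition D) (α : ℝ≥0) :
    ⨆ (γ : ℝ≥0∞) (_ : γ ≤ α), D γ = ⨅ (β : ℝ≥0) (_ : α < β), ⨆ (γ : ℝ≥0∞) (_ : γ ≤ β), D γ := by
  refine le_antisymm (le_iInf₂ fun β hβ => iSup₂_mono' fun γ hγ =>
    ⟨γ, hγ.trans (ENNReal.coe_le_coe.2 hβ.le), le_rfl⟩) fun x hx => ?_
  simp only [Submodule.mem_iInf] at hx
  refine hD.mem_iSup_iff.2 fun γ hγ y hy => ?_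
  obtain ⟨β, h1, h2⟩ := ENNReal.lt_iff_exists_nnreal_btwn.1 (not_le.1 hγ)
  exact hD.mem_iSup_iff.1 (hx β (ENNReal.coe_lt_coe.1 h1)) γ (not_le.2 h2) y hy

section Filtration

variable {W : ℝ≥0 → Submodule ℂ E} (hW : ∀ α, W α = ⨅ (β : ℝ≥0) (_ : α < β), W β)
include hW

theorem monotone_of_eq_iInf : Monotone W := fun α β h => by
  rw [hW α, hW β]
  exact le_iInf₂ fun γ hγ => iInf₂_le γ (h.trans_lt hγ)

theorem extendLevels_coe (α : ℝ≥0) : extendLevels W α = W α := by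
  refine le_antisymm (iInf₂_le α (le_refl (α : ℝ≥0∞))) (le_iInf₂ fun β h => ?_)
  exact monotone_of_eq_iInf hW (ENNReal.coe_le_coe.1 h)

omit hW in
theorem extendLevels_mono : Monotone (extendLevels W) := fun _ _ h =>
  le_iInf₂ fun γ hγ => iInf₂_le γ (h.trans hγ)

/-- Induction on the dimension of the level. Let σ be the least index at which the level is the same
as at α. Below σ the levels have smaller dimension, so they are covered by jumps; the complement of
their sum within the level at σ is the jump at σ. -/
theorem extendLevels_le [FiniteDimensional ℂ E] (n : ℕ) :
    ∀ α, Module.finrank ℂ (extendLevels W α) = n →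
      extendLevels W α ≤ ⨆ (γ : ℝ≥0∞) (_ : γ ≤ α), jumps W γ := by
  induction n using Nat.strong_induction_on with
  | _ n ih =>
  intro α hn
  let s : Set ℝ≥0∞ := {γ | extendLevels W γ = extendLevels W α}
  have hs : sInf s ≤ α := sInf_le rfl
  -- Right continuity shows that the infimum is attained: every level strictly after σ contains the
  -- level at some index in s.
  have hs' : extendLevels W (sInf s) = extendLevels W α := by
    refine le_antisymm (extendLevels_mono hs) ?_
    rcases hs.eq_or_lt with h | h
    · rw [h]
    · obtain ⟨σ, hσ⟩ : ∃ σ : ℝ≥0, (σ : ℝ≥0∞) = sInf s := ⟨_, ENNReal.coe_toNNReal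
        (h.trans_le le_top).ne⟩
      rw [← hσ, extendLevels_coe hW, hW]
      refine le_iInf₂ fun β hβ => ?_
      obtain ⟨γ, hγ, hγβ⟩ := sInf_lt_iff.1 (hσ ▸ ENNReal.coe_lt_coe.2 hβ)
      rw [← hγ, ← extendLevels_coe hW]
      exact extendLevels_mono hγβ.le
  have hlt : ⨆ (β : ℝ≥0) (_ : (β : ℝ≥0∞) < sInf s), W β ≤ extendLevels W (sInf s) :=
    iSup₂_le fun β hβ => extendLevels_coe hW β ▸ extendLevels_mono hβ.le
  rw [← hs', ← Submodule.sup_orthogonal_inf_of_hasOrthogonalProjection hlt]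
  refine sup_le (iSup₂_le fun β hβ => ?_) ?_
  · have hne : extendLevels W β ≠ extendLevels W α := fun h => not_lt.2 (sInf_le (a := (β : ℝ≥0∞)) (s := s) h) hβ
    have h1 := Submodule.finrank_lt_finrank_of_lt
      ((extendLevels_mono (hβ.le.trans hs)).lt_of_ne hne)
    rw [← extendLevels_coe hW]
    exact (ih _ (hn ▸ h1) β rfl).trans (iSup₂_mono' fun γ hγ =>
      ⟨γ, hγ.trans (hβ.le.trans hs), le_rfl⟩)
  · rw [inf_comm]
    exact le_iSup₂_of_le (sInf s) hs le_rfl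

theorem iSup_jumps [FiniteDimensional ℂ E] (α : ℝ≥0∞) :
    ⨆ (γ : ℝ≥0∞) (_ : γ ≤ α), jumps W γ = extendLevels W α :=
  le_antisymm (iSup₂_le fun _ h => inf_le_left.trans (extendLevels_mono h))
    (extendLevels_le hW _ α rfl)

theorem isOrthogonalDecomposition_jumps [FiniteDimensional ℂ E] :
    IsOrthogonalDecomposition (jumps W) := by
  have key : ∀ α β, α < β → ∀ x ∈ jumps W α, ∀ y ∈ jumps W β, inner ℂ x y = 0 := by
    intro α β h x hx y hy
    lift α to ℝ≥0 using (h.trans_le le_top).ne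
    exact (mem_jumps.1 hy).2 α h x ((mem_jumps.1 hx).1 α le_rfl)
  refine ⟨fun α β h x hx y hy => ?_, ?_⟩
  · rcases lt_or_gt_of_ne h with h | h
    · exact key α β h x hx y hy
    · rw [← inner_conj_symm, key β α h y hy x hx, map_zero]
  · have h := iSup_jumps hW ⊤
    simp only [le_top, iSup_pos] at h
    rw [h]
    -- No finite β is at least ∞, so the level at ∞ is an empty infimum, the whole space. The jump
    -- at ∞ thus absorbs whatever the finite levels miss.
    exact iInf₂_eq_top.2 fun β hβ => absurd hβ (not_le.2 ENNReal.coe_lt_top)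

end Filtration

end Decomposition

-- Assembly of the correspondence

namespace DistanceFunction
open BRel ContinuousLinearMap

variable {X : QSet.{u}}

/-- The sum of the components of `F` for distances at most `β`. -/
noncomputable def levels (F : BRel (X.prod X.dual) QSet.dist) (β : ℝ≥0) : BRel X X := fun a b =>
  ⨆ (α : ℝ≥0∞) (_ : α ≤ β), component F α a b

/-- The images of `U` in the dual spaces of the products of the atoms. -/
noncomputable abbrev bendLevels (U : ℝ≥0 → BRel X X) (a b : X.At) (β : ℝ≥0) :
    Submodule ℂ (StrongDual ℂ (X.H a ⊗[ℂ] DualSpace (X.H b))) :=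
  (U β a b).map (bendMap (X.H a) (X.H b))

/-- The binary relation whose components are the jumps of the filtration `U`. -/
noncomputable def ofLevels (U : ℝ≥0 → BRel X X) : BRel (X.prod X.dual) QSet.dist := fun ab α =>
  jumps (bendLevels U ab.1 ab.2) α.down

theorem isDecomposition_iff (F : BRel (X.prod X.dual) QSet.dist) : IsDecomposition F ↔
    ∀ a b, IsOrthogonalDecomposition fun α => slice F a b ⟨α⟩ := by
  have hsup : ∀ a b, ⨆ α : ℝ≥0∞, slice F a b ⟨α⟩ = ⨆ α, slice F a b α := fun a b =>
    Equiv.ulift.symm.iSup_comp (g := slice F a b)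
  constructor
  · intro h a b
    refine ⟨fun α β hαβ => h.inner_eq_zero a b _ _ fun e => hαβ (congrArg ULift.down e), ?_⟩
    rw [hsup, h.iSup_eq_top]
  · intro h
    refine ⟨fun a b α β hαβ => (h a b).inner_eq_zero α.down β.down fun e => hαβ (ULift.ext _ _ e),
      fun a b => ?_⟩
    rw [← hsup, (h a b).iSup_eq_top]

theorem bendLevels_levels (F : BRel (X.prod X.dual) QSet.dist) (a b : X.At) (β : ℝ≥0) :
    bendLevels (levels F) a b β = ⨆ (α : ℝ≥0∞) (_ : α ≤ β), slice F a b ⟨α⟩ := by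
  have h := comap_iSup_slice F (fun α => α ≤ (β : ℝ≥0∞)) a b
  refine (congrArg (Submodule.map (bendMap (X.H a) (X.H b))) h.symm).trans ?_
  exact Submodule.map_comap_eq_of_surjective bendMap_surjective _

theorem ofLevels_levels {F : BRel (X.prod X.dual) QSet.dist} (hF : IsDecomposition F) :
    ofLevels (levels F) = F := by
  funext ab α
  have h : bendLevels (levels F) ab.1 ab.2 = _ := funext fun β => bendLevels_levels F ab.1 ab.2 β
  have h1 := jumps_levels ((isDecomposition_iff F).1 hF ab.1 ab.2) α.down
  exact (congrArg (fun W => jumps W α.down) h).trans h1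

theorem levels_eq_iInf {F : BRel (X.prod X.dual) QSet.dist} (hF : IsDecomposition F) (α : ℝ≥0)
    (a b : X.At) : levels F α a b = ⨅ (β : ℝ≥0) (_ : α < β), levels F β a b := by
  refine Submodule.map_injective_of_injective (bendMap_injective (X.H a) (X.H b)) ?_
  refine (bendLevels_levels F a b α).trans ?_
  rw [_root_.levels_eq_iInf ((isDecomposition_iff F).1 hF a b)]
  refine Submodule.comap_injective_of_surjective bendMap_surjective ?_
  rw [Submodule.comap_map_eq_of_injective (bendMap_injective (X.H a) (X.H b))]
  simp only [Submodule.comap_iInf]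
  exact iInf_congr fun β => iInf_congr fun _ => comap_iSup_slice F (fun γ => γ ≤ (β : ℝ≥0∞)) a b

section OfLevels

variable {U : ℝ≥0 → BRel X X}
  (hU : ∀ α a b, U α a b = ⨅ (β : ℝ≥0) (_ : α < β), U β a b)
include hU

theorem bendLevels_eq_iInf (a b : X.At) (α : ℝ≥0) :
    bendLevels U a b α = ⨅ (β : ℝ≥0) (_ : α < β), bendLevels U a b β := by
  refine Submodule.comap_injective_of_surjective bendMap_surjective ?_
  simp only [Submodule.comap_iInf]
  refine (Submodule.comap_map_eq_of_injective (bendMap_injective (X.H a) (X.H b)) _).trans ?_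
  rw [hU]
  exact iInf_congr fun β => iInf_congr fun _ =>
    (Submodule.comap_map_eq_of_injective (bendMap_injective (X.H a) (X.H b)) _).symm

theorem isDecomposition_ofLevels : IsDecomposition (ofLevels U) :=
  (isDecomposition_iff _).2 fun a b => isOrthogonalDecomposition_jumps (bendLevels_eq_iInf hU a b)

theorem levels_ofLevels : levels (ofLevels U) = U := by
  funext β a b
  refine (comap_iSup_slice (ofLevels U) (fun α => α ≤ (β : ℝ≥0∞)) a b).symm.trans ?_
  have h := (iSup_jumps (bendLevels_eq_iInf hU a b) β).trans
    (extendLevels_coe (bendLevels_eq_iInf hU a b) β)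
  refine (congrArg (Submodule.comap (bendMap (X.H a) (X.H b))) h).trans ?_
  exact Submodule.comap_map_eq_of_injective (bendMap_injective (X.H a) (X.H b)) _

end OfLevels

theorem component_le_levels (F : BRel (X.prod X.dual) QSet.dist) {α : ℝ≥0∞} {β : ℝ≥0}
    (h : α ≤ β) (a b : X.At) : component F α a b ≤ levels F β a b :=
  le_iSup₂_of_le α h le_rfl

theorem levels_zero (F : BRel (X.prod X.dual) QSet.dist) (a b : X.At) :
    levels F 0 a b = component F 0 a b := by
  simp only [levels, ENNReal.coe_zero, nonpos_iff_eq_zero, iSup_iSup_eq_left]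

/-- The components are expressed through the levels and the inner product alone, so any symmetry of
the levels that preserves orthogonality is one of the components. -/
theorem mem_component_iff {F : BRel (X.prod X.dual) QSet.dist} (hF : IsDecomposition F)
    {α : ℝ≥0∞} {a b : X.At} {r : X.H a →L[ℂ] X.H b} :
    r ∈ component F α a b ↔ (∀ β : ℝ≥0, α ≤ β → r ∈ levels F β a b) ∧
      ∀ β : ℝ≥0, (β : ℝ≥0∞) < α → ∀ s ∈ levels F β a b,
        inner ℂ (bendMap (X.H a) (X.H b) s) (bendMap (X.H a) (X.H b) r) = 0 := by
  have h : slice F a b ⟨α⟩ = jumps (bendLevels (levels F) a b) α :=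
    (congrFun (congrFun (ofLevels_levels hF) (a, b)) ⟨α⟩).symm
  rw [mem_component]
  refine (Submodule.mem_iff_of_eq h).trans (mem_jumps.trans (and_congr ?_ ?_))
  · exact forall₂_congr fun β _ =>
      ⟨fun ⟨s, hs, e⟩ => bendMap_injective _ _ e ▸ hs, fun hr => ⟨r, hr, rfl⟩⟩
  · exact forall₂_congr fun β _ =>
      ⟨fun h s hs => h _ ⟨s, hs, rfl⟩, by rintro h _ ⟨s, hs, rfl⟩; exact h s hs⟩

/-- Sums of components inherit invariance by linearity. For the converse, a component is cut out of
the levels by orthogonality, which the antiunitary adjoint map preserves. -/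
theorem adjoint_mem_iff {F : BRel (X.prod X.dual) QSet.dist} (hF : IsDecomposition F) :
    (∀ α a b, ∀ r ∈ component F α a b, adjoint r ∈ component F α b a) ↔
      ∀ β a b, ∀ r ∈ levels F β a b, adjoint r ∈ levels F β b a := by
  constructor
  · intro h β a b
    have hle : levels F β a b ≤ (levels F β b a).comap
        (adjoint (𝕜 := ℂ) (E := X.H a) (F := X.H b)).toLinearEquiv.toLinearMap :=
      iSup₂_le fun α hα r hr => component_le_levels F hα b a (h α a b r hr)
    exact fun r hr => hle hr
  · intro h α a b r hr
    obtain ⟨h1, h2⟩ := (mem_component_iff hF).1 hr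
    refine (mem_component_iff hF).2 ⟨fun β hβ => h β a b r (h1 β hβ), fun β hβ s hs => ?_⟩
    have h3 := h2 β hβ _ (h β b a s hs)
    rw [← adjoint_adjoint s, inner_bendMap_adjoint, ← inner_conj_symm, h3, map_zero]

theorem comp_mem_iff {F : BRel (X.prod X.dual) QSet.dist} (hF : IsDecomposition F) :
    (∀ β₁ β₂ a b c, ∀ u ∈ component F β₁ a c, ∀ v ∈ component F β₂ c b,
      v ∘L u ∈ ⨆ (α : ℝ≥0∞) (_ : α ≤ β₁ + β₂), component F α a b) ↔
      ∀ α β a b c, ∀ u ∈ levels F α a c, ∀ v ∈ levels F β c b, v ∘L u ∈ levels F (α + β) a b := by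
  constructor
  · intro h α β a b c
    have h1 : ∀ γ : ℝ≥0∞, γ ≤ α → ∀ u ∈ component F γ a c, ∀ v ∈ levels F β c b,
        v ∘L u ∈ levels F (α + β) a b := by
      intro γ hγ u hu
      have hle : levels F β c b ≤ (levels F (α + β) a b).comap
          ((compL ℂ (X.H a) (X.H c) (X.H b)).flip u).toLinearMap := by
        refine iSup₂_le fun δ hδ v hv => ?_
        have hle' : ⨆ (ε : ℝ≥0∞) (_ : ε ≤ γ + δ), component F ε a b ≤ levels F (α + β) a b :=
          iSup₂_le fun ε hε => component_le_levels F
            (by rw [ENNReal.coe_add]; exact hε.trans (add_le_add hγ hδ)) a b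
        exact hle' (h γ δ a b c u hu v hv)
      exact fun v hv => hle hv
    intro u hu v hv
    have hle : levels F α a c ≤ (levels F (α + β) a b).comap
        (compL ℂ (X.H a) (X.H c) (X.H b) v).toLinearMap :=
      iSup₂_le fun γ hγ u hu => h1 γ hγ u hu v hv
    exact hle hu
  · intro h β₁ β₂ a b c u hu v hv
    -- The levels have only finite indices. If the bound is infinite there is nothing to prove,
    -- since all components together span the space of operators.
    by_cases hβ : β₁ + β₂ = ⊤
    · have h1 := comap_iSup_slice F (fun α => α ≤ β₁ + β₂) a b
      rw [← h1, hβ]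
      simp only [le_top, iSup_pos]
      rw [((isDecomposition_iff F).1 hF a b).iSup_eq_top]
      exact Submodule.mem_top
    · obtain ⟨hβ₁, hβ₂⟩ := ENNReal.add_ne_top.1 hβ
      lift β₁ to ℝ≥0 using hβ₁
      lift β₂ to ℝ≥0 using hβ₂
      have h1 := h β₁ β₂ a b c u (component_le_levels F le_rfl a c hu) v
        (component_le_levels F le_rfl c b hv)
      rwa [levels, ENNReal.coe_add] at h1

theorem isDistanceFunction_iff (F : BRel (X.prod X.dual) QSet.dist) :
    IsDistanceFunction F ↔ IsDecomposition F ∧ IsOperatorFiltration (levels F) := by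
  constructor
  · intro h
    have hF := (isFunction_iff_isDecomposition F).1 h.isFunction
    exact ⟨hF, fun a => levels_zero F a a ▸ (isTrue_zeroSelfDistance F).1 h.zeroSelfDistance a,
      (adjoint_mem_iff hF).1 ((isTrue_symmetry hF).1 h.symmetry),
      (comp_mem_iff hF).1 ((isTrue_triangle hF).1 h.triangle), levels_eq_iInf hF⟩
  · rintro ⟨hF, hU⟩
    exact ⟨(isFunction_iff_isDecomposition F).2 hF,
      (isTrue_zeroSelfDistance F).2 fun a => levels_zero F a a ▸ hU.id_mem a,
      (isTrue_symmetry hF).2 ((adjoint_mem_iff hF).2 hU.adjoint_mem),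
      (isTrue_triangle hF).2 ((comp_mem_iff hF).2 hU.comp_mem)⟩

/-- Distance functions correspond to filtrations of the operators between atoms. -/
noncomputable def levelsEquiv (X : QSet.{u}) :
    {F : BRel (X.prod X.dual) QSet.dist // IsDistanceFunction F} ≃
      {U : ℝ≥0 → BRel X X // IsOperatorFiltration U} where
  toFun F := ⟨levels F.1, ((isDistanceFunction_iff F.1).1 F.2).2⟩
  invFun U := ⟨ofLevels U.1, (isDistanceFunction_iff _).2 ⟨isDecomposition_ofLevels U.2.eq_iInf,
    (levels_ofLevels U.2.eq_iInf).symm ▸ U.2⟩⟩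
  left_inv F := Subtype.ext (ofLevels_levels ((isDistanceFunction_iff F.1).1 F.2).1)
  right_inv U := Subtype.ext (levels_ofLevels U.2.eq_iInf)

theorem distanceCorresponds_iff (F : BRel (X.prod X.dual) QSet.dist)
    (V : ℝ≥0 → Submodule ℂ (X.hilbertSum →L[ℂ] X.hilbertSum)) :
    DistanceCorresponds F V ↔ levels F = compressions V := by
  constructor
  · rintro ⟨R, hR, h⟩
    have : R = component F := funext fun α => (bend_eq_iff F α (R α)).1 (hR α)
    subst this
    exact funext fun β => funext fun a => funext fun b => h β a b
  · intro h
    exact ⟨component F, fun α => (bend_eq_iff F α _).2 rfl,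
      fun β a b => congrFun (congrFun (congrFun h β) a) b⟩

end DistanceFunction

theorem mainTheorem8 (X : QSet.{u}) :
    ∃ Φ : {F : BRel (X.prod X.dual) QSet.dist // IsDistanceFunction F} ≃
        {V : ℝ≥0 → Submodule ℂ (X.hilbertSum →L[ℂ] X.hilbertSum) //
          IsQuantumPseudometric X.linfty V},
      (∀ F V, Φ F = V ↔ DistanceCorresponds F.1 V.1) ∧
      ∀ F, (DistanceFunction.separation F.1).IsTrue ↔ IsQuantumMetric X.linfty (Φ F).1 := by
  refine ⟨(DistanceFunction.levelsEquiv X).trans (filtrationEquiv X), fun F V => ?_, fun F => ?_⟩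
  · rw [DistanceFunction.distanceCorresponds_iff, Equiv.trans_apply, ← Equiv.eq_symm_apply]
    exact Subtype.ext_iff
  · refine (DistanceFunction.isTrue_separation F.1).trans (Iff.trans ?_
      (IsQuantumMetric.iff_le_id ((DistanceFunction.isDistanceFunction_iff F.1).1 F.2).2).symm)
    -- No distance is below 0, so the level at 0 is the single component R_0, and separation and V_0
    -- = M' are the same inclusion.
    simp only [DistanceFunction.levels_zero]
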